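/- For $\beta\in(0,1]$ let $f_\beta(x)=\frac1\beta\tanh^{-1}(\beta\tanh x)$, let $f_0=\tanh$, and let $\ell(v,y)=\log(1+e^{-2vy})$ be the logistic loss. Let $n\ge 1$, let $X$ be a random vector in $\mathbb{R}^n$ with $\|X\|_\infty\le 1$ almost surely, let $Y$ be a $\{\pm1\}$-valued random variable, and suppose that $\mathbb{E}[Y\mid X]=\tanh(v^*(X))$, where $$v^*(x)=b^{(1)}+\sum_j w_j\, f_{\beta_j}\Big(b^{(2)}_j+\sum_k W_{jk}x_k\Big),$$ with finitely many hidden units $j$, $\beta_j\in[0,1]$, and real $b^{(1)}$, $b^{(2)}_j$, $w_j$, $W_{jk}$. Write $W_j=(W_{jk})_k$ for the weights into hidden unit $j$, and suppose that $\|W_j\|_1\le\lambda$ for every $j$, where $\lambda\ge 2$. For an integer $D\ge1$ let $\varphi_D(x)$ be the vector of all monomials in $x_1,\dots,x_n$ of total degree at most $D$ (repeated factors allowed). Given i.i.d. copies $(X_1,Y_1),\dots,(X_m,Y_m)$ of $(X,Y)$, $\ell_1$-constrained regression with constraint $R$ and tolerance $\tau\ge 0$ asks for a $\hat w$ with $\|\hat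 w\|_1\le R$ whose empirical loss $\frac1m\sum_i\ell(\hat w\cdot\varphi_D(X_i),Y_i)$ is within $\tau$ of the minimum over $\{u : \|u\|_1\le R\}$. There are universal constants $a,c,C>0$ and $K\in\mathbb{N}$, and one algorithm $A$ on a real random access machine (unit-cost arithmetic and comparison on reals, addition, truncated subtraction and comparison on natural numbers, no exponentials), such that the following holds for all $\epsilon>0$, all $\delta\in(0,1)$, every integer $D\ge 1$ with $$D\ge c\,\lambda\log\big(\max(1,\|w\|_1)\,\lambda/\epsilon\big),$$ so that one may take $D=O(\lambda\log(\|w\|_1\lambda/\epsilon))$ when $\|w\|_1\ge 1\ge\epsilon$, and every $$m\ge C\big(|b^{(1)}|^2+\lambda^{CD}\big)\log(2n/\delta).$$ Put $R=\lambda^{aD}$. 1. With probability at least $1-\delta$ over the sample, every solution $\hat w$ of $\ell_1$-constrained regression with constraint $R$ and tolerance $\epsilon/4$ (in particular every exact minimizer) satisfies $$\mathbb{E}[\ell(\hat w\cdot\varphi_D(X),Y)]-\mathbb{E}[\ell(v^*(X),Y)]\le\epsilon .$$ 2. For every sample in $([-1,1]^n\times\{\pm1\})^m$, the algorithm $A$,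 given $n$, $D$, $m$, $R$, $\epsilon/4$ and the sample, outputs such a solution $\hat w$ after at most $K(m\,n^D)^K$ steps, that is, in time polynomial in $n^D$ and the number of samples $m$. -/

import Mathlib

open MeasureTheory ProbabilityTheory

noncomputable section

namespace RBMRegression

/-! ### Two-layer networks and the logistic loss -/

/-- The activation `f_β(x) = β⁻¹ artanh (β tanh x)`, with its limit `tanh` at `β = 0`. -/
def activation (β x : ℝ) : ℝ :=
  if β = 0 then Real.tanh x else (1 / β) * Real.artanh (β * Real.tanh x)

/-- The real parameters of a two-layer network with `n` inputs and `N` hidden units; `W j` is the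
vector of weights entering the hidden unit `j`. -/
structure Network (n N : ℕ) where
  bias : ℝ
  w : Fin N → ℝ
  β : Fin N → ℝ
  hiddenBias : Fin N → ℝ
  W : Fin N → Fin n → ℝ

namespace Network

variable {n N : ℕ}

/-- `v*(x) = b⁽¹⁾ + ∑ j, w_j f_{β_j} (b⁽²⁾_j + ∑ k, W_{jk} x_k)`, the input of the top `tanh`. -/
def preactivation (net : Network n N) (x : Fin n → ℝ) : ℝ :=
  net.bias + ∑ j, net.w j * activation (net.β j) (net.hiddenBias j + ∑ k, net.W j k * x k)

/-- The `ℓ₁` norm of the top-layer weights. -/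
def topNorm (net : Network n N) : ℝ := ∑ j, |net.w j|

end Network

/-- The logistic loss `ℓ(v, y) = log (1 + exp (-2 v y))`. -/
def logisticLoss (v y : ℝ) : ℝ := Real.log (1 + Real.exp (-2 * v * y))

/-- `P` is the law of a pair `(X, Y)` with `‖X‖_∞ ≤ 1` and `Y ∈ {±1}` almost surely, and
`E[Y | X] = tanh (v*(X))`. -/
structure IsNetworkLaw {n N : ℕ} (net : Network n N) (P : Measure ((Fin n → ℝ) × ℝ)) : Prop where
  input_bounded : ∀ᵐ z ∂P, ∀ k, |z.1 k| ≤ 1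
  label_sign : ∀ᵐ z ∂P, z.2 = 1 ∨ z.2 = -1
  condExp_label :
    P[(fun z => z.2) | MeasurableSpace.comap Prod.fst inferInstance] =ᵐ[P]
      fun z => Real.tanh (net.preactivation z.1)

/-! ### `ℓ₁`-constrained logistic regression on monomial features

A coefficient vector on the monomials of degree at most `D` in `n` variables is a polynomial of
total degree at most `D`; its inner product with the feature vector of `x` is its value at `x`. -/

/-- The `ℓ₁` norm of the coefficient vector. -/
def coeffNorm {n : ℕ} (p : MvPolynomial (Fin n) ℝ) : ℝ := ∑ α ∈ p.support, |p.coeff α|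

/-- Coefficient vectors on the degree-`D` feature map with `ℓ₁` norm at most `R`. -/
def Feasible {n : ℕ} (D : ℕ) (R : ℝ) (p : MvPolynomial (Fin n) ℝ) : Prop :=
  p.totalDegree ≤ D ∧ coeffNorm p ≤ R

/-- The expected logistic loss of the predictor `v`. -/
def risk {n : ℕ} (P : Measure ((Fin n → ℝ) × ℝ)) (v : (Fin n → ℝ) → ℝ) : ℝ :=
  ∫ z, logisticLoss (v z.1) z.2 ∂P

/-- The average logistic loss of the predictor `v` on a sample. -/
def empiricalRisk {n m : ℕ} (S : Fin m → (Fin n → ℝ) × ℝ) (v : (Fin n → ℝ) → ℝ) : ℝ :=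
  (1 / (m : ℝ)) * ∑ i, logisticLoss (v (S i).1) (S i).2

/-- `p` solves the `ℓ₁`-constrained logistic regression problem on the sample `S` up to an additive
error `τ` in the objective. For `τ = 0` this is an exact solution. -/
def IsL1Regression {n m : ℕ} (D : ℕ) (R τ : ℝ) (S : Fin m → (Fin n → ℝ) × ℝ)
    (p : MvPolynomial (Fin n) ℝ) : Prop :=
  Feasible D R p ∧ ∀ q : MvPolynomial (Fin n) ℝ, Feasible D R q →
    empiricalRisk S (fun x => MvPolynomial.eval x p) ≤
      empiricalRisk S (fun x => MvPolynomial.eval x q) + τ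

/-! ### A real random access machine

Programs use registers and unbounded memory for natural numbers and for real numbers. Every
instruction and every test has unit cost. The only arithmetic on natural numbers is addition and
truncated subtraction; that on real numbers is `+`, `-`, `*`, `/` and comparison. -/

/-- A state of the machine: natural and real registers, natural and real memory. -/
structure State where
  nreg : ℕ → ℕ
  rreg : ℕ → ℝ
  nmem : ℕ → ℕ
  rmem : ℕ → ℝ

/-- The instructions of the machine. The first argument is the target. -/
inductive Instr where
  | nconst (r c : ℕ)
  | nadd (r a b : ℕ)
  | nsub (r a b : ℕ)
  | nload (r a : ℕ)
  | nstore (a r : ℕ)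
  | rconst (r : ℕ) (q : ℚ)
  | radd (r a b : ℕ)
  | rsub (r a b : ℕ)
  | rmul (r a b : ℕ)
  | rdiv (r a b : ℕ)
  | rload (r a : ℕ)
  | rstore (a r : ℕ)

/-- The effect of an instruction. Memory is addressed by the contents of a natural register. -/
def Instr.apply (s : State) : Instr → State
  | .nconst r c => { s with nreg := Function.update s.nreg r c }
  | .nadd r a b => { s with nreg := Function.update s.nreg r (s.nreg a + s.nreg b) }
  | .nsub r a b => { s with nreg := Function.update s.nreg r (s.nreg a - s.nreg b) }
  | .nload r a => { s with nreg := Function.update s.nreg r (s.nmem (s.nreg a)) }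
  | .nstore a r => { s with nmem := Function.update s.nmem (s.nreg a) (s.nreg r) }
  | .rconst r q => { s with rreg := Function.update s.rreg r (q : ℝ) }
  | .radd r a b => { s with rreg := Function.update s.rreg r (s.rreg a + s.rreg b) }
  | .rsub r a b => { s with rreg := Function.update s.rreg r (s.rreg a - s.rreg b) }
  | .rmul r a b => { s with rreg := Function.update s.rreg r (s.rreg a * s.rreg b) }
  | .rdiv r a b => { s with rreg := Function.update s.rreg r (s.rreg a / s.rreg b) }
  | .rload r a => { s with rreg := Function.update s.rreg r (s.rmem (s.nreg a)) }
  | .rstore a r => { s with rmem := Function.update s.rmem (s.nreg a) (s.rreg r) }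

/-- Structured programs. The tests are `nreg a < nreg b` and `rreg a < rreg b`. -/
inductive Program where
  | skip
  | instr (i : Instr)
  | seq (p q : Program)
  | ifNat (a b : ℕ) (p q : Program)
  | ifReal (a b : ℕ) (p q : Program)
  | whileNat (a b : ℕ) (p : Program)

/-- `Exec p s s' t`: started in state `s`, the program `p` halts in state `s'` after exactly `t`
steps. -/
inductive Exec : Program → State → State → ℕ → Prop where
  | skip (s : State) : Exec .skip s s 0
  | instr (i : Instr) (s : State) : Exec (.instr i) s (i.apply s) 1
  | seq {p q : Program} {s s' s'' : State} {t t' : ℕ} :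
      Exec p s s' t → Exec q s' s'' t' → Exec (.seq p q) s s'' (t + t')
  | ifNatTrue {a b : ℕ} {p q : Program} {s s' : State} {t : ℕ} :
      s.nreg a < s.nreg b → Exec p s s' t → Exec (.ifNat a b p q) s s' (t + 1)
  | ifNatFalse {a b : ℕ} {p q : Program} {s s' : State} {t : ℕ} :
      ¬ s.nreg a < s.nreg b → Exec q s s' t → Exec (.ifNat a b p q) s s' (t + 1)
  | ifRealTrue {a b : ℕ} {p q : Program} {s s' : State} {t : ℕ} :
      s.rreg a < s.rreg b → Exec p s s' t → Exec (.ifReal a b p q) s s' (t + 1)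
  | ifRealFalse {a b : ℕ} {p q : Program} {s s' : State} {t : ℕ} :
      ¬ s.rreg a < s.rreg b → Exec q s s' t → Exec (.ifReal a b p q) s s' (t + 1)
  | whileTrue {a b : ℕ} {p : Program} {s s' s'' : State} {t t' : ℕ} :
      s.nreg a < s.nreg b → Exec p s s' t → Exec (.whileNat a b p) s' s'' t' →
        Exec (.whileNat a b p) s s'' (t + t' + 1)
  | whileFalse {a b : ℕ} {p : Program} {s : State} :
      ¬ s.nreg a < s.nreg b → Exec (.whileNat a b p) s s 1

/-- The initial state for the regression problem. The natural registers `0, 1, 2` hold `n`, `D`,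
`m`; the real registers `0, 1` hold the constraint `R` and the tolerance `τ`; the real memory holds
the sample row by row, row `i` being `X_i` followed by `Y_i`. Everything else is zero. -/
def inputState {n m : ℕ} (D : ℕ) (R τ : ℝ) (S : Fin m → (Fin n → ℝ) × ℝ) : State where
  nreg r := if r = 0 then n else if r = 1 then D else if r = 2 then m else 0
  rreg r := if r = 0 then R else if r = 1 then τ else 0
  nmem _ := 0
  rmem a :=
    if hi : a / (n + 1) < m then
      if hk : a % (n + 1) < n then (S ⟨a / (n + 1), hi⟩).1 ⟨a % (n + 1), hk⟩
      else (S ⟨a / (n + 1), hi⟩).2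
    else 0

/-- The polynomial in `n` variables that a final state represents, as a list of terms: the natural
register `0` holds the number of terms, cell `k` of the real memory the coefficient of term `k`, and
the cells `k * n, …, k * n + n - 1` of the natural memory its exponents. -/
def outputPolynomial (n : ℕ) (s : State) : MvPolynomial (Fin n) ℝ :=
  ∑ k ∈ Finset.range (s.nreg 0),
    MvPolynomial.monomial
      (Finsupp.equivFunOnFinite.symm fun i : Fin n => s.nmem (k * n + (i : ℕ))) (s.rmem k)

end RBMRegression

end

open RBMRegression

/-!
The statistical half rests on one polynomial. The derivative of `f_β` is
`2 / ((1 - β²) cosh (2 x) + 1 + β²)`, which is holomorphic and bounded by `2` on the strip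
`|Im| ≤ π / 4`, uniformly in `0 ≤ β ≤ 1` (`activationDeriv_strip`). When an interval of radius `λ`
is rescaled to `[-1, 1]`, the strip contains an ellipse around it of width about `1 / λ`, so the
Chebyshev series converges at the rate `exp (-D / (2 λ + 1))`, with coefficients that grow only
exponentially in the degree
(`exists_polynomial_near`). Integration gives polynomials close to the increments of `f_β`
(`exists_polynomial_near_activation`), and substitution of the linear forms gives a polynomial
close to `v* - v* 0` (`Network.exists_polynomial_near_preactivation`). The constant `v* 0` may be
too large for the `ℓ₁` constraint; but then the sign of `v*` is constant on the cube and the labels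
are almost deterministic, so that a large constant is nearly optimal (`exists_comparator`).

The empirical risk is close to the risk on the whole `ℓ₁` ball: a point of the ball is a convex
combination of the vertices `± R x^α`, an average of few randomly chosen vertices is close to it
(`sparsify`), and Hoeffding's inequality with a union bound controls all these averages at once.
Comparison with the polynomial above then bounds the excess risk of every approximate minimizer
(`measure_excess_risk_le`).

The algorithm is a conditional gradient method, whose iterates stay in the `ℓ₁` ball and which
needs only a coordinate of the gradient of largest absolute value. The gradient involves `tanh`,
which the machine cannot evaluate; since `tanh v` is close to `tanh (m artanh (v / m))`, a rational
function of `v`, repeated multiplication is enough (`abs_rationalTanh_sub_le`), and `m` steps give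
the required accuracy (`sampleLoss_gradient_method_le`). The monomials are enumerated with
repetitions as the nodes of an `n`-ary heap, so that the table of exponents can be written row by
row (`heapExp`). The program is written in a language of counting loops (`Cmd`), for which
correctness is proved with loop invariants (`Cmd.run_loop`) and a polynomial bound on the running
time holds automatically (`Cmd.exec_compile`, `Cmd.exists_timeBound_le`); `exec_solver` combines
the parts.
-/

noncomputable section

namespace RBMRegression

/-! ### Chebyshev approximation of analytic functions -/

/-- A polynomial `Q` has coefficient norm at most `B` if all partial sums of the absolute values of
its coefficients are at most `B`. -/
def CoeffBound (Q : Polynomial ℝ) (B : ℝ) : Prop :=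
  ∀ K : ℕ, ∑ i ∈ Finset.range K, |Q.coeff i| ≤ B

theorem CoeffBound.add {Q Q' : Polynomial ℝ} {B B' : ℝ} (h : CoeffBound Q B)
    (h' : CoeffBound Q' B') : CoeffBound (Q + Q') (B + B') := fun K => by
  refine le_trans ?_ (add_le_add (h K) (h' K))
  rw [← Finset.sum_add_distrib]
  exact Finset.sum_le_sum fun i _ => by rw [Polynomial.coeff_add]; exact abs_add_le _ _

theorem CoeffBound.C_mul {Q : Polynomial ℝ} {B : ℝ} (h : CoeffBound Q B) (c : ℝ) :
    CoeffBound (Polynomial.C c * Q) (|c| * B) := fun K => by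
  simp only [Polynomial.coeff_C_mul, abs_mul, ← Finset.mul_sum]
  exact mul_le_mul_of_nonneg_left (h K) (abs_nonneg c)

theorem CoeffBound.X_mul {Q : Polynomial ℝ} {B : ℝ} (h : CoeffBound Q B) :
    CoeffBound (Polynomial.X * Q) B := fun K => by
  cases K with
  | zero => simpa using h 0
  | succ K =>
    rw [Finset.sum_range_succ']
    simpa using h K

theorem coeffBound_one : CoeffBound 1 1 := fun K => by
  cases K with
  | zero => simp
  | succ K => rw [Finset.sum_range_succ']; simp [Polynomial.coeff_one]

theorem coeffBound_chebyshev (n : ℕ) : CoeffBound (Polynomial.Chebyshev.T ℝ n) (3 ^ n) := by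
  induction n using Nat.twoStepInduction with
  | zero => simpa using coeffBound_one
  | one =>
    intro K
    have := coeffBound_one.X_mul K
    simp only [mul_one] at this
    simp only [Nat.cast_one, Polynomial.Chebyshev.T_one, pow_one]
    linarith
  | more n h0 h1 =>
    have h : CoeffBound (Polynomial.C 2 * (Polynomial.X * Polynomial.Chebyshev.T ℝ (n + 1 : ℕ)) +
        Polynomial.C (-1) * Polynomial.Chebyshev.T ℝ n) _ := (h1.X_mul.C_mul 2).add (h0.C_mul (-1))
    have e : Polynomial.Chebyshev.T ℝ ((n + 2 : ℕ) : ℤ) =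
        Polynomial.C 2 * (Polynomial.X * Polynomial.Chebyshev.T ℝ (n + 1 : ℕ)) +
        Polynomial.C (-1) * Polynomial.Chebyshev.T ℝ n := by
      push_cast
      rw [Polynomial.Chebyshev.T_add_two]
      rw [Polynomial.C_ofNat, Polynomial.C_neg, Polynomial.C_1]
      ring
    intro K
    rw [e]
    refine (h K).trans ?_
    have : (0 : ℝ) < 3 ^ n := by positivity
    norm_num [pow_succ]
    linarith

open Complex in
/-- The integrals of `G z * z ^ (-n - 1)` over concentric circles in an annulus of holomorphy agree,
so that the Fourier coefficients of `G` on the unit circle decay geometrically. -/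
theorem norm_fourier_integral_le {G : ℂ → ℂ} {ρ M : ℝ} (hρ : 1 < ρ)
    (hd : ∀ z : ℂ, ρ⁻¹ ≤ ‖z‖ → ‖z‖ ≤ ρ → DifferentiableAt ℂ G z)
    (hM : ∀ z : ℂ, ρ⁻¹ ≤ ‖z‖ → ‖z‖ ≤ ρ → ‖G z‖ ≤ M) (n : ℤ) :
    ‖∮ z in C(0, 1), z⁻¹ * (z ^ (-n) * G z)‖ ≤ 2 * Real.pi * (M * ρ⁻¹ ^ n.natAbs) := by
  have hρ0 : 0 < ρ := by linarith
  have hρ1 : ρ⁻¹ < 1 := inv_lt_one_of_one_lt₀ hρ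
  have hρi : 0 < ρ⁻¹ := inv_pos.2 hρ0
  have key : ∀ r R : ℝ, ρ⁻¹ ≤ r → r ≤ R → R ≤ ρ →
      (∮ z in C(0, R), z⁻¹ * (z ^ (-n) * G z)) = ∮ z in C(0, r), z⁻¹ * (z ^ (-n) * G z) := by
    intro r R h1 h2 h3
    have hr : 0 < r := hρi.trans_le h1
    have hdiff : ∀ z : ℂ, r ≤ ‖z‖ → ‖z‖ ≤ R →
        DifferentiableAt ℂ (fun z => z ^ (-n) * G z) z := by
      intro z hz1 hz2
      have hz : z ≠ 0 := norm_pos_iff.1 (hr.trans_le hz1)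
      exact (differentiableAt_zpow.2 (Or.inl hz)).mul (hd z (h1.trans hz1) (hz2.trans h3))
    have := circleIntegral_sub_center_inv_smul_eq_of_differentiable_on_annulus_off_countable
      (c := 0) hr h2 (f := fun z => z ^ (-n) * G z) Set.countable_empty
      (fun z hz =>
        (hdiff z (by simpa using hz.2) (by simpa using hz.1)).continuousAt.continuousWithinAt)
      (fun z hz => hdiff z (by simpa using (not_le.1 (by simpa using hz.1.2)).le)
        (by simpa using (Metric.mem_ball.1 hz.1.1).le))
    simpa using this
  have bound : ∀ s : ℝ, ρ⁻¹ ≤ s → s ≤ ρ →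
      ‖∮ z in C(0, s), z⁻¹ * (z ^ (-n) * G z)‖ ≤ 2 * Real.pi * (M * s ^ (-n)) := by
    intro s h1 h2
    have hs : 0 < s := hρi.trans_le h1
    have := circleIntegral.norm_integral_le_of_norm_le_const (c := 0) (R := s)
      (f := fun z => z⁻¹ * (z ^ (-n) * G z)) (C := s⁻¹ * (s ^ (-n) * M)) hs.le (by
        intro z hz
        have hz' : ‖z‖ = s := by simpa using hz
        rw [norm_mul, norm_mul, norm_inv, norm_zpow, hz']
        gcongr
        exact hM z (hz' ▸ h1) (hz' ▸ h2))
    refine this.trans (le_of_eq ?_)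
    field_simp
  have one1 : ρ⁻¹ ≤ 1 := hρ1.le
  -- The circle is moved outwards if `0 ≤ n` and inwards otherwise.
  rcases le_total 0 n with hn | hn
  · rw [← key 1 ρ one1 hρ.le le_rfl]
    refine (bound ρ (one1.trans hρ.le) le_rfl).trans (le_of_eq ?_)
    obtain ⟨k, rfl⟩ := Int.eq_ofNat_of_zero_le hn
    simp
  · rw [key ρ⁻¹ 1 le_rfl one1 hρ.le]
    refine (bound ρ⁻¹ le_rfl (one1.trans hρ.le)).trans (le_of_eq ?_)
    obtain ⟨k, hk⟩ := Int.eq_ofNat_of_zero_le (neg_nonneg.2 hn)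
    have : n = -(k : ℤ) := by omega
    subst this
    simp

open Complex in
/-- A function of `cos θ` which extends holomorphically to an annulus around the unit circle is the
sum of its Chebyshev series, and the coefficients decay geometrically. -/
theorem exists_cos_series {G : ℂ → ℂ} {φ : ℝ → ℝ} {ρ M : ℝ} (hρ : 1 < ρ)
    (hd : ∀ z : ℂ, ρ⁻¹ ≤ ‖z‖ → ‖z‖ ≤ ρ → DifferentiableAt ℂ G z)
    (hM : ∀ z : ℂ, ρ⁻¹ ≤ ‖z‖ → ‖z‖ ≤ ρ → ‖G z‖ ≤ M)
    (hφ : ∀ θ : ℝ, G (circleMap 0 1 θ) = φ (Real.cos θ)) :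
    ∃ a : ℤ → ℝ, (∀ n, |a n| ≤ M * ρ⁻¹ ^ n.natAbs) ∧
      ∀ θ : ℝ, HasSum (fun n : ℤ => a n * Real.cos (n * θ)) (φ (Real.cos θ)) := by
  have hρ0 : 0 < ρ := by linarith
  have hρ1 : ρ⁻¹ < 1 := inv_lt_one_of_one_lt₀ hρ
  have : Fact (0 < 2 * Real.pi) := ⟨by positivity⟩
  have hnorm : ∀ θ : ℝ, ‖circleMap 0 1 θ‖ = 1 := by intro θ; simp
  have hper : Function.Periodic (fun θ : ℝ => G (circleMap 0 1 θ)) (2 * Real.pi) := by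
    intro θ; simp only [periodic_circleMap 0 1 θ]
  have hcont : Continuous (fun θ : ℝ => G (circleMap 0 1 θ)) := by
    rw [continuous_iff_continuousAt]
    intro θ
    have h1 : ContinuousAt G (circleMap 0 1 θ) :=
      (hd _ (by rw [hnorm]; exact hρ1.le) (by rw [hnorm]; exact hρ.le)).continuousAt
    exact ContinuousAt.comp (f := circleMap 0 1) h1 (continuous_circleMap 0 1).continuousAt
  let f : C(AddCircle (2 * Real.pi), ℂ) :=
    ⟨hper.lift, continuous_coinduced_dom.mpr hcont⟩
  have hf : ∀ θ : ℝ, f (θ : AddCircle (2 * Real.pi)) = G (circleMap 0 1 θ) := fun θ => rfl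
  have hcoef : ∀ n : ℤ, ‖fourierCoeff f n‖ ≤ M * ρ⁻¹ ^ n.natAbs := by
    intro n
    have h1 := norm_fourier_integral_le hρ hd hM n
    have h2 : (∮ z in C(0, 1), z⁻¹ * (z ^ (-n) * G z)) =
        I * ∫ θ in (0 : ℝ)..(2 * Real.pi), fourier (-n) (θ : AddCircle (2 * Real.pi)) •
          f (θ : AddCircle (2 * Real.pi)) := by
      rw [circleIntegral, ← intervalIntegral.integral_const_mul]
      refine intervalIntegral.integral_congr fun θ _ => ?_
      have hz : circleMap 0 1 θ ≠ 0 := norm_pos_iff.1 (by rw [hnorm]; exact one_pos)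
      have e : fourier (-n) (θ : AddCircle (2 * Real.pi)) = circleMap 0 1 θ ^ (-n) := by
        rw [fourier_coe_apply, circleMap_zero, ofReal_one, one_mul, ← Complex.exp_int_mul]
        congr 1
        push_cast
        field_simp
      simp only [deriv_circleMap, smul_eq_mul, hf, e]
      field_simp
    rw [h2, norm_mul, norm_I, one_mul] at h1
    rw [fourierCoeff_eq_intervalIntegral f n 0, zero_add, norm_smul, Real.norm_eq_abs,
      abs_of_pos (by positivity)]
    rw [one_div, inv_mul_le_iff₀ (by positivity)]
    exact h1
  have hsumm : Summable (fun n : ℤ => M * ρ⁻¹ ^ n.natAbs) := by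
    apply Summable.mul_left
    have hg := summable_geometric_of_lt_one (inv_pos.2 hρ0).le hρ1
    exact Summable.of_nat_of_neg (by simpa using hg) (by simpa using hg)
  have hs : Summable (fourierCoeff f) := Summable.of_norm_bounded hsumm hcoef
  have hsum : ∀ θ : ℝ, HasSum (fun n : ℤ => fourierCoeff f n * Complex.exp (n * θ * I))
      (φ (Real.cos θ) : ℂ) := by
    intro θ
    have := has_pointwise_sum_fourier_series_of_summable hs (θ : AddCircle (2 * Real.pi))
    rw [hf, hφ] at this
    refine this.congr_fun fun n => ?_
    rw [fourier_coe_apply, smul_eq_mul]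
    congr 2
    push_cast
    field_simp
  refine ⟨fun n => (fourierCoeff f n).re, fun n => (abs_re_le_norm _).trans (hcoef n), fun θ => ?_⟩
  -- `φ (cos θ)` is even in `θ` and real: symmetrizing leaves the cosines, and taking real parts
  -- makes the coefficients real.
  have h := ((hsum θ).add (hsum (-θ))).mul_left (1 / 2)
  have h' := Complex.hasSum_re h
  convert h' using 1
  · funext n
    have : (1 / 2 : ℂ) * (fourierCoeff f n * Complex.exp (n * θ * I) +
        fourierCoeff f n * Complex.exp (n * (-θ : ℝ) * I)) =
        fourierCoeff f n * ((Real.cos (n * θ) : ℝ) : ℂ) := by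
      rw [Complex.ofReal_cos, Complex.cos]
      push_cast
      ring_nf
    rw [this, Complex.re_mul_ofReal]
  · rw [Real.cos_neg, ← two_mul, ← mul_assoc]
    norm_num

/-- Truncation of the Chebyshev series: a function `φ` on `[-1, 1]` for which `φ ((z + z⁻¹) / 2)`
extends holomorphically to an annulus is approximated by polynomials at a geometric rate. -/
theorem exists_polynomial_near {G : ℂ → ℂ} {φ : ℝ → ℝ} {ρ M : ℝ} (hρ : 1 < ρ)
    (hd : ∀ z : ℂ, ρ⁻¹ ≤ ‖z‖ → ‖z‖ ≤ ρ → DifferentiableAt ℂ G z)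
    (hM : ∀ z : ℂ, ρ⁻¹ ≤ ‖z‖ → ‖z‖ ≤ ρ → ‖G z‖ ≤ M)
    (hφ : ∀ θ : ℝ, G (circleMap 0 1 θ) = φ (Real.cos θ)) (D : ℕ) :
    ∃ Q : Polynomial ℝ, Q.natDegree ≤ D ∧ CoeffBound Q (2 * M * 3 ^ D) ∧
      ∀ x ∈ Set.Icc (-1 : ℝ) 1, |φ x - Q.eval x| ≤ 2 * M * (ρ⁻¹ ^ D * (1 - ρ⁻¹)⁻¹) := by
  obtain ⟨a, ha, hs⟩ := exists_cos_series hρ hd hM hφ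
  have hρ0 : 0 < ρ := by linarith
  have hi0 : 0 < ρ⁻¹ := inv_pos.2 hρ0
  have hi1 : ρ⁻¹ < 1 := inv_lt_one_of_one_lt₀ hρ
  have hM0 : 0 ≤ M := (norm_nonneg _).trans (hM 1 (by simpa using hi1.le) (by simpa using hρ.le))
  have haM : ∀ n, |a n| ≤ M := fun n => (ha n).trans
    (mul_le_of_le_one_right hM0 (pow_le_one₀ hi0.le hi1.le))
  -- The terms of the two-sided series with index `n` and `-(n + 1)` are taken together.
  let t : ℕ → Polynomial ℝ := fun n =>
    Polynomial.C (a n) * Polynomial.Chebyshev.T ℝ n +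
      Polynomial.C (a (-(n + 1 : ℕ))) * Polynomial.Chebyshev.T ℝ ((n + 1 : ℕ) : ℤ)
  refine ⟨∑ n ∈ Finset.range D, t n, ?_, ?_, ?_⟩
  · refine Polynomial.natDegree_sum_le_of_forall_le _ _ fun n hn => ?_
    have hn' := Finset.mem_range.1 hn
    refine (Polynomial.natDegree_add_le _ _).trans (max_le ?_ ?_)
    · refine (Polynomial.natDegree_C_mul_le _ _).trans ?_
      rw [Polynomial.Chebyshev.natDegree_T]; simpa using hn'.le
    · refine (Polynomial.natDegree_C_mul_le _ _).trans ?_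
      rw [Polynomial.Chebyshev.natDegree_T]; omega
  · induction D with
    | zero => intro K; simp; positivity
    | succ D ih =>
      intro K
      rw [Finset.sum_range_succ]
      have h1 := (coeffBound_chebyshev D).C_mul (a D)
      have h2 := (coeffBound_chebyshev (D + 1)).C_mul (a (-(D + 1 : ℕ)))
      refine ((ih.add (h1.add h2)) K).trans ?_
      have e1 : |a D| * 3 ^ D ≤ M * 3 ^ D := by gcongr; exact haM _
      have e2 : |a (-(D + 1 : ℕ))| * 3 ^ (D + 1) ≤ M * 3 ^ (D + 1) := by gcongr; exact haM _
      rw [pow_succ] at *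
      linarith
  · intro x hx
    obtain ⟨θ, rfl⟩ : ∃ θ, Real.cos θ = x := ⟨Real.arccos x, Real.cos_arccos hx.1 hx.2⟩
    have h := (hs θ).nat_add_neg_add_one
    have ht : ∀ n, (t n).eval (Real.cos θ) =
        a (n : ℤ) * Real.cos (((n : ℤ) : ℝ) * θ) +
          a (-((n : ℤ) + 1)) * Real.cos ((-((n : ℤ) + 1) : ℤ) * θ) := by
      intro n
      simp only [t, Polynomial.eval_add, Polynomial.eval_mul, Polynomial.eval_C,
        Polynomial.Chebyshev.T_real_cos]
      push_cast
      rw [neg_mul, Real.cos_neg]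
    simp_rw [← ht] at h
    have hb : ∀ n, ‖(t n).eval (Real.cos θ)‖ ≤ 2 * M * ρ⁻¹ ^ n := by
      intro n
      rw [ht, Real.norm_eq_abs]
      refine (abs_add_le _ _).trans ?_
      rw [abs_mul, abs_mul]
      have h1 : |a (n : ℤ)| * |Real.cos (((n : ℤ) : ℝ) * θ)| ≤ M * ρ⁻¹ ^ n := by
        refine (mul_le_of_le_one_right (abs_nonneg _) (Real.abs_cos_le_one _)).trans ?_
        simpa using ha n
      have h2 : |a (-((n : ℤ) + 1))| * |Real.cos ((-((n : ℤ) + 1) : ℤ) * θ)| ≤ M * ρ⁻¹ ^ n := by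
        refine (mul_le_of_le_one_right (abs_nonneg _) (Real.abs_cos_le_one _)).trans ?_
        refine (ha _).trans (mul_le_mul_of_nonneg_left ?_ hM0)
        exact pow_le_pow_of_le_one hi0.le hi1.le (by omega)
      linarith
    have htail := (hasSum_nat_add_iff' D).2 h
    have hg : HasSum (fun n : ℕ => 2 * M * ρ⁻¹ ^ (n + D)) (2 * M * (ρ⁻¹ ^ D * (1 - ρ⁻¹)⁻¹)) := by
      have := (hasSum_geometric_of_lt_one hi0.le hi1).mul_left (2 * M * ρ⁻¹ ^ D)
      rw [← mul_assoc]
      exact this.congr_fun fun n => by rw [pow_add]; ring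
    have := htail.norm_le_of_bounded hg fun n => hb (n + D)
    rw [Polynomial.eval_finsetSum]
    exact this

/-! ### Polynomial approximation of the activation functions -/

/-- The logarithms in `artanh_mul_tanh` have positive arguments, also for `β = 1`. -/
theorem abs_mul_sinh_lt_cosh {β : ℝ} (hβ : β ∈ Set.Icc (0 : ℝ) 1) (x : ℝ) :
    |β * Real.sinh x| < Real.cosh x := by
  have h1 : |Real.sinh x| < Real.cosh x := by
    rw [abs_lt]; constructor
    · have := Real.exp_pos x; rw [← Real.cosh_add_sinh] at this; linarith
    · exact Real.sinh_lt_cosh x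
  rw [abs_mul, abs_of_nonneg hβ.1]
  exact (mul_le_of_le_one_left (abs_nonneg _) hβ.2).trans_lt h1

theorem artanh_mul_tanh {β : ℝ} (hβ : β ∈ Set.Icc (0 : ℝ) 1) (x : ℝ) :
    Real.artanh (β * Real.tanh x) = 1 / 2 * (Real.log (Real.cosh x + β * Real.sinh x) -
      Real.log (Real.cosh x - β * Real.sinh x)) := by
  have h := abs_lt.1 (abs_mul_sinh_lt_cosh hβ x)
  have hc := Real.cosh_pos x
  have e : β * Real.tanh x = β * Real.sinh x / Real.cosh x := by
    rw [Real.tanh_eq_sinh_div_cosh]; ring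
  rw [Real.artanh_eq_half_log, ← Real.log_div (by linarith) (by linarith)]
  · congr 2
    rw [e, div_eq_div_iff _ (by linarith)]
    · field_simp
    · rw [sub_ne_zero, Ne, eq_div_iff hc.ne']; linarith
  · rw [e]
    exact ⟨by rw [le_div_iff₀ hc]; linarith, by rw [div_le_iff₀ hc]; linarith⟩

/-- The derivative of `activation β`, as a function of a complex variable. -/
def activationDeriv (β : ℝ) (w : ℂ) : ℂ :=
  2 / ((1 - (β : ℂ) ^ 2) * Complex.cosh (2 * w) + (1 + (β : ℂ) ^ 2))

theorem activationDeriv_denom {β : ℝ} (x : ℝ) :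
    (1 - β ^ 2) * Real.cosh (2 * x) + (1 + β ^ 2) =
      2 * ((Real.cosh x + β * Real.sinh x) * (Real.cosh x - β * Real.sinh x)) := by
  have := Real.cosh_sq x
  rw [Real.cosh_two_mul]
  ring_nf
  rw [this]
  ring

theorem hasDerivAt_activation {β : ℝ} (hβ : β ∈ Set.Icc (0 : ℝ) 1) (x : ℝ) :
    HasDerivAt (activation β) (activationDeriv β x).re x := by
  have h := abs_lt.1 (abs_mul_sinh_lt_cosh hβ x)
  have hp : 0 < Real.cosh x + β * Real.sinh x := by linarith
  have hm : 0 < Real.cosh x - β * Real.sinh x := by linarith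
  have e : (activationDeriv β x).re =
      1 / ((Real.cosh x + β * Real.sinh x) * (Real.cosh x - β * Real.sinh x)) := by
    have : activationDeriv β x =
        ((2 / ((1 - β ^ 2) * Real.cosh (2 * x) + (1 + β ^ 2)) : ℝ) : ℂ) := by
      rw [activationDeriv]; push_cast; rfl
    rw [this, Complex.ofReal_re, activationDeriv_denom]
    field_simp
  rw [e]
  have hsq := Real.cosh_sq x
  rcases eq_or_ne β 0 with rfl | h0
  · have hfun : activation 0 = fun x => Real.sinh x / Real.cosh x := by
      funext y; simp [activation, Real.tanh_eq_sinh_div_cosh]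
    rw [hfun]
    refine ((Real.hasDerivAt_sinh x).div (Real.hasDerivAt_cosh x)
      (Real.cosh_pos x).ne').congr_deriv ?_
    rw [show Real.cosh x * Real.cosh x - Real.sinh x * Real.sinh x = 1 by nlinarith]
    ring
  · have hfun : activation β = fun x => 1 / β * (1 / 2 * (Real.log (Real.cosh x + β * Real.sinh x) -
        Real.log (Real.cosh x - β * Real.sinh x))) := by
      funext y; rw [activation, if_neg h0, artanh_mul_tanh hβ]
    rw [hfun]
    have hs := (Real.hasDerivAt_sinh x).const_mul β
    have hc := Real.hasDerivAt_cosh x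
    refine ((((hc.add hs).log hp.ne').sub ((hc.sub hs).log hm.ne')).const_mul (1 / 2)
      |>.const_mul (1 / β)).congr_deriv ?_
    have hp' := hp.ne'
    have hm' := hm.ne'
    simp only [Pi.add_apply, Pi.sub_apply]
    field_simp
    linear_combination (2 * β) * hsq

/-- On the strip `|Im w| ≤ π/4` the real part of `cosh (2 w)` is nonnegative, so that the
denominator of `activationDeriv` stays away from zero. -/
theorem activationDeriv_strip {β : ℝ} (hβ : β ∈ Set.Icc (0 : ℝ) 1) {w : ℂ}
    (hw : |w.im| ≤ Real.pi / 4) :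
    DifferentiableAt ℂ (activationDeriv β) w ∧ ‖activationDeriv β w‖ ≤ 2 := by
  have hre : 1 ≤ ((1 - (β : ℂ) ^ 2) * Complex.cosh (2 * w) + (1 + (β : ℂ) ^ 2)).re := by
    have h1 : (Complex.cosh (2 * w)).re = Real.cosh (2 * w.re) * Real.cos (2 * w.im) := by
      conv_lhs => rw [← Complex.re_add_im w]
      rw [mul_add, ← mul_assoc, Complex.cosh_add, Complex.cosh_mul_I, Complex.sinh_mul_I]
      rw [show (2 : ℂ) * (w.re : ℂ) = ((2 * w.re : ℝ) : ℂ) by push_cast; ring,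
        show (2 : ℂ) * (w.im : ℂ) = ((2 * w.im : ℝ) : ℂ) by push_cast; ring,
        ← Complex.ofReal_cosh, ← Complex.ofReal_sinh, ← Complex.ofReal_cos, ← Complex.ofReal_sin]
      rw [Complex.add_re, ← Complex.ofReal_mul, Complex.ofReal_re, ← mul_assoc,
        ← Complex.ofReal_mul, Complex.re_ofReal_mul, Complex.I_re, mul_zero, add_zero]
    have h2 : 0 ≤ Real.cos (2 * w.im) := by
      have := abs_le.1 hw
      exact Real.cos_nonneg_of_mem_Icc ⟨by linarith, by linarith⟩
    have h3 : ((1 - (β : ℂ) ^ 2) * Complex.cosh (2 * w) + (1 + (β : ℂ) ^ 2)).re =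
        (1 - β ^ 2) * (Complex.cosh (2 * w)).re + (1 + β ^ 2) := by
      rw [show (1 - (β : ℂ) ^ 2) = ((1 - β ^ 2 : ℝ) : ℂ) by push_cast; ring,
        show (1 + (β : ℂ) ^ 2) = ((1 + β ^ 2 : ℝ) : ℂ) by push_cast; ring,
        Complex.add_re, Complex.re_ofReal_mul, Complex.ofReal_re]
    rw [h3, h1]
    have h4 : 0 ≤ 1 - β ^ 2 := by nlinarith [hβ.1, hβ.2]
    have h5 := mul_nonneg h4 (mul_nonneg (Real.cosh_pos (2 * w.re)).le h2)
    nlinarith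
  have hnorm := hre.trans (Complex.re_le_norm _)
  have hne : (1 - (β : ℂ) ^ 2) * Complex.cosh (2 * w) + (1 + (β : ℂ) ^ 2) ≠ 0 :=
    norm_pos_iff.1 (by linarith)
  constructor
  · unfold activationDeriv
    refine DifferentiableAt.div (by fun_prop) ?_ hne
    have : DifferentiableAt ℂ (fun w : ℂ => Complex.cosh (2 * w)) w :=
      (Complex.differentiable_cosh _).comp w (by fun_prop)
    fun_prop
  · rw [activationDeriv, norm_div, div_le_iff₀ (by linarith)]
    simp; linarith

theorem activation_continuous {β : ℝ} (hβ : β ∈ Set.Icc (0 : ℝ) 1) : Continuous (activation β) :=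
  continuous_iff_continuousAt.2 fun x => (hasDerivAt_activation hβ x).continuousAt

theorem abs_activation_sub_le {β : ℝ} (hβ : β ∈ Set.Icc (0 : ℝ) 1) (x y : ℝ) :
    |activation β y - activation β x| ≤ 2 * |y - x| := by
  refine Convex.norm_image_sub_le_of_norm_hasDerivWithin_le (s := Set.univ)
    (fun z _ => (hasDerivAt_activation hβ z).hasDerivWithinAt) (fun z _ => ?_) convex_univ
    (Set.mem_univ x) (Set.mem_univ y)
  exact (Complex.abs_re_le_norm _).trans (activationDeriv_strip hβ (by simp; positivity)).2

/-- The polynomial antiderivative vanishing at zero. -/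
theorem exists_antiderivative {Q : Polynomial ℝ} {D : ℕ} {B : ℝ} (hD : Q.natDegree ≤ D)
    (hB : CoeffBound Q B) : ∃ P : Polynomial ℝ, P.natDegree ≤ D + 1 ∧ CoeffBound P B ∧
      P.eval 0 = 0 ∧ ∀ x, HasDerivAt (fun x => P.eval x) (Q.eval x) x := by
  let P : Polynomial ℝ := ∑ i ∈ Finset.range (D + 1),
    Polynomial.monomial (i + 1) (Q.coeff i / (i + 1))
  have hder : Polynomial.derivative P = Q := by
    conv_rhs => rw [Q.as_sum_range' (D + 1) (by omega)]
    rw [Polynomial.derivative_sum]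
    refine Finset.sum_congr rfl fun i _ => ?_
    rw [Polynomial.derivative_monomial]
    congr 1
    push_cast
    field_simp
  have hcoef : ∀ i, |P.coeff (i + 1)| ≤ |Q.coeff i| := by
    intro i
    have := congrArg (fun p => p.coeff i) hder
    simp only [Polynomial.coeff_derivative] at this
    rw [← this, abs_mul]
    refine le_mul_of_one_le_right (abs_nonneg _) ?_
    rw [abs_of_nonneg (by positivity)]
    linarith [(Nat.cast_nonneg i : (0 : ℝ) ≤ i)]
  have h0 : P.coeff 0 = 0 := by
    simp [P, Polynomial.coeff_monomial]
  refine ⟨P, ?_, ?_, ?_, fun x => ?_⟩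
  · refine Polynomial.natDegree_sum_le_of_forall_le _ _ fun i hi => ?_
    refine (Polynomial.natDegree_monomial_le _).trans ?_
    have := Finset.mem_range.1 hi
    omega
  · intro K
    cases K with
    | zero => simpa using hB 0
    | succ K =>
      rw [Finset.sum_range_succ', h0, abs_zero, add_zero]
      exact (Finset.sum_le_sum fun i _ => hcoef i).trans (hB K)
  · rw [← Polynomial.coeff_zero_eq_eval_zero, h0]
  · rw [← hder]; exact P.hasDerivAt x

/-- On an interval of radius `L` the increments of an activation function are approximated by
polynomials of degree `D + 1`, with an error that decays at the rate `exp (-D / (2 L + 1))`. -/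
theorem exists_polynomial_near_activation {β : ℝ} (hβ : β ∈ Set.Icc (0 : ℝ) 1) {L : ℝ} (hL : 0 < L)
    (b : ℝ) (D : ℕ) :
    ∃ Q : Polynomial ℝ, Q.natDegree ≤ D + 1 ∧ CoeffBound Q (L * (4 * 3 ^ D)) ∧
      ∀ u ∈ Set.Icc (-1 : ℝ) 1, |activation β (b + L * u) - activation β b - Q.eval u| ≤
        L * (4 * (2 * L + 1) * Real.exp (-(D / (2 * L + 1)))) := by
  -- The annulus `ρ⁻¹ ≤ ‖z‖ ≤ ρ` is mapped by `z ↦ b + L * (z + z⁻¹) / 2` into the strip on which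
  -- `activationDeriv β` is bounded, since `ρ - ρ⁻¹ ≤ 1 / L`.
  set ρ : ℝ := 1 + 1 / (2 * L) with hρdef
  have hρ : 1 < ρ := by rw [hρdef]; linarith [show 0 < 1 / (2 * L) by positivity]
  have hρ0 : 0 < ρ := by linarith
  have hinv : ρ⁻¹ = 1 - 1 / (2 * L + 1) := by
    rw [hρdef]; field_simp; ring
  let G : ℂ → ℂ := fun z => activationDeriv β (b + L * ((z + z⁻¹) / 2))
  have him : ∀ z : ℂ, ρ⁻¹ ≤ ‖z‖ → ‖z‖ ≤ ρ →
      |((b : ℂ) + L * ((z + z⁻¹) / 2)).im| ≤ Real.pi / 4 := by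
    intro z h1 h2
    have hz : 0 < ‖z‖ := (inv_pos.2 hρ0).trans_le h1
    have e : ((b : ℂ) + L * ((z + z⁻¹) / 2)).im = L * (z.im * (1 - (‖z‖ ^ 2)⁻¹) / 2) := by
      rw [show (z + z⁻¹) / 2 = (((1 / 2 : ℝ) : ℂ)) * (z + z⁻¹) by push_cast; ring]
      rw [Complex.add_im, Complex.ofReal_im, Complex.im_ofReal_mul, Complex.im_ofReal_mul,
        Complex.add_im, Complex.inv_im, Complex.normSq_eq_norm_sq]
      ring
    have h3 : |z.im * (1 - (‖z‖ ^ 2)⁻¹)| ≤ ρ - ρ⁻¹ := by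
      rw [abs_mul]
      refine (mul_le_mul_of_nonneg_right (Complex.abs_im_le_norm z) (abs_nonneg _)).trans ?_
      rw [← abs_of_pos hz, ← abs_mul, abs_of_pos hz, mul_sub, mul_one,
        show ‖z‖ * (‖z‖ ^ 2)⁻¹ = ‖z‖⁻¹ by field_simp]
      have h4 : ‖z‖⁻¹ ≤ ρ := by rw [inv_le_comm₀ hz hρ0]; exact h1
      have h5 : ρ⁻¹ ≤ ‖z‖⁻¹ := inv_anti₀ hz h2
      rw [abs_le]; constructor <;> linarith
    have h6 : ρ - ρ⁻¹ ≤ 1 / L := by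
      rw [hinv, hρdef]
      have : 1 / (2 * L + 1) ≤ 1 / (2 * L) := one_div_le_one_div_of_le (by positivity) (by linarith)
      have e2 : 1 / L = 1 / (2 * L) + 1 / (2 * L) := by field_simp; norm_num
      linarith
    rw [e, abs_mul, abs_of_pos hL, abs_div, abs_two]
    have h7 : L * (|z.im * (1 - (‖z‖ ^ 2)⁻¹)| / 2) ≤ L * ((1 / L) / 2) := by
      gcongr; exact h3.trans h6
    have h8 : L * ((1 / L) / 2) = 1 / 2 := by field_simp
    linarith [Real.pi_gt_three]
  have hz0 : ∀ z : ℂ, ρ⁻¹ ≤ ‖z‖ → z ≠ 0 := fun z h =>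
    norm_pos_iff.1 ((inv_pos.2 hρ0).trans_le h)
  obtain ⟨Q, hQ1, hQ2, hQ3⟩ := exists_polynomial_near (G := G)
    (φ := fun x => (activationDeriv β ((b + L * x : ℝ) : ℂ)).re) (M := 2) hρ
    (fun z h1 h2 => by
      have := (activationDeriv_strip hβ (him z h1 h2)).1
      have hinv : DifferentiableAt ℂ (fun z : ℂ => z⁻¹) z := differentiableAt_inv (hz0 z h1)
      refine DifferentiableAt.comp (g := activationDeriv β)
        (f := fun z : ℂ => (b : ℂ) + L * ((z + z⁻¹) / 2)) z this ?_
      fun_prop)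
    (fun z h1 h2 => (activationDeriv_strip hβ (him z h1 h2)).2)
    (fun θ => by
      have e1 : (circleMap 0 1 θ + (circleMap 0 1 θ)⁻¹) / 2 = ((Real.cos θ : ℝ) : ℂ) := by
        rw [circleMap_zero, Complex.ofReal_one, one_mul, ← Complex.exp_neg, Complex.ofReal_cos,
          Complex.cos]
        ring_nf
      simp only [G, e1]
      rw [← Complex.ofReal_mul, ← Complex.ofReal_add]
      have : activationDeriv β ((b + L * Real.cos θ : ℝ) : ℂ) =
        ((2 / ((1 - β ^ 2) * Real.cosh (2 * (b + L * Real.cos θ)) + (1 + β ^ 2)) : ℝ) : ℂ) := by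
        rw [activationDeriv]; push_cast; rfl
      rw [this, Complex.ofReal_re]) D
  -- Integrating the approximation of the derivative avoids the logarithms of `activation` itself,
  -- which need not be bounded on the strip.
  obtain ⟨P, hP1, hP2, hP3, hP4⟩ := exists_antiderivative hQ1 hQ2
  refine ⟨Polynomial.C L * P, (Polynomial.natDegree_C_mul_le _ _).trans hP1, ?_, ?_⟩
  · have := hP2.C_mul L
    rw [abs_of_pos hL] at this
    convert this using 1; ring
  · intro u hu
    set η : ℝ := 4 * (2 * L + 1) * Real.exp (-(D / (2 * L + 1))) with hη
    have hQη : ∀ x ∈ Set.Icc (-1 : ℝ) 1,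
        |(activationDeriv β ((b + L * x : ℝ) : ℂ)).re - Q.eval x| ≤ η := by
      intro x hx
      refine (hQ3 x hx).trans ?_
      have h1 : ρ⁻¹ ≤ Real.exp (-(1 / (2 * L + 1))) := by
        rw [hinv]
        have := Real.add_one_le_exp (-(1 / (2 * L + 1)))
        linarith
      have h2 : ρ⁻¹ ^ D ≤ Real.exp (-(D / (2 * L + 1))) := by
        refine (pow_le_pow_left₀ (inv_pos.2 hρ0).le h1 D).trans (le_of_eq ?_)
        rw [← Real.exp_nat_mul]; congr 1; ring
      have h3 : (1 - ρ⁻¹)⁻¹ = 2 * L + 1 := by rw [hinv]; simp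
      rw [h3, hη]
      nlinarith [mul_le_mul_of_nonneg_right h2 (show 0 ≤ 2 * L + 1 by positivity)]
    have hder : ∀ x ∈ Set.Icc (-1 : ℝ) 1, HasDerivWithinAt
        (fun x => activation β (b + L * x) - L * P.eval x)
        (L * ((activationDeriv β ((b + L * x : ℝ) : ℂ)).re - Q.eval x)) (Set.Icc (-1) 1) x := by
      intro x _
      have h1 : HasDerivAt (fun x : ℝ => b + L * x) L x := by
        simpa using ((hasDerivAt_id x).const_mul L).const_add b
      have h2 := (hasDerivAt_activation hβ (b + L * x)).comp x h1
      exact ((h2.sub ((hP4 x).const_mul L)).congr_deriv (by ring)).hasDerivWithinAt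
    have := Convex.norm_image_sub_le_of_norm_hasDerivWithin_le (C := L * η) hder (fun x hx => by
      rw [norm_mul, Real.norm_eq_abs, Real.norm_eq_abs, abs_of_pos hL]
      exact mul_le_mul_of_nonneg_left (hQη x hx) hL.le) (convex_Icc _ _)
      (show (0 : ℝ) ∈ Set.Icc (-1 : ℝ) 1 by norm_num) hu
    have hLη : 0 ≤ L * η := by positivity
    simp only [hP3, mul_zero, add_zero, sub_zero] at this
    rw [Polynomial.eval_mul, Polynomial.eval_C]
    rw [Real.norm_eq_abs, Real.norm_eq_abs] at this
    rw [show activation β (b + L * u) - activation β b - L * P.eval u =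
      activation β (b + L * u) - L * P.eval u - activation β b by ring]
    refine this.trans (mul_le_of_le_one_right hLη ?_)
    exact abs_le.2 hu

/-! ### The `ℓ₁` norm of coefficient vectors -/

section coeffNorm

variable {n : ℕ}

theorem coeffNorm_eq_sum {p : MvPolynomial (Fin n) ℝ} {s : Finset (Fin n →₀ ℕ)}
    (h : p.support ⊆ s) : coeffNorm p = ∑ α ∈ s, |p.coeff α| :=
  Finset.sum_subset h fun α _ hα => by simpa using hα

theorem coeffNorm_nonneg (p : MvPolynomial (Fin n) ℝ) : 0 ≤ coeffNorm p :=
  Finset.sum_nonneg fun _ _ => abs_nonneg _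

theorem coeffNorm_zero : coeffNorm (0 : MvPolynomial (Fin n) ℝ) = 0 := by simp [coeffNorm]

theorem coeffNorm_add_le (p q : MvPolynomial (Fin n) ℝ) :
    coeffNorm (p + q) ≤ coeffNorm p + coeffNorm q := by
  classical
  rw [coeffNorm_eq_sum (MvPolynomial.support_add (p := p) (q := q)),
    coeffNorm_eq_sum (Finset.subset_union_left (s₁ := p.support) (s₂ := q.support)),
    coeffNorm_eq_sum (Finset.subset_union_right (s₁ := p.support) (s₂ := q.support)),
    ← Finset.sum_add_distrib]
  exact Finset.sum_le_sum fun α _ => by rw [MvPolynomial.coeff_add]; exact abs_add_le _ _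

theorem coeffNorm_sum_le {ι : Type*} (s : Finset ι) (p : ι → MvPolynomial (Fin n) ℝ) :
    coeffNorm (∑ i ∈ s, p i) ≤ ∑ i ∈ s, coeffNorm (p i) :=
  Finset.le_sum_of_subadditive _ coeffNorm_zero.le coeffNorm_add_le s p

theorem coeffNorm_monomial (α : Fin n →₀ ℕ) (c : ℝ) :
    coeffNorm (MvPolynomial.monomial α c) = |c| := by
  classical
  rw [coeffNorm_eq_sum (MvPolynomial.support_monomial_subset (s := α) (a := c))]
  simp

theorem coeffNorm_mul_le (p q : MvPolynomial (Fin n) ℝ) :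
    coeffNorm (p * q) ≤ coeffNorm p * coeffNorm q := by
  have h : p * q = ∑ α ∈ p.support, ∑ γ ∈ q.support,
      MvPolynomial.monomial (α + γ) (p.coeff α * q.coeff γ) := by
    conv_lhs => rw [p.as_sum, q.as_sum, Finset.sum_mul_sum]
    simp only [MvPolynomial.monomial_mul]
  rw [h]
  refine (coeffNorm_sum_le _ _).trans ?_
  rw [coeffNorm, coeffNorm, Finset.sum_mul_sum]
  refine Finset.sum_le_sum fun α _ => (coeffNorm_sum_le _ _).trans (le_of_eq ?_)
  simp only [coeffNorm_monomial, abs_mul]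

theorem coeffNorm_C_mul_le (c : ℝ) (p : MvPolynomial (Fin n) ℝ) :
    coeffNorm (MvPolynomial.C c * p) ≤ |c| * coeffNorm p :=
  (coeffNorm_mul_le _ _).trans_eq (by rw [MvPolynomial.C_apply, coeffNorm_monomial])

theorem coeffNorm_pow_le_one {p : MvPolynomial (Fin n) ℝ} (h : coeffNorm p ≤ 1) (k : ℕ) :
    coeffNorm (p ^ k) ≤ 1 := by
  induction k with
  | zero => rw [pow_zero, MvPolynomial.one_def, coeffNorm_monomial, abs_one]
  | succ k ih =>
    rw [pow_succ]
    exact (coeffNorm_mul_le _ _).trans (mul_le_one₀ ih (coeffNorm_nonneg _) h)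

theorem abs_prod_pow_le_one {x : Fin n → ℝ} (hx : ∀ k, |x k| ≤ 1) (α : Fin n → ℕ) :
    |∏ i, x i ^ α i| ≤ 1 := by
  rw [Finset.abs_prod]
  exact Finset.prod_le_one (fun _ _ => abs_nonneg _) fun i _ => by
    rw [abs_pow]; exact pow_le_one₀ (abs_nonneg _) (hx i)

theorem abs_eval_le_coeffNorm (p : MvPolynomial (Fin n) ℝ) {x : Fin n → ℝ} (hx : ∀ k, |x k| ≤ 1) :
    |MvPolynomial.eval x p| ≤ coeffNorm p := by
  rw [MvPolynomial.eval_eq']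
  refine (Finset.abs_sum_le_sum_abs _ _).trans (Finset.sum_le_sum fun α _ => ?_)
  rw [abs_mul]
  exact mul_le_of_le_one_right (abs_nonneg _) (abs_prod_pow_le_one hx α)

/-- Substituting a linear form with coefficient norm at most one does not increase coefficient
norms. -/
theorem exists_comp_linear {Q : Polynomial ℝ} {K : ℕ} {B : ℝ} (hQ : Q.natDegree ≤ K)
    (hB : CoeffBound Q B) {ℓ : MvPolynomial (Fin n) ℝ} (hdeg : ℓ.totalDegree ≤ 1)
    (hℓ : coeffNorm ℓ ≤ 1) : ∃ p : MvPolynomial (Fin n) ℝ, p.totalDegree ≤ K ∧ coeffNorm p ≤ B ∧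
      ∀ x, MvPolynomial.eval x p = Q.eval (MvPolynomial.eval x ℓ) := by
  refine ⟨∑ i ∈ Finset.range (K + 1), MvPolynomial.C (Q.coeff i) * ℓ ^ i, ?_, ?_, fun x => ?_⟩
  · refine MvPolynomial.totalDegree_finsetSum_le fun i hi => ?_
    refine (MvPolynomial.totalDegree_mul _ _).trans ?_
    rw [MvPolynomial.totalDegree_C, zero_add]
    refine (MvPolynomial.totalDegree_pow _ _).trans ?_
    have := Finset.mem_range.1 hi
    nlinarith
  · refine (coeffNorm_sum_le _ _).trans (le_trans (Finset.sum_le_sum fun i _ => ?_) (hB (K + 1)))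
    exact (coeffNorm_C_mul_le _ _).trans
      (mul_le_of_le_one_right (abs_nonneg _) (coeffNorm_pow_le_one hℓ i))
  · rw [Polynomial.eval_eq_sum_range' (n := K + 1) (by omega), map_sum]
    simp

end coeffNorm

/-! ### Polynomials close to a network -/

namespace Network

variable {n N : ℕ} {net : Network n N} {lam : ℝ}

theorem abs_hidden_le (hW : ∀ j, ∑ k, |net.W j k| ≤ lam) {x : Fin n → ℝ} (hx : ∀ k, |x k| ≤ 1)
    (j : Fin N) : |∑ k, net.W j k * x k| ≤ lam := by
  refine (Finset.abs_sum_le_sum_abs _ _).trans ((Finset.sum_le_sum fun k _ => ?_).trans (hW j))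
  rw [abs_mul]
  exact mul_le_of_le_one_right (abs_nonneg _) (hx k)

theorem preactivation_sub (net : Network n N) (x : Fin n → ℝ) :
    net.preactivation x - net.preactivation 0 = ∑ j, net.w j *
      (activation (net.β j) (net.hiddenBias j + ∑ k, net.W j k * x k) -
        activation (net.β j) (net.hiddenBias j)) := by
  simp only [preactivation, Pi.zero_apply, mul_zero, Finset.sum_const_zero, add_zero,
    add_sub_add_left_eq_sub, mul_sub, Finset.sum_sub_distrib]

theorem topNorm_nonneg (net : Network n N) : 0 ≤ net.topNorm :=
  Finset.sum_nonneg fun _ _ => abs_nonneg _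

theorem abs_preactivation_sub_le (hβ : ∀ j, net.β j ∈ Set.Icc (0 : ℝ) 1)
    (hW : ∀ j, ∑ k, |net.W j k| ≤ lam) {x : Fin n → ℝ} (hx : ∀ k, |x k| ≤ 1) :
    |net.preactivation x - net.preactivation 0| ≤ net.topNorm * (2 * lam) := by
  rw [preactivation_sub, topNorm, Finset.sum_mul]
  refine (Finset.abs_sum_le_sum_abs _ _).trans (Finset.sum_le_sum fun j _ => ?_)
  rw [abs_mul]
  refine mul_le_mul_of_nonneg_left ((abs_activation_sub_le (hβ j) _ _).trans ?_) (abs_nonneg _)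
  rw [add_sub_cancel_left]
  exact mul_le_mul_of_nonneg_left (abs_hidden_le hW hx j) zero_le_two

theorem continuous_preactivation (hβ : ∀ j, net.β j ∈ Set.Icc (0 : ℝ) 1) :
    Continuous net.preactivation := by
  unfold preactivation
  refine continuous_const.add (continuous_finsetSum _ fun j _ => continuous_const.mul ?_)
  exact (activation_continuous (hβ j)).comp (by fun_prop)

/-- On the cube, `v*` minus its value at the origin is close to a polynomial with moderate
coefficients. -/
theorem exists_polynomial_near_preactivation (hβ : ∀ j, net.β j ∈ Set.Icc (0 : ℝ) 1)
    (hlam : 0 < lam) (hW : ∀ j, ∑ k, |net.W j k| ≤ lam) (D : ℕ) :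
    ∃ p : MvPolynomial (Fin n) ℝ, p.totalDegree ≤ D + 1 ∧
      coeffNorm p ≤ net.topNorm * (lam * (4 * 3 ^ D)) ∧
      ∀ x : Fin n → ℝ, (∀ k, |x k| ≤ 1) →
        |net.preactivation x - net.preactivation 0 - MvPolynomial.eval x p| ≤
          net.topNorm * (lam * (4 * (2 * lam + 1) * Real.exp (-(D / (2 * lam + 1))))) := by
  have h : ∀ j, ∃ p : MvPolynomial (Fin n) ℝ, p.totalDegree ≤ D + 1 ∧
      coeffNorm p ≤ lam * (4 * 3 ^ D) ∧ ∀ x : Fin n → ℝ, (∀ k, |x k| ≤ 1) →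
        |activation (net.β j) (net.hiddenBias j + ∑ k, net.W j k * x k) -
        activation (net.β j) (net.hiddenBias j) - MvPolynomial.eval x p| ≤
          lam * (4 * (2 * lam + 1) * Real.exp (-(D / (2 * lam + 1)))) := by
    intro j
    obtain ⟨Q, hQ1, hQ2, hQ3⟩ :=
      exists_polynomial_near_activation (hβ j) hlam (net.hiddenBias j) D
    let ℓ : MvPolynomial (Fin n) ℝ :=
      ∑ k, MvPolynomial.monomial (Finsupp.single k 1) (net.W j k / lam)
    have hℓdeg : ℓ.totalDegree ≤ 1 := MvPolynomial.totalDegree_finsetSum_le fun k _ =>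
      (MvPolynomial.totalDegree_monomial_le _ _).trans (by simp)
    have hℓ : coeffNorm ℓ ≤ 1 := by
      refine (coeffNorm_sum_le _ _).trans ?_
      simp only [coeffNorm_monomial, abs_div, ← Finset.sum_div, abs_of_pos hlam]
      exact (div_le_one hlam).2 (hW j)
    have hev : ∀ x, lam * MvPolynomial.eval x ℓ = ∑ k, net.W j k * x k := by
      intro x
      simp only [ℓ, map_sum, MvPolynomial.eval_monomial, Finset.mul_sum]
      refine Finset.sum_congr rfl fun k _ => ?_
      simp only [pow_zero, Finsupp.prod_single_index, pow_one]
      field_simp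
    obtain ⟨p, hp1, hp2, hp3⟩ := exists_comp_linear hQ1 hQ2 hℓdeg hℓ
    refine ⟨p, hp1, hp2, fun x hx => ?_⟩
    rw [hp3, ← hev]
    refine hQ3 _ (abs_le.1 ?_)
    exact (abs_eval_le_coeffNorm _ hx).trans hℓ
  choose p hp1 hp2 hp3 using h
  refine ⟨∑ j, MvPolynomial.C (net.w j) * p j, ?_, ?_, fun x hx => ?_⟩
  · refine MvPolynomial.totalDegree_finsetSum_le fun j _ => ?_
    refine (MvPolynomial.totalDegree_mul _ _).trans ?_
    rw [MvPolynomial.totalDegree_C, zero_add]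
    exact hp1 j
  · refine (coeffNorm_sum_le _ _).trans ?_
    rw [topNorm, Finset.sum_mul]
    exact Finset.sum_le_sum fun j _ => (coeffNorm_C_mul_le _ _).trans
      (mul_le_mul_of_nonneg_left (hp2 j) (abs_nonneg _))
  · rw [preactivation_sub, map_sum, ← Finset.sum_sub_distrib, topNorm, Finset.sum_mul]
    refine (Finset.abs_sum_le_sum_abs _ _).trans (Finset.sum_le_sum fun j _ => ?_)
    rw [map_mul, MvPolynomial.eval_C, ← mul_sub, abs_mul]
    exact mul_le_mul_of_nonneg_left (hp3 j x hx) (abs_nonneg _)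

end Network

/-! ### The logistic loss -/

/-- The even part `log (2 cosh v)` of the logistic loss. -/
def logTwoCosh (v : ℝ) : ℝ := Real.log (Real.exp v + Real.exp (-v))

theorem logisticLoss_eq (v : ℝ) {y : ℝ} (hy : y = 1 ∨ y = -1) :
    logisticLoss v y = logTwoCosh v - v * y := by
  have key : ∀ u : ℝ, Real.log (1 + Real.exp (-2 * u)) = logTwoCosh u - u := by
    intro u
    have : Real.exp u + Real.exp (-u) = Real.exp u * (1 + Real.exp (-2 * u)) := by
      rw [mul_add, mul_one, ← Real.exp_add]; ring_nf
    rw [logTwoCosh, this, Real.log_mul (Real.exp_pos _).ne' (by positivity), Real.log_exp]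
    ring
  rcases hy with rfl | rfl
  · simpa [logisticLoss] using key v
  · have := key (-v)
    simp only [logTwoCosh, neg_neg, mul_neg] at this
    simp only [logisticLoss, logTwoCosh, mul_neg, mul_one, sub_neg_eq_add]
    rw [this, add_comm (Real.exp (-v))]
    ring

theorem hasDerivAt_logTwoCosh (v : ℝ) : HasDerivAt logTwoCosh (Real.tanh v) v := by
  have h1 : HasDerivAt (fun v : ℝ => Real.exp v + Real.exp (-v))
      (Real.exp v - Real.exp (-v)) v := by
    refine ((Real.hasDerivAt_exp v).add ((Real.hasDerivAt_exp (-v)).comp v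
      (hasDerivAt_neg v))).congr_deriv ?_
    ring
  have := h1.log (by positivity)
  rwa [← Real.tanh_eq] at this

theorem hasDerivAt_tanh (v : ℝ) : HasDerivAt Real.tanh (1 / Real.cosh v ^ 2) v := by
  have hfun : Real.tanh = fun x => Real.sinh x / Real.cosh x := by
    funext y; rw [Real.tanh_eq_sinh_div_cosh]
  rw [hfun]
  refine ((Real.hasDerivAt_sinh v).div (Real.hasDerivAt_cosh v)
    (Real.cosh_pos v).ne').congr_deriv ?_
  have := Real.cosh_sq v
  rw [show Real.cosh v * Real.cosh v - Real.sinh v * Real.sinh v = 1 by nlinarith]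

theorem monotone_tanh : Monotone Real.tanh :=
  monotone_of_hasDerivAt_nonneg hasDerivAt_tanh fun v => by
    have := Real.cosh_pos v
    simp only [Pi.zero_apply]; positivity

theorem monotone_sub_tanh : Monotone (fun v => v - Real.tanh v) :=
  monotone_of_hasDerivAt_nonneg (fun v => (hasDerivAt_id v).sub (hasDerivAt_tanh v)) fun v => by
    have := Real.one_le_cosh v
    simp only [Pi.zero_apply, sub_nonneg]
    rw [div_le_one (by positivity)]
    exact one_le_pow₀ this

theorem abs_tanh_sub_tanh_le (x y : ℝ) : |Real.tanh x - Real.tanh y| ≤ |x - y| := by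
  rcases le_total x y with h | h
  · have h1 := monotone_tanh h
    have h2 := monotone_sub_tanh h
    simp only at h2
    rw [abs_of_nonpos (by linarith), abs_of_nonpos (by linarith)]
    linarith
  · have h1 := monotone_tanh h
    have h2 := monotone_sub_tanh h
    simp only at h2
    rw [abs_of_nonneg (by linarith), abs_of_nonneg (by linarith)]
    linarith

/-- A function with monotone derivative lies above its tangents. -/
theorem tangent_le_of_monotone_deriv {f f' : ℝ → ℝ} (hf : ∀ x, HasDerivAt f (f' x) x)
    (hm : Monotone f') (x y : ℝ) : f x + f' x * (y - x) ≤ f y := by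
  have hcont : Continuous f := continuous_iff_continuousAt.2 fun x => (hf x).continuousAt
  rcases lt_trichotomy x y with h | rfl | h
  · obtain ⟨c, hc, he⟩ := exists_hasDerivAt_eq_slope f f' h hcont.continuousOn fun z _ => hf z
    have := hm hc.1.le
    rw [he, le_div_iff₀ (by linarith)] at this
    linarith
  · simp
  · obtain ⟨c, hc, he⟩ := exists_hasDerivAt_eq_slope f f' h hcont.continuousOn fun z _ => hf z
    have := hm hc.2.le
    rw [he, div_le_iff₀ (by linarith)] at this
    linarith

theorem logTwoCosh_tangent_le (x y : ℝ) :
    logTwoCosh x + Real.tanh x * (y - x) ≤ logTwoCosh y :=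
  tangent_le_of_monotone_deriv hasDerivAt_logTwoCosh monotone_tanh x y

theorem logTwoCosh_le_quadratic (x y : ℝ) :
    logTwoCosh y ≤ logTwoCosh x + Real.tanh x * (y - x) + (y - x) ^ 2 / 2 := by
  have := tangent_le_of_monotone_deriv (f := fun v => v ^ 2 / 2 - logTwoCosh v)
    (f' := fun v => v - Real.tanh v)
    (fun v => (((hasDerivAt_pow 2 v).div_const 2).sub (hasDerivAt_logTwoCosh v)).congr_deriv
      (by simp)) monotone_sub_tanh x y
  nlinarith

theorem logisticLoss_nonneg (v y : ℝ) : 0 ≤ logisticLoss v y :=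
  Real.log_nonneg (by linarith [Real.exp_pos (-2 * v * y)])

theorem abs_logTwoCosh_sub_le (x y : ℝ) : |logTwoCosh x - logTwoCosh y| ≤ |x - y| := by
  have h : ∀ x y : ℝ, logTwoCosh x - logTwoCosh y ≤ |x - y| := by
    intro x y
    have h1 := logTwoCosh_tangent_le x y
    have h2 : Real.tanh x * (x - y) ≤ |x - y| := by
      refine (le_abs_self _).trans ?_
      rw [abs_mul]
      exact mul_le_of_le_one_left (abs_nonneg _) (Real.abs_tanh_lt_one x).le
    linarith
  exact abs_le.2 ⟨by have := h y x; rw [abs_sub_comm] at this; linarith, h x y⟩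

theorem abs_logisticLoss_sub_le (v v' : ℝ) {y : ℝ} (hy : y = 1 ∨ y = -1) :
    |logisticLoss v y - logisticLoss v' y| ≤ 2 * |v - v'| := by
  rw [logisticLoss_eq v hy, logisticLoss_eq v' hy]
  have h1 := abs_logTwoCosh_sub_le v v'
  have h2 : |(v - v') * y| = |v - v'| := by
    rw [abs_mul]; rcases hy with rfl | rfl <;> simp
  rw [show logTwoCosh v - v * y - (logTwoCosh v' - v' * y) =
    (logTwoCosh v - logTwoCosh v') - (v - v') * y by ring]
  refine (abs_sub _ _).trans ?_
  linarith

theorem logisticLoss_le {v y B : ℝ} (hy : y = 1 ∨ y = -1) (hv : |v| ≤ B) :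
    logisticLoss v y ≤ 1 + 2 * B := by
  have h := (abs_le.1 (abs_logisticLoss_sub_le v 0 hy)).2
  have h0 : logisticLoss 0 y = Real.log 2 := by norm_num [logisticLoss]
  have := Real.log_two_lt_d9
  rw [sub_zero] at h
  linarith

theorem measurable_logisticLoss : Measurable (fun p : ℝ × ℝ => logisticLoss p.1 p.2) := by
  unfold logisticLoss
  fun_prop

/-! ### The population risk -/

section risk

variable {n N : ℕ} {net : Network n N} {P : Measure ((Fin n → ℝ) × ℝ)}

theorem integrable_logisticLoss [IsProbabilityMeasure P] (hP : IsNetworkLaw net P)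
    {v : (Fin n → ℝ) → ℝ} (hv : Measurable v) {B : ℝ}
    (hB : ∀ x : Fin n → ℝ, (∀ k, |x k| ≤ 1) → |v x| ≤ B) :
    Integrable (fun z => logisticLoss (v z.1) z.2) P := by
  refine Integrable.of_bound (C := 1 + 2 * B) ?_ ?_
  · exact (measurable_logisticLoss.comp
      ((hv.comp measurable_fst).prodMk measurable_snd)).aestronglyMeasurable
  · filter_upwards [hP.input_bounded, hP.label_sign] with z h1 h2
    rw [Real.norm_of_nonneg (logisticLoss_nonneg _ _)]
    exact logisticLoss_le h2 (hB _ h1)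

theorem risk_nonneg (v : (Fin n → ℝ) → ℝ) : 0 ≤ risk P v :=
  integral_nonneg fun _ => logisticLoss_nonneg _ _

theorem risk_sub_le [IsProbabilityMeasure P] (hP : IsNetworkLaw net P)
    {v v' : (Fin n → ℝ) → ℝ} (hv : Measurable v) (hv' : Measurable v') {B B' η : ℝ}
    (hB : ∀ x : Fin n → ℝ, (∀ k, |x k| ≤ 1) → |v x| ≤ B)
    (hB' : ∀ x : Fin n → ℝ, (∀ k, |x k| ≤ 1) → |v' x| ≤ B')
    (h : ∀ x : Fin n → ℝ, (∀ k, |x k| ≤ 1) → |v x - v' x| ≤ η) :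
    risk P v - risk P v' ≤ 2 * η := by
  rw [risk, risk, ← integral_sub (integrable_logisticLoss hP hv hB)
    (integrable_logisticLoss hP hv' hB')]
  have : (2 * η) = ∫ _, 2 * η ∂P := by simp
  rw [this]
  refine integral_mono_ae ((integrable_logisticLoss hP hv hB).sub
    (integrable_logisticLoss hP hv' hB')) (integrable_const _) ?_
  filter_upwards [hP.input_bounded, hP.label_sign] with z h1 h2
  refine (le_abs_self _).trans ((abs_logisticLoss_sub_le _ _ h2).trans ?_)
  exact mul_le_mul_of_nonneg_left (h _ h1) zero_le_two

/-- The label may be replaced by its conditional mean `tanh (v*(X))` inside the risk. -/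
theorem risk_eq_integral [IsProbabilityMeasure P] (hP : IsNetworkLaw net P)
    {v : (Fin n → ℝ) → ℝ} (hv : Measurable v) {B : ℝ}
    (hB : ∀ x : Fin n → ℝ, (∀ k, |x k| ≤ 1) → |v x| ≤ B) :
    Integrable (fun z => logTwoCosh (v z.1) - v z.1 * Real.tanh (net.preactivation z.1)) P ∧
    risk P v = ∫ z, (logTwoCosh (v z.1) - v z.1 * Real.tanh (net.preactivation z.1)) ∂P := by
  have h𝒢 : MeasurableSpace.comap (Prod.fst : (Fin n → ℝ) × ℝ → Fin n → ℝ) inferInstance ≤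
    Prod.instMeasurableSpace := measurable_fst.comap_le
  have hY : Integrable (fun z : (Fin n → ℝ) × ℝ => z.2) P := by
    refine Integrable.of_bound (C := 1) measurable_snd.aestronglyMeasurable ?_
    filter_upwards [hP.label_sign] with z h
    rcases h with h | h <;> simp [h]
  have hvm : StronglyMeasurable[MeasurableSpace.comap Prod.fst inferInstance]
      (fun z : (Fin n → ℝ) × ℝ => v z.1) :=
    (hv.comp (comap_measurable Prod.fst)).stronglyMeasurable
  have hψ : Continuous logTwoCosh :=
    continuous_iff_continuousAt.2 fun x => (hasDerivAt_logTwoCosh x).continuousAt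
  have hvY : Integrable (fun z : (Fin n → ℝ) × ℝ => v z.1 * z.2) P := by
    refine Integrable.of_bound (C := B)
      ((hv.comp measurable_fst).mul measurable_snd).aestronglyMeasurable ?_
    filter_upwards [hP.input_bounded, hP.label_sign] with z h1 h2
    rw [norm_mul]
    have := hB _ h1
    rcases h2 with h | h <;> simpa [h] using this
  have hce := condExp_mul_of_stronglyMeasurable_left (μ := P) hvm hvY hY
  have hae : P[(fun z => v z.1 * z.2) | MeasurableSpace.comap Prod.fst inferInstance] =ᵐ[P]
      fun z => v z.1 * Real.tanh (net.preactivation z.1) := by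
    filter_upwards [hce, hP.condExp_label] with z h1 h2
    refine h1.trans ?_
    simp only [Pi.mul_apply]
    rw [h2]
  have hint : Integrable (fun z => v z.1 * Real.tanh (net.preactivation z.1)) P :=
    (integrable_condExp).congr hae
  have heq : ∫ z, v z.1 * z.2 ∂P = ∫ z, v z.1 * Real.tanh (net.preactivation z.1) ∂P := by
    rw [← integral_condExp h𝒢, integral_congr_ae hae]
  have hψi : Integrable (fun z : (Fin n → ℝ) × ℝ => logTwoCosh (v z.1)) P := by
    refine Integrable.of_bound (C := |logTwoCosh 0| + B)
      (hψ.measurable.comp (hv.comp measurable_fst)).aestronglyMeasurable ?_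
    filter_upwards [hP.input_bounded] with z h1
    have h2 := abs_logTwoCosh_sub_le (v z.1) 0
    have h3 := abs_sub_abs_le_abs_sub (logTwoCosh (v z.1)) (logTwoCosh 0)
    have h4 := hB _ h1
    rw [sub_zero] at h2
    rw [Real.norm_eq_abs]
    linarith
  refine ⟨hψi.sub hint, ?_⟩
  rw [integral_sub hψi hint, ← heq, ← integral_sub hψi hvY, risk]
  refine integral_congr_ae ?_
  filter_upwards [hP.label_sign] with z h
  exact logisticLoss_eq _ h

theorem logTwoCosh_neg (v : ℝ) : logTwoCosh (-v) = logTwoCosh v := by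
  rw [logTwoCosh, neg_neg, add_comm, logTwoCosh]

theorem logTwoCosh_le (v : ℝ) : logTwoCosh v ≤ v + Real.exp (-2 * v) := by
  have h := logisticLoss_eq v (y := 1) (Or.inl rfl)
  have h2 := Real.log_le_sub_one_of_pos (show 0 < 1 + Real.exp (-2 * v * 1) by positivity)
  rw [logisticLoss] at h
  simp only [mul_one] at h h2
  linarith

theorem le_logTwoCosh (v : ℝ) : v ≤ logTwoCosh v := by
  have h := logisticLoss_eq v (y := 1) (Or.inl rfl)
  have := logisticLoss_nonneg v 1
  linarith

/-- A constant of the sign of `v*` and of absolute value at most `|v*|` has small excess risk if it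
is large: the labels are then almost deterministic, and both risks are almost zero. -/
theorem risk_const_sub_le [IsProbabilityMeasure P] (hP : IsNetworkLaw net P)
    (hm : Measurable net.preactivation) {B : ℝ}
    (hB : ∀ x : Fin n → ℝ, (∀ k, |x k| ≤ 1) → |net.preactivation x| ≤ B)
    {s L : ℝ} (hs : s = 1 ∨ s = -1)
    (hL : ∀ x : Fin n → ℝ, (∀ k, |x k| ≤ 1) → L ≤ s * net.preactivation x) :
    risk P (fun _ => s * L) - risk P net.preactivation ≤ Real.exp (-2 * L) := by
  obtain ⟨i1, e1⟩ := risk_eq_integral hP (v := fun _ => s * L) measurable_const (B := |s * L|)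
    (fun _ _ => le_rfl)
  obtain ⟨i2, e2⟩ := risk_eq_integral hP hm hB
  rw [e1, e2, ← integral_sub i1 i2]
  have : Real.exp (-2 * L) = ∫ _, Real.exp (-2 * L) ∂P := by simp
  rw [this]
  refine integral_mono_ae (i1.sub i2) (integrable_const _) ?_
  filter_upwards [hP.input_bounded] with z h1
  have key : ∀ u : ℝ, L ≤ u → logTwoCosh L - L * Real.tanh u - (logTwoCosh u - u * Real.tanh u) ≤
      Real.exp (-2 * L) := by
    intro u hu
    have h2 := logTwoCosh_le L
    have h3 := le_logTwoCosh u
    have h4 : (u - L) * Real.tanh u ≤ u - L :=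
      mul_le_of_le_one_right (by linarith) (Real.tanh_lt_one u).le
    linarith
  have h2 := key _ (hL _ h1)
  rcases hs with rfl | rfl
  · simpa using h2
  · simpa [logTwoCosh_neg] using h2

end risk

/-! ### A good feasible polynomial -/

theorem measurable_eval {n : ℕ} (p : MvPolynomial (Fin n) ℝ) :
    Measurable (fun x : Fin n → ℝ => MvPolynomial.eval x p) := p.continuous_eval.measurable

/-- The two uses of the lower bound on the degree, for `A = max 1 ‖w‖₁ λ / ε`: it makes `A` at most
`2 ^ D`, and the rate `exp (-D / (2 λ + 1))` of the polynomial approximation at most a large power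
of `A⁻¹`. -/
theorem degree_bounds {lam A : ℝ} {D : ℕ} (hlam : 2 ≤ lam) (hA : 4 / 3 ≤ A)
    (hD : 100 * lam * Real.log A ≤ D) :
    A ≤ 2 ^ D ∧ Real.exp (-(D / (2 * lam + 1))) ≤ A⁻¹ ^ 40 := by
  have hA0 : 0 < A := by linarith
  have hl : 0 ≤ Real.log A := Real.log_nonneg (by linarith)
  have h1 : 40 * Real.log A ≤ D / (2 * lam + 1) := by
    rw [le_div_iff₀ (by linarith)]
    nlinarith
  constructor
  · have h2 : Real.log A ≤ D * Real.log 2 := by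
      have := Real.log_two_gt_d9
      have hD0 : (0 : ℝ) ≤ D := Nat.cast_nonneg D
      nlinarith
    rw [← Real.exp_log hA0, ← Real.exp_log (show (0 : ℝ) < 2 ^ D by positivity), Real.log_pow]
    exact Real.exp_le_exp.2 h2
  · rw [← Real.exp_log hA0, ← Real.exp_neg, ← Real.exp_nat_mul]
    refine Real.exp_le_exp.2 ?_
    push_cast
    linarith

/-- Some feasible polynomial has excess risk at most `ε / 2`. The zero polynomial serves if `ε` is
large. Otherwise the polynomial that approximates `v*` serves, unless its constant coefficient,
which is about `v* 0`, exceeds the constraint; then a large constant of the sign of `v* 0` does. -/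
theorem exists_comparator {n N : ℕ} {net : Network n N} {P : Measure ((Fin n → ℝ) × ℝ)}
    {lam ε : ℝ} {D : ℕ} [IsProbabilityMeasure P] (hP : IsNetworkLaw net P)
    (hβ : ∀ j, net.β j ∈ Set.Icc (0 : ℝ) 1) (hlam : 2 ≤ lam) (hW : ∀ j, ∑ k, |net.W j k| ≤ lam)
    (hε : 0 < ε) (hD1 : 1 ≤ D)
    (hD : 100 * lam * Real.log (max 1 net.topNorm * lam / ε) ≤ D) :
    ∃ u : MvPolynomial (Fin n) ℝ, Feasible D ((lam ^ D) ^ 10) u ∧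
      risk P (fun x => MvPolynomial.eval x u) - risk P net.preactivation ≤ ε / 2 := by
  have hcont := (net.continuous_preactivation hβ).measurable
  have hlam0 : 0 < lam := by linarith
  rcases le_or_gt (3 / 2) ε with hε2 | hε2
  · refine ⟨0, ⟨by simp, by rw [coeffNorm_zero]; positivity⟩, ?_⟩
    have h1 : risk P (fun x => MvPolynomial.eval x (0 : MvPolynomial (Fin n) ℝ)) = Real.log 2 := by
      simp only [risk, map_zero, logisticLoss]
      norm_num
    have h2 := risk_nonneg (P := P) net.preactivation
    have := Real.log_two_lt_d9
    linarith
  set T := net.topNorm with hT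
  have hT0 : 0 ≤ T := net.topNorm_nonneg
  set A := max 1 T * lam / ε with hA
  have hεA : max 1 T * lam = ε * A := by rw [hA]; field_simp
  have hTA : T * lam ≤ ε * A := by
    rw [← hεA]; exact mul_le_mul_of_nonneg_right (le_max_right _ _) hlam0.le
  have hlA : lam ≤ ε * A := by
    rw [← hεA]; exact le_mul_of_one_le_left hlam0.le (le_max_left _ _)
  have hA1 : 4 / 3 ≤ A := by
    by_contra h
    push Not at h
    nlinarith
  obtain ⟨hA2, hAexp⟩ := degree_bounds hlam hA1 hD
  have hX2 : (2 : ℝ) ^ D ≤ lam ^ D := pow_le_pow_left₀ (by norm_num) hlam D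
  have hX : (2 : ℝ) ≤ lam ^ D := le_trans (by
    calc (2 : ℝ) = 2 ^ 1 := by norm_num
      _ ≤ 2 ^ D := pow_le_pow_right₀ (by norm_num) hD1) hX2
  set X := lam ^ D with hXdef
  obtain ⟨D', rfl⟩ : ∃ D', D = D' + 1 := ⟨D - 1, by omega⟩
  obtain ⟨p, hp1, hp2, hp3⟩ := net.exists_polynomial_near_preactivation hβ hlam0 hW D'
  have hvB : ∀ x : Fin n → ℝ, (∀ k, |x k| ≤ 1) →
      |net.preactivation x| ≤ |net.preactivation 0| + T * (2 * lam) := by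
    intro x hx
    have h1 := net.abs_preactivation_sub_le hβ hW hx
    have h2 := abs_sub_abs_le_abs_sub (net.preactivation x) (net.preactivation 0)
    linarith
  have hX8 : 64 * X ^ 2 ≤ X ^ 10 := by
    have : (2 : ℝ) ^ 8 ≤ X ^ 8 := pow_le_pow_left₀ (by norm_num) hX 8
    calc 64 * X ^ 2 ≤ X ^ 8 * X ^ 2 := by gcongr; linarith
      _ = X ^ 10 := by ring
  have hX1 : X ≤ X ^ 2 := by nlinarith
  rcases le_or_gt |net.preactivation 0| (X ^ 10 / 2) with hB | hB
  · -- The risk exceeds that of `v*` by at most twice the distance `E ≤ 30 ε A ^ (-38)`.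
    refine ⟨MvPolynomial.C (net.preactivation 0) + p, ⟨?_, ?_⟩, ?_⟩
    · refine (MvPolynomial.totalDegree_add _ _).trans (max_le ?_ hp1)
      rw [MvPolynomial.totalDegree_C]; omega
    · refine (coeffNorm_add_le _ _).trans ?_
      rw [MvPolynomial.C_apply, coeffNorm_monomial]
      have h1 : T * (lam * (4 * 3 ^ D')) ≤ X ^ 10 / 2 := by
        have h3 : (3 : ℝ) ^ D' ≤ X ^ 2 := by
          calc (3 : ℝ) ^ D' ≤ 4 ^ D' := by gcongr; norm_num
            _ ≤ 4 ^ (D' + 1) := pow_le_pow_right₀ (by norm_num) (by omega)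
            _ = (2 ^ (D' + 1)) ^ 2 := by rw [← pow_mul, mul_comm, pow_mul]; norm_num
            _ ≤ X ^ 2 := by gcongr
        have h4 : T * lam ≤ 2 * X := by
          have : ε * A ≤ 2 * A := by nlinarith
          linarith
        have h5 : T * lam * (4 * 3 ^ D') ≤ 2 * X * (4 * X ^ 2) := by gcongr
        have h6 : 2 * X * (4 * X ^ 2) ≤ X ^ 10 / 2 := by
          have : (2 : ℝ) ^ 7 ≤ X ^ 7 := pow_le_pow_left₀ (by norm_num) hX 7
          calc 2 * X * (4 * X ^ 2) = 16 * X ^ 3 / 2 := by ring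
            _ ≤ X ^ 7 * X ^ 3 / 2 := by gcongr; linarith
            _ = X ^ 10 / 2 := by ring
        calc T * (lam * (4 * 3 ^ D')) = T * lam * (4 * 3 ^ D') := by ring
          _ ≤ _ := h5.trans h6
      linarith
    · set E := T * (lam * (4 * (2 * lam + 1) * Real.exp (-(D' / (2 * lam + 1))))) with hE
      have h := risk_sub_le hP (v := fun x => MvPolynomial.eval x
        (MvPolynomial.C (net.preactivation 0) + p)) (v' := net.preactivation) (measurable_eval _)
        hcont (fun x hx => abs_eval_le_coeffNorm _ hx) hvB (η := E) (fun x hx => by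
          have := hp3 x hx
          rw [abs_sub_comm] at this
          rw [map_add, MvPolynomial.eval_C]
          convert this using 2; ring)
      refine h.trans ?_
      have h1 : Real.exp (-(D' / (2 * lam + 1))) ≤ 2 * A⁻¹ ^ 40 := by
        have e : -((D' : ℝ) / (2 * lam + 1)) =
            1 / (2 * lam + 1) + -(((D' + 1 : ℕ) : ℝ) / (2 * lam + 1)) := by
          push_cast; field_simp; ring
        rw [e, Real.exp_add]
        have h2 : Real.exp (1 / (2 * lam + 1)) ≤ 2 := by
          refine (Real.le_log_iff_exp_le (by norm_num)).1 ?_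
          have := Real.log_two_gt_d9
          rw [div_le_iff₀ (by linarith)]
          nlinarith
        gcongr
      have hA0 : 0 < A := by linarith
      have h4 : E ≤ ε * A * (4 * (5 / 2 * (3 / 2 * A)) * (2 * A⁻¹ ^ 40)) := by
        rw [hE, ← mul_assoc]
        have : 2 * lam + 1 ≤ 5 / 2 * (3 / 2 * A) := by nlinarith
        gcongr
      have h5 : ε * A * (4 * (5 / 2 * (3 / 2 * A)) * (2 * A⁻¹ ^ 40)) = 30 * ε * A⁻¹ ^ 38 := by
        field_simp; norm_num
      have h6 : A⁻¹ ^ 38 ≤ (3 / 4) ^ 38 := by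
        gcongr
        rw [inv_le_comm₀ hA0 (by norm_num)]; linarith
      have h7 : (3 / 4 : ℝ) ^ 38 ≤ 1 / 120 := by norm_num
      nlinarith
  · -- The value of `v*` at the origin dominates: the sign of `v*` is constant on the cube.
    set L := X ^ 10 / 4 with hL
    have hTL : T * (2 * lam) ≤ L := by
      have : ε * A ≤ 2 * A := by nlinarith
      have : X ^ 2 ≤ X ^ 10 / 64 := by linarith
      linarith
    obtain ⟨s, hs, hs'⟩ : ∃ s : ℝ, (s = 1 ∨ s = -1) ∧
        s * net.preactivation 0 = |net.preactivation 0| := by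
      rcases le_total 0 (net.preactivation 0) with h | h
      · exact ⟨1, Or.inl rfl, by rw [abs_of_nonneg h, one_mul]⟩
      · exact ⟨-1, Or.inr rfl, by rw [abs_of_nonpos h]; ring⟩
    have hs1 : |s| = 1 := by rcases hs with rfl | rfl <;> simp
    have hX10 : 0 < X ^ 10 := by positivity
    refine ⟨MvPolynomial.C (s * L), ⟨by rw [MvPolynomial.totalDegree_C]; omega, ?_⟩, ?_⟩
    · rw [MvPolynomial.C_apply, coeffNorm_monomial, abs_mul, hs1, one_mul, abs_of_nonneg]
      · linarith
      · rw [hL]; positivity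
    · simp only [MvPolynomial.eval_C]
      refine (risk_const_sub_le hP hcont hvB hs fun x hx => ?_).trans ?_
      · have h1 := net.abs_preactivation_sub_le hβ hW hx
        have h2 : |s * (net.preactivation x - net.preactivation 0)| ≤ L := by
          rw [abs_mul, hs1, one_mul]; exact h1.trans hTL
        have h3 := (abs_le.1 h2).1
        rw [mul_sub, hs'] at h3
        linarith
      · have h1 := Real.add_one_le_exp (2 * L)
        rw [neg_mul, Real.exp_neg]
        have h2 : 4 ≤ ε * X ^ 2 := by
          have : 2 ≤ ε * X := hlam.trans (hlA.trans (by gcongr; linarith))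
          nlinarith
        rw [inv_le_comm₀ (Real.exp_pos _) (by linarith)]
        refine le_trans ?_ h1
        rw [inv_le_iff_one_le_mul₀ (by linarith)]
        have h3 : ε * (64 * X ^ 2) ≤ ε * X ^ 10 := mul_le_mul_of_nonneg_left hX8 hε.le
        have h4 : (2 * L + 1) * (ε / 2) = ε * X ^ 10 / 4 + ε / 2 := by rw [hL]; ring
        linarith

/-! ### Sparsification of convex combinations -/

section sparsify

variable {ι : Type*} [Fintype ι]

/-- The weights of a product distribution add up to one. -/
theorem sum_prod_weights (p : ι → ℝ) (h1 : ∑ i, p i = 1) (k : ℕ) :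
    ∑ s : Fin k → ι, ∏ j, p (s j) = 1 := by
  classical
  rw [← Fintype.sum_pow, h1, one_pow]

/-- The mean of a sum of `k` independent centred choices. -/
theorem sum_prod_weights_mul_sum (p a : ι → ℝ) (h1 : ∑ i, p i = 1) (h0 : ∑ i, p i * a i = 0)
    (k : ℕ) : ∑ s : Fin k → ι, (∏ j, p (s j)) * ∑ j, a (s j) = 0 := by
  induction k with
  | zero => simp
  | succ k ih =>
    rw [← (Fin.consEquiv fun _ => ι).sum_comp, Fintype.sum_prod_type]
    simp only [Fin.consEquiv_apply, Fin.prod_univ_succ, Fin.sum_univ_succ, Fin.cons_zero,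
      Fin.cons_succ]
    have : ∀ i, ∑ s : Fin k → ι, p i * (∏ j, p (s j)) * (a i + ∑ j, a (s j)) = p i * a i := by
      intro i
      have e : ∀ s : Fin k → ι, p i * (∏ j, p (s j)) * (a i + ∑ j, a (s j)) =
          p i * a i * (∏ j, p (s j)) + p i * ((∏ j, p (s j)) * ∑ j, a (s j)) := fun s => by ring
      simp_rw [e]
      rw [Finset.sum_add_distrib, ← Finset.mul_sum, ← Finset.mul_sum, ih, sum_prod_weights p h1]
      ring
    simp_rw [this, h0]

/-- The variance of a sum of `k` independent centred choices. -/
theorem sum_prod_weights_mul_sum_sq (p a : ι → ℝ) (h1 : ∑ i, p i = 1)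
    (h0 : ∑ i, p i * a i = 0) (k : ℕ) :
    ∑ s : Fin k → ι, (∏ j, p (s j)) * (∑ j, a (s j)) ^ 2 = k * ∑ i, p i * a i ^ 2 := by
  induction k with
  | zero => simp
  | succ k ih =>
    rw [← (Fin.consEquiv fun _ => ι).sum_comp, Fintype.sum_prod_type]
    simp only [Fin.consEquiv_apply, Fin.prod_univ_succ, Fin.sum_univ_succ, Fin.cons_zero,
      Fin.cons_succ]
    have : ∀ i, ∑ s : Fin k → ι, p i * (∏ j, p (s j)) * (a i + ∑ j, a (s j)) ^ 2 =
        p i * a i ^ 2 + p i * (k * ∑ i, p i * a i ^ 2) := by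
      intro i
      have e : ∀ s : Fin k → ι, p i * (∏ j, p (s j)) * (a i + ∑ j, a (s j)) ^ 2 =
          p i * a i ^ 2 * (∏ j, p (s j)) + 2 * p i * a i * ((∏ j, p (s j)) * ∑ j, a (s j)) +
            p i * ((∏ j, p (s j)) * (∑ j, a (s j)) ^ 2) := fun s => by ring
      simp_rw [e]
      rw [Finset.sum_add_distrib, Finset.sum_add_distrib, ← Finset.mul_sum, ← Finset.mul_sum,
        ← Finset.mul_sum, ih, sum_prod_weights p h1, sum_prod_weights_mul_sum p a h1 h0]
      ring
    simp_rw [this, Finset.sum_add_distrib, ← Finset.sum_mul, h1]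
    push_cast
    ring

/-- Maurey's argument: the averages of `k` atoms, drawn independently with the weights `p`, are on
average close to the convex combination of the atoms with these weights. -/
theorem sparsify {p h : ι → ℝ} (hp : ∀ i, 0 ≤ p i) (h1 : ∑ i, p i = 1) {R t : ℝ}
    (hR : ∀ i, |h i| ≤ R) (ht : 0 < t) {k : ℕ} (hk : R ^ 2 ≤ t ^ 2 * k) (hk0 : 0 < k) :
    ∑ s : Fin k → ι, (∏ j, p (s j)) * |1 / (k : ℝ) * ∑ j, h (s j) - ∑ i, p i * h i| ≤ t := by
  set u := ∑ i, p i * h i with hu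
  have hk' : (0 : ℝ) < k := Nat.cast_pos.2 hk0
  have h0 : ∑ i, p i * (h i - u) = 0 := by
    simp_rw [mul_sub, Finset.sum_sub_distrib, ← Finset.sum_mul, h1]
    rw [hu]; ring
  have hvar : ∑ i, p i * (h i - u) ^ 2 ≤ R ^ 2 := by
    have e : ∑ i, p i * (h i - u) ^ 2 = ∑ i, p i * h i ^ 2 - u ^ 2 := by
      have : ∀ i, p i * (h i - u) ^ 2 = p i * h i ^ 2 - 2 * u * (p i * h i) + u ^ 2 * p i :=
        fun i => by ring
      simp_rw [this]
      rw [Finset.sum_add_distrib, Finset.sum_sub_distrib, ← Finset.mul_sum, ← Finset.mul_sum, h1,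
        ← hu]
      ring
    have h2 : ∑ i, p i * h i ^ 2 ≤ ∑ i, p i * R ^ 2 :=
      Finset.sum_le_sum fun i _ => mul_le_mul_of_nonneg_left (sq_le_sq' (abs_le.1 (hR i)).1
        (abs_le.1 (hR i)).2) (hp i)
    rw [← Finset.sum_mul, h1, one_mul] at h2
    nlinarith
  have hw : ∀ s : Fin k → ι, 0 ≤ ∏ j, p (s j) := fun s => Finset.prod_nonneg fun j _ => hp _
  -- `|x| ≤ x ^ 2 / (2 t) + t / 2` replaces the square root of the variance.
  have hpt : ∀ s : Fin k → ι,
      (∏ j, p (s j)) * |1 / (k : ℝ) * ∑ j, h (s j) - u| ≤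
        1 / (2 * t * k ^ 2) * ((∏ j, p (s j)) * (∑ j, (h (s j) - u)) ^ 2) +
          t / 2 * ∏ j, p (s j) := by
    intro s
    have e : ∑ j, (h (s j) - u) = k * (1 / (k : ℝ) * ∑ j, h (s j) - u) := by
      rw [Finset.sum_sub_distrib, Finset.sum_const, Finset.card_univ, Fintype.card_fin,
        nsmul_eq_mul]
      field_simp
    rw [e]
    set x := 1 / (k : ℝ) * ∑ j, h (s j) - u
    have h3 : |x| ≤ x ^ 2 / (2 * t) + t / 2 := by
      rw [← sub_nonneg, ← sq_abs x]
      have : |x| ^ 2 / (2 * t) + t / 2 - |x| = (|x| - t) ^ 2 / (2 * t) := by field_simp; ring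
      rw [this]; positivity
    calc _ ≤ (∏ j, p (s j)) * (x ^ 2 / (2 * t) + t / 2) := mul_le_mul_of_nonneg_left h3 (hw s)
      _ = _ := by field_simp
  refine (Finset.sum_le_sum fun s _ => hpt s).trans ?_
  rw [Finset.sum_add_distrib, ← Finset.mul_sum, ← Finset.mul_sum, sum_prod_weights p h1,
    sum_prod_weights_mul_sum_sq p _ h1 h0]
  have h4 : 1 / (2 * t * k ^ 2) * (k * ∑ i, p i * (h i - u) ^ 2) ≤ t / 2 := by
    rw [one_div, inv_mul_le_iff₀ (by positivity)]
    have : k * ∑ i, p i * (h i - u) ^ 2 ≤ k * (t ^ 2 * k) := by gcongr; exact hvar.trans hk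
    linarith
  linarith

end sparsify

/-! ### Uniform deviations of the empirical risk -/

section deviation

variable {n N m : ℕ} {net : Network n N} {P : Measure ((Fin n → ℝ) × ℝ)}

/-- Hoeffding's inequality for the sum of a bounded function over an i.i.d. sample. -/
theorem measure_sum_sub_integral_ge_le {Z : Type*} [MeasurableSpace Z] {P : Measure Z}
    [IsProbabilityMeasure P] {g : Z → ℝ} (hg : Measurable g) {A B η : ℝ} (hAB : A < B)
    (hb : ∀ᵐ z ∂P, g z ∈ Set.Icc A B) (hm : 0 < m) (hη : 0 ≤ η) :
    (Measure.pi fun _ : Fin m => P).real {S | m * η ≤ ∑ i, (g (S i) - ∫ z, g z ∂P)} ≤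
      Real.exp (-(2 * m * η ^ 2 / (B - A) ^ 2)) := by
  have h1 := hasSubgaussianMGF_of_mem_Icc hg.aemeasurable hb
  have h2 : ∀ i : Fin m, HasSubgaussianMGF (fun S : Fin m → Z => g (S i) - ∫ z, g z ∂P)
      ((‖B - A‖₊ / 2) ^ 2) (Measure.pi fun _ : Fin m => P) := by
    intro i
    have hmp := measurePreserving_eval (fun _ : Fin m => P) i
    have h : HasSubgaussianMGF (fun z => g z - ∫ z, g z ∂P) ((‖B - A‖₊ / 2) ^ 2)
        (Measure.map (fun S : Fin m → Z => S i) (Measure.pi fun _ : Fin m => P)) := by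
      have e := hmp.map_eq
      change Measure.map (fun S : Fin m → Z => S i) _ = P at e
      rw [e]; exact h1
    exact HasSubgaussianMGF.of_map hmp.measurable.aemeasurable h
  have h3 : iIndepFun (fun (i : Fin m) (S : Fin m → Z) => g (S i) - ∫ z, g z ∂P)
      (Measure.pi fun _ : Fin m => P) :=
    iIndepFun_pi (X := fun _ z => g z - ∫ z, g z ∂P) fun _ => (hg.sub_const _).aemeasurable
  have h4 := HasSubgaussianMGF.measure_sum_ge_le_of_iIndepFun h3 (s := Finset.univ)
    (c := fun _ => (‖B - A‖₊ / 2) ^ 2) (fun i _ => h2 i) (ε := m * η) (by positivity)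
  refine h4.trans (le_of_eq ?_)
  congr 1
  simp only [Finset.sum_const, Finset.card_univ, Fintype.card_fin, nsmul_eq_mul]
  push_cast
  rw [Real.norm_of_nonneg (by linarith)]
  have : B - A ≠ 0 := by linarith
  have : (m : ℝ) ≠ 0 := by positivity
  field_simp

/-- Hoeffding's inequality for the empirical risk of a fixed bounded predictor. -/
theorem measure_abs_empiricalRisk_sub_risk_le [IsProbabilityMeasure P] (hP : IsNetworkLaw net P)
    {v : (Fin n → ℝ) → ℝ} (hv : Measurable v) {R η : ℝ} (hR : 0 ≤ R)
    (hb : ∀ x : Fin n → ℝ, (∀ k, |x k| ≤ 1) → |v x| ≤ R) (hm : 0 < m) (hη : 0 ≤ η) :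
    (Measure.pi fun _ : Fin m => P) {S | η < |empiricalRisk S v - risk P v|} ≤
      ENNReal.ofReal (2 * Real.exp (-(2 * m * η ^ 2 / (1 + 2 * R) ^ 2))) := by
  have hm' : (0 : ℝ) < m := Nat.cast_pos.2 hm
  let g : (Fin n → ℝ) × ℝ → ℝ := fun z => logisticLoss (v z.1) z.2
  have hg : Measurable g :=
    measurable_logisticLoss.comp ((hv.comp measurable_fst).prodMk measurable_snd)
  have hgb : ∀ᵐ z ∂P, g z ∈ Set.Icc 0 (1 + 2 * R) := by
    filter_upwards [hP.input_bounded, hP.label_sign] with z h1 h2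
    exact ⟨logisticLoss_nonneg _ _, logisticLoss_le h2 (hb _ h1)⟩
  have h1 := measure_sum_sub_integral_ge_le (m := m) hg (by linarith) hgb hm hη
  have h2 := measure_sum_sub_integral_ge_le (m := m) hg.neg (A := -(1 + 2 * R)) (B := 0)
    (by linarith) (by
      filter_upwards [hgb] with z h
      exact ⟨by simpa using h.2, by simpa using h.1⟩) hm hη
  rw [sub_zero] at h1
  rw [zero_sub, neg_neg] at h2
  have hdiff : ∀ S : Fin m → (Fin n → ℝ) × ℝ,
      m * (empiricalRisk S v - risk P v) = ∑ i, (g (S i) - ∫ z, g z ∂P) := by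
    intro S
    rw [Finset.sum_sub_distrib, Finset.sum_const, Finset.card_univ, Fintype.card_fin, nsmul_eq_mul,
      empiricalRisk, risk]
    field_simp
    rfl
  have hsub : {S : Fin m → (Fin n → ℝ) × ℝ | η < |empiricalRisk S v - risk P v|} ⊆
      {S | m * η ≤ ∑ i, (g (S i) - ∫ z, g z ∂P)} ∪
        {S | m * η ≤ ∑ i, ((-g) (S i) - ∫ z, (-g) z ∂P)} := by
    intro S hS
    have hS' : η < |empiricalRisk S v - risk P v| := hS
    rcases lt_abs.1 hS' with h | h
    · left
      rw [Set.mem_ofPred_eq, ← hdiff]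
      exact mul_le_mul_of_nonneg_left h.le hm'.le
    · right
      have e : ∑ i, ((-g) (S i) - ∫ z, (-g) z ∂P) = -∑ i, (g (S i) - ∫ z, g z ∂P) := by
        simp only [Pi.neg_apply, integral_neg, ← Finset.sum_neg_distrib]
        refine Finset.sum_congr rfl fun i _ => by ring
      rw [Set.mem_ofPred_eq, e, ← hdiff, ← mul_neg]
      exact mul_le_mul_of_nonneg_left h.le hm'.le
  refine (measure_mono hsub).trans ((measure_union_le _ _).trans ?_)
  rw [two_mul, ENNReal.ofReal_add (Real.exp_pos _).le (Real.exp_pos _).le]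
  refine add_le_add ?_ ?_
  · rw [← ofReal_measureReal]; exact ENNReal.ofReal_le_ofReal h1
  · rw [← ofReal_measureReal]; exact ENNReal.ofReal_le_ofReal h2

/-- The average of the atoms selected by `s`. -/
def atomAverage {ι X : Type*} {k : ℕ} (H : ι → X → ℝ) (s : Fin k → ι) (x : X) : ℝ :=
  1 / (k : ℝ) * ∑ j, H (s j) x

theorem abs_atomAverage_le {ι X : Type*} {k : ℕ} {H : ι → X → ℝ} {R : ℝ} (hk : 0 < k) {x : X}
    (h : ∀ i, |H i x| ≤ R) (s : Fin k → ι) : |atomAverage H s x| ≤ R := by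
  have hk' : (0 : ℝ) < k := Nat.cast_pos.2 hk
  rw [atomAverage, abs_mul, abs_of_pos (by positivity), one_div, inv_mul_le_iff₀ hk']
  refine (Finset.abs_sum_le_sum_abs _ _).trans ((Finset.sum_le_sum fun j _ => h (s j)).trans ?_)
  simp

/-- Simultaneous concentration for all averages of `k` atoms, by a union bound. The good event
includes that the sample lies in the cube, where the predictors are bounded. -/
theorem measure_exists_deviation_le {ι : Type*} [Fintype ι] [IsProbabilityMeasure P]
    (hP : IsNetworkLaw net P) {H : ι → (Fin n → ℝ) → ℝ} (hH : ∀ i, Measurable (H i)) {R η δ : ℝ}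
    (hR : 0 ≤ R) (hb : ∀ i, ∀ x : Fin n → ℝ, (∀ k, |x k| ≤ 1) → |H i x| ≤ R) (hm : 0 < m)
    (hη : 0 ≤ η) {k : ℕ} (hk : 0 < k)
    (hδ : (Fintype.card ι : ℝ) ^ k * (2 * Real.exp (-(2 * m * η ^ 2 / (1 + 2 * R) ^ 2))) ≤ δ) :
    (Measure.pi fun _ : Fin m => P) {S | ¬ ((∀ i, (∀ k, |(S i).1 k| ≤ 1) ∧
      ((S i).2 = 1 ∨ (S i).2 = -1)) ∧ ∀ s : Fin k → ι,
        |empiricalRisk S (atomAverage H s) - risk P (atomAverage H s)| ≤ η)} ≤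
      ENNReal.ofReal δ := by
  classical
  have hbox : (Measure.pi fun _ : Fin m => P) {S | ¬ ∀ i, (∀ k, |(S i).1 k| ≤ 1) ∧
      ((S i).2 = 1 ∨ (S i).2 = -1)} = 0 := by
    have h : ∀ᵐ S ∂(Measure.pi fun _ : Fin m => P), ∀ i, (∀ k, |(S i).1 k| ≤ 1) ∧
        ((S i).2 = 1 ∨ (S i).2 = -1) := by
      rw [ae_all_iff]
      intro i
      exact (measurePreserving_eval (fun _ : Fin m => P) i).quasiMeasurePreserving.ae
        (hP.input_bounded.and hP.label_sign)
    exact h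
  have hsub : {S : Fin m → (Fin n → ℝ) × ℝ | ¬ ((∀ i, (∀ k, |(S i).1 k| ≤ 1) ∧
      ((S i).2 = 1 ∨ (S i).2 = -1)) ∧ ∀ s : Fin k → ι,
        |empiricalRisk S (atomAverage H s) - risk P (atomAverage H s)| ≤ η)} ⊆
      {S | ¬ ∀ i, (∀ k, |(S i).1 k| ≤ 1) ∧ ((S i).2 = 1 ∨ (S i).2 = -1)} ∪
        ⋃ s : Fin k → ι, {S | η < |empiricalRisk S (atomAverage H s) -
          risk P (atomAverage H s)|} := by
    intro S hS
    by_cases h : ∀ i, (∀ k, |(S i).1 k| ≤ 1) ∧ ((S i).2 = 1 ∨ (S i).2 = -1)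
    · right
      rw [Set.mem_ofPred_eq, not_and] at hS
      have := hS h
      push Not at this
      exact Set.mem_iUnion.2 this
    · exact Or.inl h
  refine (measure_mono hsub).trans ((measure_union_le _ _).trans ?_)
  rw [hbox, zero_add]
  refine (measure_iUnion_fintype_le _ _).trans ?_
  have hs : ∀ s : Fin k → ι, (Measure.pi fun _ : Fin m => P)
      {S | η < |empiricalRisk S (atomAverage H s) - risk P (atomAverage H s)|} ≤
      ENNReal.ofReal (2 * Real.exp (-(2 * m * η ^ 2 / (1 + 2 * R) ^ 2))) := fun s =>
    measure_abs_empiricalRisk_sub_risk_le hP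
      ((Finset.measurable_fun_sum _ fun j _ => hH (s j)).const_mul _) hR
      (fun x hx => abs_atomAverage_le hk (fun i => hb i x hx) s) hm hη
  refine (Finset.sum_le_sum fun s _ => hs s).trans ?_
  rw [Finset.sum_const, Finset.card_univ, Fintype.card_fun, Fintype.card_fin, nsmul_eq_mul,
    ← ENNReal.ofReal_natCast, ← ENNReal.ofReal_mul (Nat.cast_nonneg _)]
  refine ENNReal.ofReal_le_ofReal ?_
  push_cast
  exact hδ

/-- If the empirical risk is accurate for all averages of `k` atoms, then it is accurate for all
convex combinations of atoms. -/
theorem abs_empiricalRisk_sub_risk_le {ι : Type*} [Fintype ι] [IsProbabilityMeasure P]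
    (hP : IsNetworkLaw net P) {H : ι → (Fin n → ℝ) → ℝ} (hH : ∀ i, Measurable (H i)) {R η t : ℝ}
    (hb : ∀ i, ∀ x : Fin n → ℝ, (∀ k, |x k| ≤ 1) → |H i x| ≤ R) (hm : 0 < m)
    (ht : 0 < t) {k : ℕ} (hk : 0 < k) (hkR : R ^ 2 ≤ t ^ 2 * k) {S : Fin m → (Fin n → ℝ) × ℝ}
    (hS : ∀ i, (∀ k, |(S i).1 k| ≤ 1) ∧ ((S i).2 = 1 ∨ (S i).2 = -1))
    (hdev : ∀ s : Fin k → ι,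
        |empiricalRisk S (atomAverage H s) - risk P (atomAverage H s)| ≤ η)
    {p : ι → ℝ} (hp : ∀ i, 0 ≤ p i) (hp1 : ∑ i, p i = 1) :
    |empiricalRisk S (fun x => ∑ i, p i * H i x) - risk P (fun x => ∑ i, p i * H i x)| ≤
      η + 4 * t := by
  have hm' : (0 : ℝ) < m := Nat.cast_pos.2 hm
  set u : (Fin n → ℝ) → ℝ := fun x => ∑ i, p i * H i x with hu
  have hum : Measurable u := Finset.measurable_fun_sum _ fun i _ => (hH i).const_mul _
  have hw : ∀ s : Fin k → ι, 0 ≤ ∏ j, p (s j) := fun s => Finset.prod_nonneg fun j _ => hp _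
  have hw1 := sum_prod_weights p hp1 k
  have hub : ∀ x : Fin n → ℝ, (∀ k, |x k| ≤ 1) → |u x| ≤ R := by
    intro x hx
    refine (Finset.abs_sum_le_sum_abs _ _).trans ?_
    calc ∑ i, |p i * H i x| ≤ ∑ i, p i * R := Finset.sum_le_sum fun i _ => by
          rw [abs_mul, abs_of_nonneg (hp i)]
          exact mul_le_mul_of_nonneg_left (hb i x hx) (hp i)
      _ = R := by rw [← Finset.sum_mul, hp1, one_mul]
  have hpt : ∀ (x : Fin n → ℝ) (y : ℝ), (∀ k, |x k| ≤ 1) → (y = 1 ∨ y = -1) →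
      |∑ s : Fin k → ι, (∏ j, p (s j)) * logisticLoss (atomAverage H s x) y -
        logisticLoss (u x) y| ≤ 2 * t := by
    intro x y hx hy
    have e : ∑ s : Fin k → ι, (∏ j, p (s j)) * logisticLoss (atomAverage H s x) y -
        logisticLoss (u x) y = ∑ s : Fin k → ι, (∏ j, p (s j)) *
          (logisticLoss (atomAverage H s x) y - logisticLoss (u x) y) := by
      simp_rw [mul_sub, Finset.sum_sub_distrib, ← Finset.sum_mul, hw1, one_mul]
    rw [e]
    refine (Finset.abs_sum_le_sum_abs _ _).trans ?_
    calc _ ≤ ∑ s : Fin k → ι, 2 * ((∏ j, p (s j)) * |atomAverage H s x - u x|) :=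
          Finset.sum_le_sum fun s _ => by
            rw [abs_mul, abs_of_nonneg (hw s)]
            have := mul_le_mul_of_nonneg_left
              (abs_logisticLoss_sub_le (atomAverage H s x) (u x) hy) (hw s)
            linarith
      _ ≤ 2 * t := by
          rw [← Finset.mul_sum]
          exact mul_le_mul_of_nonneg_left
            (sparsify hp hp1 (fun i => hb i x hx) ht hkR hk) zero_le_two
  have hint : ∀ s : Fin k → ι, Integrable (fun z => logisticLoss (atomAverage H s z.1) z.2) P :=
    fun s => integrable_logisticLoss hP
      ((Finset.measurable_fun_sum _ fun j _ => hH (s j)).const_mul _)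
      (fun x hx => abs_atomAverage_le hk (fun i => hb i x hx) s)
  have hpop : |∑ s : Fin k → ι, (∏ j, p (s j)) * risk P (atomAverage H s) - risk P u| ≤ 2 * t := by
    have e : ∑ s : Fin k → ι, (∏ j, p (s j)) * risk P (atomAverage H s) - risk P u =
        ∫ z, (∑ s : Fin k → ι, (∏ j, p (s j)) * logisticLoss (atomAverage H s z.1) z.2 -
          logisticLoss (u z.1) z.2) ∂P := by
      rw [integral_sub (integrable_finsetSum _ fun s _ => (hint s).const_mul _)
        (integrable_logisticLoss hP hum hub),
        integral_finsetSum _ fun s _ => (hint s).const_mul _]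
      simp only [integral_const_mul]
      rfl
    rw [e]
    have := norm_integral_le_of_norm_le_const (μ := P) (C := 2 * t)
      (f := fun z => ∑ s : Fin k → ι, (∏ j, p (s j)) * logisticLoss (atomAverage H s z.1) z.2 -
          logisticLoss (u z.1) z.2) (by
        filter_upwards [hP.input_bounded, hP.label_sign] with z h1 h2
        exact hpt _ _ h1 h2)
    simpa using this
  have hemp : |∑ s : Fin k → ι, (∏ j, p (s j)) * empiricalRisk S (atomAverage H s) -
      empiricalRisk S u| ≤ 2 * t := by
    have e : ∑ s : Fin k → ι, (∏ j, p (s j)) * empiricalRisk S (atomAverage H s) -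
        empiricalRisk S u = 1 / (m : ℝ) * ∑ i, (∑ s : Fin k → ι, (∏ j, p (s j)) *
          logisticLoss (atomAverage H s (S i).1) (S i).2 - logisticLoss (u (S i).1) (S i).2) := by
      rw [Finset.sum_sub_distrib, mul_sub, Finset.sum_comm, Finset.mul_sum]
      simp only [empiricalRisk]
      congr 1
      refine Finset.sum_congr rfl fun s _ => ?_
      rw [← Finset.mul_sum]; ring
    rw [e, abs_mul, abs_of_pos (by positivity), one_div, inv_mul_le_iff₀ hm']
    refine (Finset.abs_sum_le_sum_abs _ _).trans
      ((Finset.sum_le_sum fun i _ => hpt _ _ (hS i).1 (hS i).2).trans ?_)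
    simp
  have hmid : |∑ s : Fin k → ι, (∏ j, p (s j)) * empiricalRisk S (atomAverage H s) -
      ∑ s : Fin k → ι, (∏ j, p (s j)) * risk P (atomAverage H s)| ≤ η := by
    rw [← Finset.sum_sub_distrib]
    refine (Finset.abs_sum_le_sum_abs _ _).trans ?_
    calc _ ≤ ∑ s : Fin k → ι, (∏ j, p (s j)) * η := Finset.sum_le_sum fun s _ => by
          rw [← mul_sub, abs_mul, abs_of_nonneg (hw s)]
          exact mul_le_mul_of_nonneg_left (hdev s) (hw s)
      _ = η := by rw [← Finset.sum_mul, hw1, one_mul]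
  rw [abs_le] at *
  constructor <;> linarith [hpop.1, hpop.2, hemp.1, hemp.2, hmid.1, hmid.2]

end deviation

/-! ### An enumeration of the monomials -/

/-- The number of occurrences of the letter `i` in the word number `k`. The words over the alphabet
`{0, …, n - 1}` are numbered like the nodes of an `n`-ary heap: `0` is the empty word, and `k + 1`
is the word number `k / n` followed by the letter `k % n`. A word stands for the monomial that is
the product of its letters; a monomial has several words, which does no harm. -/
def heapExp (n : ℕ) : ℕ → ℕ → ℕ
  | 0, _ => 0
  | k + 1, i => heapExp n (k / n) i + if k % n = i then 1 else 0
termination_by k => k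
decreasing_by exact Nat.lt_succ_of_le (Nat.div_le_self k n)

/-- The number of words of length at most `d`. -/
def heapSize (n : ℕ) : ℕ → ℕ
  | 0 => 1
  | d + 1 => heapSize n d * n + 1

/-- The monomial of the word number `k`, evaluated at `x`. -/
def heapFeature {n : ℕ} (k : ℕ) (x : Fin n → ℝ) : ℝ := ∏ i : Fin n, x i ^ heapExp n k i

theorem heapExp_zero (n i : ℕ) : heapExp n 0 i = 0 := by rw [heapExp]

theorem heapExp_child {n q j : ℕ} (hj : j < n) (i : ℕ) :
    heapExp n (q * n + j + 1) i = heapExp n q i + if j = i then 1 else 0 := by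
  have hn : 0 < n := by omega
  rw [heapExp]
  have h1 : (q * n + j) / n = q := by
    rw [mul_comm, Nat.mul_add_div hn, Nat.div_eq_of_lt hj, add_zero]
  have h2 : (q * n + j) % n = j := by
    rw [mul_comm, Nat.mul_add_mod, Nat.mod_eq_of_lt hj]
  rw [h1, h2]

theorem heapSize_pos (n d : ℕ) : 0 < heapSize n d := by
  cases d <;> simp [heapSize]

/-- Every monomial of degree at most `d` comes from a word of length at most `d`. -/
theorem exists_heapExp_eq {n : ℕ} (d : ℕ) (α : Fin n → ℕ) (hα : ∑ i, α i ≤ d) :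
    ∃ k < heapSize n d, ∀ i : Fin n, heapExp n k i = α i := by
  induction d generalizing α with
  | zero =>
    refine ⟨0, heapSize_pos n 0, fun i => ?_⟩
    have := Finset.sum_eq_zero_iff.1 (Nat.le_zero.1 hα) i (Finset.mem_univ i)
    rw [heapExp_zero, this]
  | succ d ih =>
    by_cases h : ∃ j, α j ≠ 0
    · obtain ⟨j, hj⟩ := h
      have hsum : ∑ i, Function.update α j (α j - 1) i ≤ d := by
        rw [Finset.sum_update_of_mem (Finset.mem_univ j)]
        rw [← Finset.add_sum_erase _ _ (Finset.mem_univ j)] at hα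
        rw [Finset.sdiff_singleton_eq_erase]
        omega
      obtain ⟨q, hq, he⟩ := ih _ hsum
      refine ⟨q * n + j + 1, ?_, fun i => ?_⟩
      · have hjn := j.2
        have : (q + 1) * n ≤ heapSize n d * n := Nat.mul_le_mul_right n hq
        rw [add_mul, one_mul] at this
        rw [heapSize]
        omega
      · rw [heapExp_child j.2, he]
        by_cases hij : i = j
        · subst hij; simp; omega
        · rw [Function.update_of_ne hij, if_neg (fun h => hij (Fin.ext h.symm)), add_zero]
    · push Not at h
      exact ⟨0, heapSize_pos n _, fun i => by rw [heapExp_zero, h]⟩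

theorem sum_heapExp_le {n : ℕ} (d : ℕ) {k : ℕ} (hk : k < heapSize n d) :
    ∑ i : Fin n, heapExp n k i ≤ d := by
  induction d generalizing k with
  | zero =>
    have : k = 0 := by simpa [heapSize] using hk
    simp [this, heapExp_zero]
  | succ d ih =>
    cases k with
    | zero => simp [heapExp_zero]
    | succ k =>
      have hk' : k < heapSize n d * n := by rw [heapSize] at hk; omega
      have h1 := ih (Nat.div_lt_of_lt_mul (by rwa [mul_comm] at hk'))
      have h2 : ∑ i : Fin n, heapExp n (k + 1) i =
          ∑ i : Fin n, heapExp n (k / n) i + ∑ i : Fin n, if k % n = i then 1 else 0 := by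
        rw [← Finset.sum_add_distrib]
        exact Finset.sum_congr rfl fun i _ => by rw [heapExp]
      have h3 : ∑ i : Fin n, (if k % n = i then 1 else 0) ≤ 1 := by
        rw [Fin.sum_univ_eq_sum_range (fun i => if k % n = i then 1 else 0), Finset.sum_ite_eq]
        split_ifs <;> omega
      omega

theorem heapSize_le {n : ℕ} (hn : 1 ≤ n) (d : ℕ) : heapSize n d ≤ (d + 1) * n ^ d := by
  induction d with
  | zero => simp [heapSize]
  | succ d ih =>
    rw [heapSize]
    have h1 : 1 ≤ n ^ (d + 1) := Nat.one_le_pow _ _ hn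
    calc heapSize n d * n + 1 ≤ (d + 1) * n ^ d * n + n ^ (d + 1) :=
          Nat.add_le_add (Nat.mul_le_mul_right n ih) h1
      _ = (d + 1 + 1) * n ^ (d + 1) := by ring

theorem abs_heapFeature_le_one {n : ℕ} (k : ℕ) {x : Fin n → ℝ} (hx : ∀ i, |x i| ≤ 1) :
    |heapFeature k x| ≤ 1 := abs_prod_pow_le_one hx _

/-- A feasible polynomial is a combination of the features of the words of length at most `D`. -/
theorem Feasible.exists_heap_coeffs {n D : ℕ} {R : ℝ} {p : MvPolynomial (Fin n) ℝ}
    (hp : Feasible D R p) : ∃ c : ℕ → ℝ, ∑ k ∈ Finset.range (heapSize n D), |c k| ≤ R ∧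
      ∀ x, MvPolynomial.eval x p = ∑ k ∈ Finset.range (heapSize n D), c k * heapFeature k x := by
  have h : ∀ α ∈ p.support, ∃ k < heapSize n D, ∀ i : Fin n, heapExp n k i = α i := by
    intro α hα
    refine exists_heapExp_eq D α ?_
    have := (MvPolynomial.le_totalDegree hα).trans hp.1
    rwa [Finsupp.sum_fintype _ _ (fun _ => rfl)] at this
  choose! κ hκ1 hκ2 using h
  refine ⟨fun k => ∑ α ∈ p.support, if κ α = k then p.coeff α else 0, ?_, fun x => ?_⟩
  · calc _ ≤ ∑ k ∈ Finset.range (heapSize n D), ∑ α ∈ p.support,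
          if κ α = k then |p.coeff α| else 0 := Finset.sum_le_sum fun k _ =>
          (Finset.abs_sum_le_sum_abs _ _).trans (Finset.sum_le_sum fun α _ => by split_ifs <;> simp)
      _ = ∑ α ∈ p.support, |p.coeff α| := by
          rw [Finset.sum_comm]
          refine Finset.sum_congr rfl fun α hα => ?_
          rw [Finset.sum_ite_eq, if_pos (Finset.mem_range.2 (hκ1 α hα))]
      _ ≤ R := hp.2
  · simp_rw [Finset.sum_mul]
    rw [Finset.sum_comm, MvPolynomial.eval_eq']
    refine Finset.sum_congr rfl fun α hα => ?_
    simp_rw [ite_mul, zero_mul]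
    rw [Finset.sum_ite_eq, if_pos (Finset.mem_range.2 (hκ1 α hα)), heapFeature]
    simp_rw [hκ2 α hα]

/-- The vertices `± R e_k` of the `ℓ₁` ball, as predictors. -/
def signedFeature {n : ℕ} (R : ℝ) (M : ℕ) (i : Fin M × Bool) (x : Fin n → ℝ) : ℝ :=
  (if i.2 then R else -R) * heapFeature i.1 x

/-- The `ℓ₁` ball is the convex hull of its vertices; the mass that the coefficients leave over is
spread evenly over all vertices. -/
theorem exists_convex_weights {n M : ℕ} (hM : 0 < M) {R : ℝ} (hR : 0 < R) {c : ℕ → ℝ}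
    (hc : ∑ k ∈ Finset.range M, |c k| ≤ R) :
    ∃ p : Fin M × Bool → ℝ, (∀ i, 0 ≤ p i) ∧ ∑ i, p i = 1 ∧ ∀ x : Fin n → ℝ,
      ∑ i, p i * signedFeature R M i x = ∑ k ∈ Finset.range M, c k * heapFeature k x := by
  have hM' : (0 : ℝ) < M := Nat.cast_pos.2 hM
  set r : ℝ := (1 - (∑ k ∈ Finset.range M, |c k|) / R) / (2 * M) with hr
  have hr0 : 0 ≤ r := by
    refine div_nonneg ?_ (by positivity)
    rw [sub_nonneg, div_le_one hR]; exact hc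
  refine ⟨fun i => max (if i.2 then c i.1 else -c i.1) 0 / R + r, fun i => by positivity, ?_,
    fun x => ?_⟩
  · rw [Fintype.sum_prod_type]
    simp only [Fintype.sum_bool, if_true, Bool.false_eq_true, if_false]
    have e : ∀ k : Fin M, max (c k) 0 / R + r + (max (-c k) 0 / R + r) = |c k| / R + 2 * r := by
      intro k
      have : max (c k) 0 + max (-c k) 0 = |c k| := by
        rcases le_total 0 (c k) with h | h
        · rw [max_eq_left h, max_eq_right (by linarith), abs_of_nonneg h, add_zero]
        · rw [max_eq_right h, max_eq_left (by linarith), abs_of_nonpos h, zero_add]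
      rw [← this]; ring
    simp_rw [e]
    rw [Finset.sum_add_distrib, Fin.sum_univ_eq_sum_range (fun k => |c k| / R), ← Finset.sum_div,
      Finset.sum_const, Finset.card_univ, Fintype.card_fin, nsmul_eq_mul, hr]
    field_simp
    ring
  · rw [Fintype.sum_prod_type]
    simp only [Fintype.sum_bool, if_true, Bool.false_eq_true, if_false, signedFeature]
    rw [← Fin.sum_univ_eq_sum_range (fun k => c k * heapFeature k x)]
    refine Finset.sum_congr rfl fun k _ => ?_
    have : max (c k) 0 - max (-c k) 0 = c k := by
      rcases le_total 0 (c k) with h | h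
      · rw [max_eq_left h, max_eq_right (by linarith), sub_zero]
      · rw [max_eq_right h, max_eq_left (by linarith)]; ring
    calc _ = (max (c k) 0 - max (-c k) 0) * heapFeature k x := by field_simp; ring
      _ = _ := by rw [this]

/-! ### The excess risk of approximate minimizers -/

/-- The sample size makes the union bound over averages of atoms effective. -/
theorem union_bound_le {n D k m : ℕ} {X δ Λ : ℝ} (hn : 1 ≤ n) (hδ : 0 < δ) (hδ1 : δ < 1)
    (hX : 2 ≤ X) (hDX : 2 ^ D ≤ X) (hΛ : Λ = Real.log (2 * n / δ)) (hk : (k : ℝ) ≤ 2 * X ^ 32)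
    (hm : X ^ 80 * Λ ≤ m) :
    ((Fintype.card (Fin (heapSize n D) × Bool) : ℕ) : ℝ) ^ k *
      (2 * Real.exp (-(2 * m * (1 / X ^ 6) ^ 2 / (1 + 2 * X ^ 10) ^ 2))) ≤ δ := by
  have hn' : (1 : ℝ) ≤ n := Nat.one_le_cast.2 hn
  have hX0 : 0 < X := by linarith
  have hX1 : 1 ≤ X := by linarith
  have hlog : Real.log (2 * n) ≤ Λ := by
    rw [hΛ]
    refine Real.log_le_log (by positivity) ?_
    rw [le_div_iff₀ hδ]
    nlinarith
  have hlog0 : 0 ≤ Real.log (2 * n) := Real.log_nonneg (by linarith)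
  have hcard : ((Fintype.card (Fin (heapSize n D) × Bool) : ℕ) : ℝ) ≤ Real.exp (X * Λ) := by
    have h1 : Fintype.card (Fin (heapSize n D) × Bool) ≤ (2 * n) ^ (D + 1) := by
      rw [Fintype.card_prod, Fintype.card_fin, Fintype.card_bool]
      have h2 : D + 1 ≤ 2 ^ D := Nat.lt_two_pow_self
      calc heapSize n D * 2 ≤ (D + 1) * n ^ D * 2 := Nat.mul_le_mul_right 2 (heapSize_le hn D)
        _ ≤ 2 ^ D * n ^ D * (2 * n) := by gcongr; omega
        _ = (2 * n) ^ (D + 1) := by rw [← mul_pow, pow_succ]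
    have h3 : ((D : ℝ) + 1) ≤ X := by
      have h2 : D + 1 ≤ 2 ^ D := Nat.lt_two_pow_self
      have : ((D + 1 : ℕ) : ℝ) ≤ ((2 ^ D : ℕ) : ℝ) := Nat.cast_le.2 h2
      push_cast at this
      linarith
    calc ((Fintype.card (Fin (heapSize n D) × Bool) : ℕ) : ℝ) ≤ (2 * n : ℝ) ^ (D + 1) := by
          exact_mod_cast h1
      _ = Real.exp ((D + 1 : ℕ) * Real.log (2 * n)) := by
          rw [Real.exp_nat_mul, Real.exp_log (by positivity)]
      _ ≤ Real.exp (X * Λ) := by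
          refine Real.exp_le_exp.2 ?_
          push_cast
          gcongr
  have hΛ0 : 0 ≤ Λ := hlog0.trans hlog
  have h2δ : 2 ≤ δ * Real.exp Λ := by
    rw [hΛ, Real.exp_log (by positivity)]
    field_simp
    linarith
  have h1 : ((Fintype.card (Fin (heapSize n D) × Bool) : ℕ) : ℝ) ^ k ≤
      Real.exp (2 * X ^ 33 * Λ) := by
    calc _ ≤ Real.exp (X * Λ) ^ k := by gcongr
      _ = Real.exp (k * (X * Λ)) := by rw [Real.exp_nat_mul]
      _ ≤ Real.exp (2 * X ^ 32 * (X * Λ)) := by gcongr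
      _ = _ := by ring_nf
  have hR : (1 + 2 * X ^ 10) ^ 2 ≤ X ^ 24 := by
    have h4 : 1 ≤ X ^ 10 := one_le_pow₀ hX1
    have h5 : (2 : ℝ) ^ 2 ≤ X ^ 2 := pow_le_pow_left₀ (by norm_num) hX 2
    have h6 : 1 + 2 * X ^ 10 ≤ X ^ 12 := by
      calc 1 + 2 * X ^ 10 ≤ 2 ^ 2 * X ^ 10 := by linarith
        _ ≤ X ^ 2 * X ^ 10 := by gcongr
        _ = X ^ 12 := by ring
    calc (1 + 2 * X ^ 10) ^ 2 ≤ (X ^ 12) ^ 2 := by gcongr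
      _ = X ^ 24 := by ring
  have hexp : 2 * X ^ 33 * Λ + Λ ≤ 2 * m * (1 / X ^ 6) ^ 2 / (1 + 2 * X ^ 10) ^ 2 := by
    rw [le_div_iff₀ (by positivity)]
    have h7 : (2 * X ^ 33 * Λ + Λ) * (1 + 2 * X ^ 10) ^ 2 ≤ X ^ 44 * Λ * X ^ 24 := by
      have : 2 * X ^ 33 * Λ + Λ ≤ X ^ 44 * Λ := by
        have h8 : 1 ≤ X ^ 33 := one_le_pow₀ hX1
        have h9 : (2 : ℝ) ^ 11 ≤ X ^ 11 := pow_le_pow_left₀ (by norm_num) hX 11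
        calc 2 * X ^ 33 * Λ + Λ = (2 * X ^ 33 + 1) * Λ := by ring
          _ ≤ (X ^ 11 * X ^ 33) * Λ := by gcongr; nlinarith
          _ = X ^ 44 * Λ := by ring
      gcongr
    have h10 : X ^ 44 * Λ * X ^ 24 = X ^ 80 * Λ * (1 / X ^ 6) ^ 2 := by field_simp
    have h11 : X ^ 80 * Λ * (1 / X ^ 6) ^ 2 ≤ 2 * m * (1 / X ^ 6) ^ 2 := by
      have : (0 : ℝ) ≤ m := Nat.cast_nonneg m
      exact mul_le_mul_of_nonneg_right (by linarith) (by positivity)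
    linarith
  calc _ ≤ Real.exp (2 * X ^ 33 * Λ) * (δ * Real.exp Λ * Real.exp (-(2 * X ^ 33 * Λ + Λ))) := by
        gcongr
    _ = δ := by
        rw [neg_add, Real.exp_add, Real.exp_neg, Real.exp_neg]
        field_simp

/-- With high probability over the sample, all approximate solutions of the regression problem have
small excess risk. -/
theorem measure_excess_risk_le {n N : ℕ} {net : Network n N} {P : Measure ((Fin n → ℝ) × ℝ)}
    {lam ε δ : ℝ} {D m : ℕ} [IsProbabilityMeasure P] (hn : 1 ≤ n) (hP : IsNetworkLaw net P)
    (hβ : ∀ j, net.β j ∈ Set.Icc (0 : ℝ) 1) (hlam : 2 ≤ lam) (hW : ∀ j, ∑ k, |net.W j k| ≤ lam)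
    (hε : 0 < ε) (hδ : 0 < δ) (hδ1 : δ < 1) (hD1 : 1 ≤ D)
    (hD : 100 * lam * Real.log (max 1 net.topNorm * lam / ε) ≤ D)
    (hεX : 2 / lam ^ D ≤ ε)
    (hm : (lam ^ D) ^ 80 * Real.log (2 * n / δ) ≤ m) :
    (Measure.pi fun _ : Fin m => P)
      {S | ¬ ∀ p : MvPolynomial (Fin n) ℝ, IsL1Regression D ((lam ^ D) ^ 10) (ε / 4) S p →
        risk P (fun x => MvPolynomial.eval x p) - risk P net.preactivation ≤ ε} ≤
      ENNReal.ofReal δ := by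
  obtain ⟨u, hu, hur⟩ := exists_comparator hP hβ hlam hW hε hD1 hD
  set X := lam ^ D with hXdef
  have hDX : (2 : ℝ) ^ D ≤ X := pow_le_pow_left₀ (by norm_num) hlam D
  have hX : (2 : ℝ) ≤ X := le_trans (by
    calc (2 : ℝ) = 2 ^ 1 := by norm_num
      _ ≤ 2 ^ D := pow_le_pow_right₀ (by norm_num) hD1) hDX
  have hX0 : 0 < X := by linarith
  have hn' : (1 : ℝ) ≤ n := Nat.one_le_cast.2 hn
  have hΛ : 0 < Real.log (2 * n / δ) := Real.log_pos (by rw [lt_div_iff₀ hδ]; linarith)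
  have hm0 : 0 < m := by
    have : (0 : ℝ) < m := lt_of_lt_of_le (by positivity) hm
    exact_mod_cast this
  set k := ⌈X ^ 32⌉₊ with hk
  have hk1 : X ^ 32 ≤ k := Nat.le_ceil _
  have hk2 : (k : ℝ) ≤ 2 * X ^ 32 := by
    have := Nat.ceil_lt_add_one (show 0 ≤ X ^ 32 by positivity)
    have : 1 ≤ X ^ 32 := one_le_pow₀ (by linarith)
    linarith
  have hk0 : 0 < k := Nat.ceil_pos.2 (by positivity)
  have hR : (0 : ℝ) < X ^ 10 := by positivity
  have hH : ∀ i, Measurable (signedFeature (n := n) (X ^ 10) (heapSize n D) i) := by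
    intro i
    unfold signedFeature heapFeature
    fun_prop
  have hb : ∀ i, ∀ x : Fin n → ℝ, (∀ k, |x k| ≤ 1) →
      |signedFeature (X ^ 10) (heapSize n D) i x| ≤ X ^ 10 := by
    intro i x hx
    rw [signedFeature, abs_mul]
    have : |if i.2 then X ^ 10 else -X ^ 10| = X ^ 10 := by
      split_ifs
      · exact abs_of_pos hR
      · rw [abs_neg]; exact abs_of_pos hR
    rw [this]
    exact mul_le_of_le_one_right hR.le (abs_heapFeature_le_one _ hx)
  have hmain := measure_exists_deviation_le hP hH hR.le hb hm0 (η := 1 / X ^ 6) (by positivity) hk0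
    (union_bound_le (m := m) hn hδ hδ1 hX hDX rfl hk2 hm)
  refine (measure_mono ?_).trans hmain
  intro S hS
  by_contra hgood
  rw [Set.mem_ofPred_eq, not_not] at hgood
  rw [Set.mem_ofPred_eq] at hS
  refine hS ?_
  obtain ⟨hS1, hS2⟩ := hgood
  have hdev : ∀ q : MvPolynomial (Fin n) ℝ, Feasible D (X ^ 10) q →
      |empiricalRisk S (fun x => MvPolynomial.eval x q) -
        risk P (fun x => MvPolynomial.eval x q)| ≤ ε / 8 := by
    intro q hq
    obtain ⟨c, hc1, hc2⟩ := hq.exists_heap_coeffs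
    obtain ⟨p, hp0, hp1, hp2⟩ := exists_convex_weights (n := n) (heapSize_pos n D) hR hc1
    have h := abs_empiricalRisk_sub_risk_le hP hH hb hm0 (t := 1 / X ^ 6) (by positivity) hk0
      (by
        calc (X ^ 10) ^ 2 = (1 / X ^ 6) ^ 2 * X ^ 32 := by field_simp
          _ ≤ (1 / X ^ 6) ^ 2 * k := by gcongr) hS1 hS2 hp0 hp1
    have e : (fun x => MvPolynomial.eval x q) =
        fun x => ∑ i, p i * signedFeature (X ^ 10) (heapSize n D) i x := by
      funext x; rw [hc2, hp2]
    rw [e]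
    refine h.trans ?_
    have h5 : (2 : ℝ) ^ 5 ≤ X ^ 5 := pow_le_pow_left₀ (by norm_num) hX 5
    have h6 : 1 / X ^ 6 + 4 * (1 / X ^ 6) ≤ 2 / X / 8 := by
      rw [div_div, show 1 / X ^ 6 + 4 * (1 / X ^ 6) = 5 / X ^ 6 by ring,
        div_le_div_iff₀ (by positivity) (by positivity)]
      calc 5 * (X * 8) ≤ 2 * (2 ^ 5 * X) := by linarith
        _ ≤ 2 * (X ^ 5 * X) := by gcongr
        _ = 2 * X ^ 6 := by ring
    linarith
  intro p hp
  have h1 := abs_le.1 (hdev p hp.1)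
  have h2 := abs_le.1 (hdev u hu)
  have h3 := hp.2 u hu
  linarith [h1.1, h2.2]

/-! ### A conditional gradient method without exponentials -/

/-- A rational approximation of `tanh v`, which equals `tanh (m * artanh (v / m))`. -/
def rationalTanh (m v : ℝ) (k : ℕ) : ℝ :=
  (((1 + v / m) / (1 - v / m)) ^ k - 1) / (((1 + v / m) / (1 - v / m)) ^ k + 1)

theorem abs_log_one_add_sub_le {x : ℝ} (hx : |x| ≤ 1 / 2) : |Real.log (1 + x) - x| ≤ 2 * x ^ 2 := by
  have h := Real.abs_log_sub_add_sum_range_le (x := -x) (by rw [abs_neg]; linarith) 1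
  simp only [Finset.range_one, Finset.sum_singleton, zero_add, pow_one, Nat.cast_zero, div_one,
    abs_neg, sub_neg_eq_add] at h
  rw [neg_add_eq_sub] at h
  refine h.trans ?_
  rw [div_le_iff₀ (by linarith), show (1 + 1 : ℕ) = 2 from rfl, sq_abs]
  nlinarith [sq_nonneg x]

/-- The machine has no exponentials; `tanh` is replaced by a rational function that it can evaluate
by repeated multiplication. -/
theorem abs_rationalTanh_sub_le {m : ℕ} {v R : ℝ} (hm : 0 < m) (hR : 2 * R ≤ m) (hv : |v| ≤ R) :
    |rationalTanh m v m - Real.tanh v| ≤ 2 * R ^ 2 / m := by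
  have hm' : (0 : ℝ) < m := Nat.cast_pos.2 hm
  set x := v / m with hx
  have hvx : v = m * x := by rw [hx]; field_simp
  have hx2 : |x| ≤ 1 / 2 := by
    rw [hx, abs_div, abs_of_pos hm', div_le_iff₀ hm']; linarith
  have hx3 := abs_le.1 hx2
  have hp : 0 < 1 + x := by linarith
  have hq : 0 < 1 - x := by linarith
  set t := m * (1 / 2 * (Real.log (1 + x) - Real.log (1 - x))) with ht
  have hE : ((1 + x) / (1 - x)) ^ m = Real.exp (2 * t) := by
    rw [show 2 * t = m * (Real.log (1 + x) - Real.log (1 - x)) by rw [ht]; ring,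
      Real.exp_nat_mul, Real.exp_sub, Real.exp_log hp, Real.exp_log hq]
  have hT : rationalTanh m v m = Real.tanh t := by
    rw [rationalTanh, ← hx, hE, Real.tanh_eq]
    have : Real.exp (2 * t) = Real.exp t * Real.exp t := by rw [← Real.exp_add]; ring_nf
    rw [this, Real.exp_neg]
    have := Real.exp_pos t
    field_simp
  rw [hT]
  refine (abs_tanh_sub_tanh_le _ _).trans ?_
  have h1 := abs_le.1 (abs_log_one_add_sub_le hx2)
  have h2 := abs_le.1 (abs_log_one_add_sub_le (x := -x) (by rwa [abs_neg]))
  rw [← sub_eq_add_neg, neg_sq] at h2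
  have h3 : |1 / 2 * (Real.log (1 + x) - Real.log (1 - x)) - x| ≤ 2 * x ^ 2 := by
    rw [abs_le]; constructor <;> linarith [h1.1, h1.2, h2.1, h2.2]
  have h4 : t - v = m * (1 / 2 * (Real.log (1 + x) - Real.log (1 - x)) - x) := by
    rw [ht, hvx]; ring
  rw [h4, abs_mul, abs_of_pos hm']
  have h5 : v ^ 2 ≤ R ^ 2 := sq_le_sq' (abs_le.1 hv).1 (abs_le.1 hv).2
  calc _ ≤ m * (2 * x ^ 2) := mul_le_mul_of_nonneg_left h3 hm'.le
    _ = 2 * v ^ 2 / m := by rw [hvx]; field_simp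
    _ ≤ _ := by gcongr

section conditionalGradient

variable {m : ℕ}

/-- The values on the sample of the combination of features with coefficients `c`. -/
def prediction (M : ℕ) (φ : ℕ → Fin m → ℝ) (c : ℕ → ℝ) (i : Fin m) : ℝ :=
  ∑ k ∈ Finset.range M, c k * φ k i

/-- The approximate derivative of the empirical loss at `c / t` in the direction of feature `k`, up
to the factor `1 / m`. -/
def approxGradient (M : ℕ) (φ : ℕ → Fin m → ℝ) (y : Fin m → ℝ) (c : ℕ → ℝ) (t : ℕ) (k : ℕ) : ℝ :=
  ∑ i, (rationalTanh m (prediction M φ c i / t) m - y i) * φ k i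

/-- One step of the method: `c' / (t + 1)` moves from `c / t` towards a vertex of the `ℓ₁` ball of
radius `R` that minimizes the approximate gradient. The method starts from `c = 0` at `t = 0`, where
`c / t` is read as `0`. -/
def GradientStep (M : ℕ) (φ : ℕ → Fin m → ℝ) (y : Fin m → ℝ) (R : ℝ) (t : ℕ) (c c' : ℕ → ℝ) :
    Prop :=
  ∃ j < M, ∃ r : ℝ, |r| ≤ R ∧ c' = Function.update c j (c j + r) ∧
    ∀ k < M, r * approxGradient M φ y c t j ≤ -(R * |approxGradient M φ y c t k|)

/-- The average logistic loss of a vector of predictions. -/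
def sampleLoss (y u : Fin m → ℝ) : ℝ := 1 / (m : ℝ) * ∑ i, (logTwoCosh (u i) - u i * y i)

theorem prediction_update {M : ℕ} (φ : ℕ → Fin m → ℝ) (c : ℕ → ℝ) {j : ℕ} (hj : j < M) (r : ℝ)
    (i : Fin m) : prediction M φ (Function.update c j (c j + r)) i =
      prediction M φ c i + r * φ j i := by
  have hj' : j ∈ Finset.range M := Finset.mem_range.2 hj
  unfold prediction
  rw [← Finset.add_sum_erase _ _ hj', ← Finset.add_sum_erase _ (fun k => c k * φ k i) hj',
    Function.update_self]
  have : ∑ k ∈ (Finset.range M).erase j, Function.update c j (c j + r) k * φ k i =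
      ∑ k ∈ (Finset.range M).erase j, c k * φ k i :=
    Finset.sum_congr rfl fun k hk => by rw [Function.update_of_ne (Finset.ne_of_mem_erase hk)]
  rw [this]; ring

theorem sum_abs_update_le {M : ℕ} (c : ℕ → ℝ) {j : ℕ} (hj : j < M) (r : ℝ) :
    ∑ k ∈ Finset.range M, |Function.update c j (c j + r) k| ≤
      ∑ k ∈ Finset.range M, |c k| + |r| := by
  have hj' : j ∈ Finset.range M := Finset.mem_range.2 hj
  rw [← Finset.add_sum_erase _ _ hj', ← Finset.add_sum_erase _ (fun k => |c k|) hj',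
    Function.update_self]
  have : ∑ k ∈ (Finset.range M).erase j, |Function.update c j (c j + r) k| =
      ∑ k ∈ (Finset.range M).erase j, |c k| :=
    Finset.sum_congr rfl fun k hk => by rw [Function.update_of_ne (Finset.ne_of_mem_erase hk)]
  rw [this]
  linarith [abs_add_le (c j) r]

theorem abs_prediction_le {M : ℕ} {φ : ℕ → Fin m → ℝ} (hφ : ∀ k i, |φ k i| ≤ 1) {c : ℕ → ℝ} {B : ℝ}
    (hc : ∑ k ∈ Finset.range M, |c k| ≤ B) (i : Fin m) : |prediction M φ c i| ≤ B := by
  refine (Finset.abs_sum_le_sum_abs _ _).trans ((Finset.sum_le_sum fun k _ => ?_).trans hc)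
  rw [abs_mul]
  exact mul_le_of_le_one_right (abs_nonneg _) (hφ k i)

/-- A vertex that minimizes a linear functional on the vertices of the `ℓ₁` ball minimizes it on the
ball. -/
theorem vertex_le_of_sum_abs_le {M : ℕ} {G q : ℕ → ℝ} {R W : ℝ} (hR : 0 < R) (hM : 0 < M)
    (hW : ∀ k < M, W ≤ -(R * |G k|)) (hq : ∑ k ∈ Finset.range M, |q k| ≤ R) :
    W ≤ ∑ k ∈ Finset.range M, q k * G k := by
  have hW0 : W ≤ 0 := (hW 0 hM).trans (by simp; positivity)
  have h1 : -∑ k ∈ Finset.range M, |q k| * |G k| ≤ ∑ k ∈ Finset.range M, q k * G k := by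
    have := (abs_le.1 (Finset.abs_sum_le_sum_abs (fun k => q k * G k) (Finset.range M))).1
    simpa only [abs_mul] using this
  have h2 : R * ∑ k ∈ Finset.range M, |q k| * |G k| ≤ R * -W := by
    calc R * ∑ k ∈ Finset.range M, |q k| * |G k| = ∑ k ∈ Finset.range M, |q k| * (R * |G k|) := by
          rw [Finset.mul_sum]; exact Finset.sum_congr rfl fun k _ => by ring
      _ ≤ ∑ k ∈ Finset.range M, |q k| * -W := Finset.sum_le_sum fun k hk =>
          mul_le_mul_of_nonneg_left (by linarith [hW k (Finset.mem_range.1 hk)]) (abs_nonneg _)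
      _ ≤ R * -W := by
          rw [← Finset.sum_mul]; exact mul_le_mul_of_nonneg_right hq (by linarith)
  have h3 := le_of_mul_le_mul_left h2 hR
  linarith

/-- The decrease of the loss in one step towards `z`, when `z` is at least as good as `q` for the
linear functional given by the approximate gradient `g`. -/
theorem sampleLoss_step_le {y u z q g : Fin m → ℝ} {R κ γ : ℝ} (hm : 0 < m) (hγ : 0 ≤ γ)
    (hκ : ∀ i, |g i - (Real.tanh (u i) - y i)| ≤ κ) (hu : ∀ i, |u i| ≤ R) (hz : ∀ i, |z i| ≤ R)
    (hq : ∀ i, |q i| ≤ R) (hopt : ∑ i, g i * z i ≤ ∑ i, g i * q i) :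
    sampleLoss y (fun i => u i + γ * (z i - u i)) ≤ sampleLoss y u +
      γ * (sampleLoss y q - sampleLoss y u + 2 * R * κ) + 2 * R ^ 2 * γ ^ 2 := by
  have hm' : (0 : ℝ) < m := Nat.cast_pos.2 hm
  have hpt : ∀ i, logTwoCosh (u i + γ * (z i - u i)) - (u i + γ * (z i - u i)) * y i ≤
      (logTwoCosh (u i) - u i * y i) + γ * ((logTwoCosh (q i) - q i * y i) -
        (logTwoCosh (u i) - u i * y i) + 2 * R * κ) + 2 * R ^ 2 * γ ^ 2 +
        γ * (g i * z i - g i * q i) := by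
    intro i
    have h1 := logTwoCosh_le_quadratic (u i) (u i + γ * (z i - u i))
    have h2 := logTwoCosh_tangent_le (u i) (q i)
    have h3 : |z i - u i| ≤ 2 * R := by
      refine (abs_sub _ _).trans ?_; linarith [hz i, hu i]
    have h4 : (z i - u i) ^ 2 ≤ (2 * R) ^ 2 := sq_le_sq' (abs_le.1 h3).1 (abs_le.1 h3).2
    have h5 : |z i - q i| ≤ 2 * R := by
      refine (abs_sub _ _).trans ?_; linarith [hz i, hq i]
    have h6 : (Real.tanh (u i) - y i - g i) * (z i - q i) ≤ 2 * R * κ := by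
      refine (le_abs_self _).trans ?_
      rw [abs_mul, abs_sub_comm, mul_comm]
      exact mul_le_mul h5 (hκ i) (abs_nonneg _) ((abs_nonneg _).trans h5)
    have h7 : (u i + γ * (z i - u i) - u i) ^ 2 / 2 ≤ 2 * R ^ 2 * γ ^ 2 := by
      have : (u i + γ * (z i - u i) - u i) ^ 2 / 2 = γ ^ 2 * (z i - u i) ^ 2 / 2 := by ring
      rw [this]
      nlinarith [mul_le_mul_of_nonneg_left h4 (sq_nonneg γ)]
    have h8 : γ * ((Real.tanh (u i) - y i) * (z i - u i)) ≤ γ * ((logTwoCosh (q i) - q i * y i) -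
        (logTwoCosh (u i) - u i * y i) + 2 * R * κ + (g i * z i - g i * q i)) := by
      refine mul_le_mul_of_nonneg_left ?_ hγ
      linarith
    linarith
  have hsum := Finset.sum_le_sum fun i (_ : i ∈ Finset.univ) => hpt i
  simp only [Finset.sum_add_distrib, Finset.sum_sub_distrib, ← Finset.mul_sum, Finset.sum_const,
    Finset.card_univ, Fintype.card_fin, nsmul_eq_mul] at hsum
  have h9 : γ * (∑ i, g i * z i - ∑ i, g i * q i) ≤ 0 :=
    mul_nonpos_of_nonneg_of_nonpos hγ (by linarith)
  have h10 := mul_le_mul_of_nonneg_left (hsum.trans (add_le_add_right h9 _))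
    (show 0 ≤ 1 / (m : ℝ) by positivity)
  simp only [sampleLoss, Finset.sum_sub_distrib]
  refine h10.trans (le_of_eq ?_)
  field_simp
  ring

theorem sum_inv_le_two_sqrt (t : ℕ) : ∑ s ∈ Finset.range t, 1 / ((s : ℝ) + 1) ≤ 2 * √t := by
  induction t with
  | zero => simp
  | succ t ih =>
    rw [Finset.sum_range_succ]
    have h0 : (0 : ℝ) ≤ t := Nat.cast_nonneg t
    have h1 : √(t : ℝ) ^ 2 = t := Real.sq_sqrt h0
    have h2 : √((t : ℝ) + 1) ^ 2 = t + 1 := Real.sq_sqrt (by positivity)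
    have h3 : 1 ≤ √((t : ℝ) + 1) := by
      rw [Real.one_le_sqrt]; linarith
    have h4 := Real.sqrt_nonneg (t : ℝ)
    set a := √(t : ℝ)
    set b := √((t : ℝ) + 1) with hb
    have h5 : a ≤ b := Real.sqrt_le_sqrt (by linarith)
    have h6 : 1 / ((t : ℝ) + 1) ≤ 2 * b - 2 * a := by
      rw [← h2, div_le_iff₀ (by positivity)]
      have h7 : (b - a) * (b + a) = 1 := by ring_nf; rw [h1, h2]; ring
      have h8 : (b - a) * (b + a) ≤ (b - a) * (2 * b) :=
        mul_le_mul_of_nonneg_left (by linarith) (by linarith)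
      nlinarith [mul_le_mul_of_nonneg_left h3 (show 0 ≤ (b - a) * (2 * b) by nlinarith)]
    push_cast
    linarith

/-- Convergence of the conditional gradient method with step `1 / (t + 1)`. The coefficients `c t`
are sums of `t` vertices and the iterates are the averages `c t / t`, so that a step changes a
single coefficient. -/
theorem sampleLoss_gradient_method_le {M : ℕ} {φ : ℕ → Fin m → ℝ} {y : Fin m → ℝ} {R : ℝ}
    {c : ℕ → ℕ → ℝ} {T : ℕ} (hm : 0 < m) (hR : 0 < R) (hmR : 2 * R ≤ m) (hM : 0 < M)
    (hφ : ∀ k i, |φ k i| ≤ 1) (h0 : c 0 = 0) (hT : 0 < T)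
    (hstep : ∀ t < T, GradientStep M φ y R t (c t) (c (t + 1))) :
    ∑ k ∈ Finset.range M, |c T k| ≤ T * R ∧
    ∀ q : ℕ → ℝ, ∑ k ∈ Finset.range M, |q k| ≤ R →
      sampleLoss y (fun i => prediction M φ (c T) i / T) ≤
        sampleLoss y (prediction M φ q) + (4 * R ^ 3 / m + 4 * R ^ 2 / √T) := by
  have hnorm : ∀ t ≤ T, ∑ k ∈ Finset.range M, |c t k| ≤ t * R := by
    intro t
    induction t with
    | zero => simp [h0]
    | succ t ih =>
      intro ht
      obtain ⟨j, hj, r, hr, hc, -⟩ := hstep t (by omega)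
      rw [hc]
      refine (sum_abs_update_le _ hj r).trans ?_
      have := ih (by omega)
      push_cast
      linarith
  refine ⟨hnorm T le_rfl, fun q hq => ?_⟩
  set κ : ℝ := 2 * R ^ 2 / m with hκ
  set F : ℕ → ℝ := fun t => sampleLoss y (fun i => prediction M φ (c t) i / t) with hF
  set Q := sampleLoss y (prediction M φ q) with hQ
  -- With the step `1 / (t + 1)`, the one-step inequality for `t * (F t - Q)` telescopes.
  have hmain : ∀ t ≤ T, t * (F t - Q) ≤
      2 * R * κ * t + 2 * R ^ 2 * ∑ s ∈ Finset.range t, 1 / ((s : ℝ) + 1) := by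
    intro t
    induction t with
    | zero => simp
    | succ t ih =>
      intro ht
      obtain ⟨j, hj, r, hr, hc, hopt⟩ := hstep t (by omega)
      have ht1 : (0 : ℝ) < t + 1 := by positivity
      have hu : ∀ i, |prediction M φ (c t) i / t| ≤ R := by
        intro i
        have := abs_prediction_le hφ (hnorm t (by omega)) i
        rcases Nat.eq_zero_or_pos t with rfl | htp
        · simpa using hR.le
        · have htp' : (0 : ℝ) < t := Nat.cast_pos.2 htp
          rw [abs_div, abs_of_pos htp', div_le_iff₀ htp']
          linarith
      have h1 := sampleLoss_step_le (y := y) (γ := 1 / ((t : ℝ) + 1)) (κ := κ) (R := R)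
        (u := fun i => prediction M φ (c t) i / t) (z := fun i => r * φ j i)
        (q := prediction M φ q)
        (g := fun i => rationalTanh m (prediction M φ (c t) i / t) m - y i)
        hm (by positivity) (fun i => by
          have := abs_rationalTanh_sub_le hm hmR (hu i)
          rwa [show ∀ a b d : ℝ, a - d - (b - d) = a - b from fun a b d => by ring]) hu
        (fun i => by
          rw [abs_mul]; exact (mul_le_of_le_one_right (abs_nonneg _) (hφ j i)).trans hr)
        (abs_prediction_le hφ hq) (by
          have h2 := vertex_le_of_sum_abs_le hR hM hopt hq
          have h3 : ∑ i, (rationalTanh m (prediction M φ (c t) i / t) m - y i) * (r * φ j i) =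
              r * approxGradient M φ y (c t) t j := by
            rw [approxGradient, Finset.mul_sum]
            exact Finset.sum_congr rfl fun i _ => by ring
          have h4 : ∑ i, (rationalTanh m (prediction M φ (c t) i / t) m - y i) *
              prediction M φ q i = ∑ k ∈ Finset.range M, q k * approxGradient M φ y (c t) t k := by
            simp only [prediction, approxGradient, Finset.mul_sum]
            rw [Finset.sum_comm]
            exact Finset.sum_congr rfl fun k _ => Finset.sum_congr rfl fun i _ => by ring
          rw [h3, h4]; exact h2)
      have h5 : (fun i => prediction M φ (c t) i / t + 1 / ((t : ℝ) + 1) *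
          (r * φ j i - prediction M φ (c t) i / t)) =
          fun i => prediction M φ (c (t + 1)) i / ((t + 1 : ℕ) : ℝ) := by
        funext i
        rw [hc, prediction_update φ _ hj]
        push_cast
        rcases Nat.eq_zero_or_pos t with rfl | htp
        · simp [h0, prediction]
        · have htp' : (0 : ℝ) < t := Nat.cast_pos.2 htp
          field_simp
          ring
      rw [h5] at h1
      have h6 : F (t + 1) ≤ F t + 1 / ((t : ℝ) + 1) * (Q - F t + 2 * R * κ) +
        2 * R ^ 2 * (1 / ((t : ℝ) + 1)) ^ 2 := h1
      rw [Finset.sum_range_succ]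
      have h7 := ih (by omega)
      have h8 : ((t : ℝ) + 1) * (F (t + 1) - Q) ≤ t * (F t - Q) + 2 * R * κ +
          2 * R ^ 2 * (1 / ((t : ℝ) + 1)) := by
        have := mul_le_mul_of_nonneg_left h6 ht1.le
        have e : ((t : ℝ) + 1) * (F t + 1 / ((t : ℝ) + 1) * (Q - F t + 2 * R * κ) +
            2 * R ^ 2 * (1 / ((t : ℝ) + 1)) ^ 2) = ((t : ℝ) + 1) * F t + (Q - F t + 2 * R * κ) +
            2 * R ^ 2 * (1 / ((t : ℝ) + 1)) := by field_simp
        rw [e] at this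
        linarith
      push_cast
      linarith
  have hT' : (0 : ℝ) < T := Nat.cast_pos.2 hT
  have hs : 0 < √(T : ℝ) := Real.sqrt_pos.2 hT'
  have hs2 : √(T : ℝ) ^ 2 = T := Real.sq_sqrt hT'.le
  have h1 := hmain T le_rfl
  have h2 : T * (F T - Q) ≤ T * (4 * R ^ 3 / m + 4 * R ^ 2 / √T) := by
    have e : T * (4 * R ^ 3 / m + 4 * R ^ 2 / √T) = 2 * R * κ * T + 2 * R ^ 2 * (2 * √T) := by
      rw [hκ]
      nth_rewrite 1 [← hs2]
      nth_rewrite 3 [← hs2]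
      field_simp
      ring
    rw [e]
    have := mul_le_mul_of_nonneg_left (sum_inv_le_two_sqrt T) (show 0 ≤ 2 * R ^ 2 by positivity)
    linarith
  have h3 := le_of_mul_le_mul_left h2 hT'
  linarith

end conditionalGradient

/-! ### A structured command language -/

/-- Commands whose only loops are counting loops: `loop i b c` runs `c` with register `i` equal to
`0, 1, …, nreg b - 1`. They have a total semantics `Cmd.run`, and the machine programs to which they
compile take a time polynomial in the values of the registers that bound the loops. -/
inductive Cmd where
  | skip
  | op (i : Instr)
  | seq (c d : Cmd)
  | ifNat (a b : ℕ) (c d : Cmd)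
  | ifReal (a b : ℕ) (c d : Cmd)
  | loop (i b : ℕ) (c : Cmd)

/-- Sequential composition of a list of commands. -/
def Cmd.block : List Cmd → Cmd
  | [] => .skip
  | c :: l => .seq c (Cmd.block l)

/-- Assignment to a natural register. -/
def State.setN (s : State) (r v : ℕ) : State := { s with nreg := Function.update s.nreg r v }

/-- The components of a state that a command may change. -/
inductive Loc where
  | nreg (r : ℕ)
  | rreg (r : ℕ)
  | nmem
  | rmem

/-- Two states agree on a component. -/
def State.same (s s' : State) : Loc → Prop
  | .nreg r => s.nreg r = s'.nreg r
  | .rreg r => s.rreg r = s'.rreg r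
  | .nmem => s.nmem = s'.nmem
  | .rmem => s.rmem = s'.rmem

theorem State.same.trans {s s' s'' : State} {l : Loc} (h : s.same s' l) (h' : s'.same s'' l) :
    s.same s'' l := by
  cases l <;> exact Eq.trans h h'

theorem State.same_refl (s : State) (l : Loc) : s.same s l := by
  cases l <;> rfl

/-- The component that an instruction changes. -/
def instrWrites : Instr → Loc → Bool
  | .nconst r _, .nreg x => r == x
  | .nadd r _ _, .nreg x => r == x
  | .nsub r _ _, .nreg x => r == x
  | .nload r _, .nreg x => r == x
  | .nstore _ _, .nmem => true
  | .rconst r _, .rreg x => r == x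
  | .radd r _ _, .rreg x => r == x
  | .rsub r _ _, .rreg x => r == x
  | .rmul r _ _, .rreg x => r == x
  | .rdiv r _ _, .rreg x => r == x
  | .rload r _, .rreg x => r == x
  | .rstore _ _, .rmem => true
  | _, _ => false

theorem instrWrites_spec {i : Instr} {l : Loc} (h : instrWrites i l = false) (s : State) :
    (i.apply s).same s l := by
  cases i <;> cases l <;> simp only [instrWrites, beq_eq_false_iff_ne, ne_eq, reduceCtorEq] at h <;>
    first
      | rfl
      | exact Function.update_of_ne (Ne.symm h) _ _

namespace Cmd

/-- The components that a command may change. -/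
def writes : Cmd → Loc → Bool
  | skip, _ => false
  | op i, l => instrWrites i l
  | seq c d, l => writes c l || writes d l
  | ifNat _ _ c d, l => writes c l || writes d l
  | ifReal _ _ c d, l => writes c l || writes d l
  | loop i _ c, .nreg x => i == x || writes c (.nreg x)
  | loop _ _ c, l => writes c l

/-- The registers that bound the loops of a command. -/
def bounds : Cmd → List ℕ
  | skip => []
  | op _ => []
  | seq c d => bounds c ++ bounds d
  | ifNat _ _ c d => bounds c ++ bounds d
  | ifReal _ _ c d => bounds c ++ bounds d
  | loop _ b c => b :: bounds c

/-- The loop bodies leave their counter alone. -/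
def countersSafe : Cmd → Bool
  | skip => true
  | op _ => true
  | seq c d => countersSafe c && countersSafe d
  | ifNat _ _ c d => countersSafe c && countersSafe d
  | ifReal _ _ c d => countersSafe c && countersSafe d
  | loop i _ c => !writes c (.nreg i) && countersSafe c

/-- No loop changes its counter or a register that bounds a loop, and register `3`, which holds the
constant `1`, is never changed. -/
def safe (c : Cmd) : Bool :=
  countersSafe c && !writes c (.nreg 3) && (bounds c).all fun b => !writes c (.nreg b)

/-- The state after a command. -/
def run : Cmd → State → State
  | skip, s => s
  | op i, s => i.apply s
  | seq c d, s => run d (run c s)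
  | ifNat a b c d, s => if s.nreg a < s.nreg b then run c s else run d s
  | ifReal a b c d, s => if s.rreg a < s.rreg b then run c s else run d s
  | loop i b c, s => Nat.rec (motive := fun _ => State) (s.setN i 0)
      (fun k st => (run c st).setN i (k + 1)) (s.nreg b)

/-- The machine program of a command. -/
def compile : Cmd → Program
  | skip => .skip
  | op i => .instr i
  | seq c d => .seq (compile c) (compile d)
  | ifNat a b c d => .ifNat a b (compile c) (compile d)
  | ifReal a b c d => .ifReal a b (compile c) (compile d)
  | loop i b c => .seq (.instr (.nconst i 0))
      (.whileNat i b (.seq (compile c) (.instr (.nadd i i 3))))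

/-- A bound for the number of steps of a command whose loops are run at most `B` times each. -/
def timeBound (B : ℕ) : Cmd → ℕ
  | skip => 0
  | op _ => 1
  | seq c d => timeBound B c + timeBound B d
  | ifNat _ _ c d => timeBound B c + timeBound B d + 1
  | ifReal _ _ c d => timeBound B c + timeBound B d + 1
  | loop _ _ c => 2 + B * (timeBound B c + 2)

theorem setN_same_of_loop {i b : ℕ} {c : Cmd} {l : Loc} (h : (loop i b c).writes l = false)
    (s : State) (v : ℕ) : (s.setN i v).same s l := by
  cases l with
  | nreg x =>
    simp only [writes, Bool.or_eq_false_iff, beq_eq_false_iff_ne] at h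
    exact Function.update_of_ne (Ne.symm h.1) _ _
  | _ => rfl

theorem writes_of_loop {i b : ℕ} {c : Cmd} {l : Loc} (h : (loop i b c).writes l = false) :
    c.writes l = false := by
  cases l with
  | nreg x => simp only [writes, Bool.or_eq_false_iff] at h; exact h.2
  | _ => exact h

theorem run_same {c : Cmd} {l : Loc} (h : c.writes l = false) (s : State) :
    (c.run s).same s l := by
  induction c generalizing s with
  | skip => exact State.same_refl _ _
  | op i => exact instrWrites_spec h s
  | seq c d hc hd =>
    simp only [writes, Bool.or_eq_false_iff] at h
    exact (hd h.2 _).trans (hc h.1 _)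
  | ifNat a b c d hc hd =>
    simp only [writes, Bool.or_eq_false_iff] at h
    rw [run]; split_ifs
    · exact hc h.1 _
    · exact hd h.2 _
  | ifReal a b c d hc hd =>
    simp only [writes, Bool.or_eq_false_iff] at h
    rw [run]; split_ifs
    · exact hc h.1 _
    · exact hd h.2 _
  | loop i b c hc =>
    rw [run]
    generalize s.nreg b = N
    induction N with
    | zero => exact setN_same_of_loop h s 0
    | succ N ih =>
      exact ((setN_same_of_loop h _ _).trans (hc (writes_of_loop h) _)).trans ih

theorem run_nreg {c : Cmd} {r : ℕ} (h : c.writes (.nreg r) = false) (s : State) :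
    (c.run s).nreg r = s.nreg r := run_same h s

theorem run_rreg {c : Cmd} {r : ℕ} (h : c.writes (.rreg r) = false) (s : State) :
    (c.run s).rreg r = s.rreg r := run_same h s

theorem run_nmem {c : Cmd} (h : c.writes .nmem = false) (s : State) :
    (c.run s).nmem = s.nmem := run_same h s

theorem run_rmem {c : Cmd} (h : c.writes .rmem = false) (s : State) :
    (c.run s).rmem = s.rmem := run_same h s

/-- The invariant rule for loops. In the body the counter is known, and all components that the loop
does not change have their initial value. -/
theorem run_loop {i b : ℕ} {c : Cmd} {s : State} (P : ℕ → State → Prop)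
    (h0 : P 0 (s.setN i 0))
    (hs : ∀ k < s.nreg b, ∀ st : State, (∀ l, (loop i b c).writes l = false → st.same s l) →
      st.nreg i = k → P k st → P (k + 1) ((c.run st).setN i (k + 1))) :
    P (s.nreg b) ((loop i b c).run s) := by
  rw [run]
  have key : ∀ N ≤ s.nreg b,
      let st := Nat.rec (motive := fun _ => State) (s.setN i 0)
        (fun k st => (run c st).setN i (k + 1)) N
      (∀ l, (loop i b c).writes l = false → st.same s l) ∧ st.nreg i = N ∧ P N st := by
    intro N
    induction N with
    | zero =>
      intro _
      exact ⟨fun l hl => setN_same_of_loop hl _ _, by simp [State.setN], h0⟩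
    | succ N ih =>
      intro hN
      obtain ⟨h1, h2, h3⟩ := ih (by omega)
      refine ⟨fun l hl => ?_, by simp [State.setN], hs N (by omega) _ h1 h2 h3⟩
      exact ((setN_same_of_loop hl _ _).trans (run_same (writes_of_loop hl) _)).trans (h1 l hl)
  exact (key _ le_rfl).2.2

/-- `exec_compile` with the three parts of `safe` as separate hypotheses, as the induction on the
command needs them. -/
theorem exec_compile_aux {c : Cmd} {B : ℕ} (hc : countersSafe c = true)
    (h3 : writes c (.nreg 3) = false) (hb : ∀ b ∈ bounds c, writes c (.nreg b) = false) (s : State)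
    (hs3 : s.nreg 3 = 1) (hsb : ∀ b ∈ bounds c, s.nreg b ≤ B) :
    ∃ t ≤ timeBound B c, Exec c.compile s (c.run s) t := by
  induction c generalizing s with
  | skip => exact ⟨0, le_rfl, .skip s⟩
  | op i => exact ⟨1, le_rfl, .instr i s⟩
  | seq c d ihc ihd =>
    simp only [countersSafe, Bool.and_eq_true, writes, Bool.or_eq_false_iff, bounds,
      List.mem_append] at hc h3 hb hsb
    obtain ⟨t, ht, e⟩ := ihc hc.1 h3.1 (fun b h => (hb b (.inl h)).1) s hs3
      (fun b h => hsb b (.inl h))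
    have hs3' : (c.run s).nreg 3 = 1 := (run_nreg h3.1 s).trans hs3
    obtain ⟨t', ht', e'⟩ := ihd hc.2 h3.2 (fun b h => (hb b (.inr h)).2) (c.run s) hs3'
      (fun b h => (run_nreg (hb b (.inr h)).1 s).trans_le (hsb b (.inr h)))
    exact ⟨t + t', add_le_add ht ht', .seq e e'⟩
  | ifNat a b c d ihc ihd =>
    simp only [countersSafe, Bool.and_eq_true, writes, Bool.or_eq_false_iff, bounds,
      List.mem_append] at hc h3 hb hsb
    obtain ⟨t, ht, e⟩ := ihc hc.1 h3.1 (fun b h => (hb b (.inl h)).1) s hs3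
      (fun b h => hsb b (.inl h))
    obtain ⟨t', ht', e'⟩ := ihd hc.2 h3.2 (fun b h => (hb b (.inr h)).2) s hs3
      (fun b h => hsb b (.inr h))
    rw [run]
    split_ifs with h
    · exact ⟨t + 1, by rw [timeBound]; omega, .ifNatTrue h e⟩
    · exact ⟨t' + 1, by rw [timeBound]; omega, .ifNatFalse h e'⟩
  | ifReal a b c d ihc ihd =>
    simp only [countersSafe, Bool.and_eq_true, writes, Bool.or_eq_false_iff, bounds,
      List.mem_append] at hc h3 hb hsb
    obtain ⟨t, ht, e⟩ := ihc hc.1 h3.1 (fun b h => (hb b (.inl h)).1) s hs3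
      (fun b h => hsb b (.inl h))
    obtain ⟨t', ht', e'⟩ := ihd hc.2 h3.2 (fun b h => (hb b (.inr h)).2) s hs3
      (fun b h => hsb b (.inr h))
    rw [run]
    split_ifs with h
    · exact ⟨t + 1, by rw [timeBound]; omega, .ifRealTrue h e⟩
    · exact ⟨t' + 1, by rw [timeBound]; omega, .ifRealFalse h e'⟩
  | loop i b c ih =>
    simp only [countersSafe, Bool.and_eq_true, Bool.not_eq_true', writes, Bool.or_eq_false_iff,
      beq_eq_false_iff_ne, bounds, List.mem_cons, forall_eq_or_imp] at hc h3 hb hsb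
    set N := s.nreg b with hN
    set st : ℕ → State := fun k => Nat.rec (motive := fun _ => State) (s.setN i 0)
      (fun k st => (run c st).setN i (k + 1)) k with hst
    have hcounter : ∀ k, (st k).nreg i = k := by
      intro k; cases k <;> simp [hst, State.setN]
    have hkeep : ∀ x, i ≠ x → writes c (.nreg x) = false → ∀ k, (st k).nreg x = s.nreg x := by
      intro x hx hw k
      induction k with
      | zero => exact Function.update_of_ne (Ne.symm hx) _ _
      | succ k ihk =>
        exact (Function.update_of_ne (Ne.symm hx) _ _).trans ((run_nreg hw _).trans ihk)
    -- the loop is unrolled from the end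
    have hwhile : ∀ d ≤ N, ∃ t ≤ 1 + d * (timeBound B c + 2),
        Exec (.whileNat i b (.seq c.compile (.instr (.nadd i i 3)))) (st (N - d)) (st N) t := by
      intro d
      induction d with
      | zero =>
        intro _
        refine ⟨1, by omega, .whileFalse ?_⟩
        rw [Nat.sub_zero, hcounter, hkeep b hb.1.1 hb.1.2]
        exact lt_irrefl _
      | succ d ihd =>
        intro hd
        obtain ⟨t, ht, e⟩ := ihd (by omega)
        obtain ⟨t', ht', e'⟩ := ih hc.2 h3.2 (fun x hx => (hb.2 x hx).2) (st (N - (d + 1)))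
          ((hkeep 3 h3.1 h3.2 _).trans hs3)
          (fun x hx => (hkeep x (hb.2 x hx).1 (hb.2 x hx).2 _).trans_le (hsb.2 x hx))
        have hnext : (Instr.nadd i i 3).apply (c.run (st (N - (d + 1)))) = st (N - d) := by
          have e1 : N - d = N - (d + 1) + 1 := by omega
          have e2 : (c.run (st (N - (d + 1)))).nreg i = N - (d + 1) :=
            (run_nreg hc.1 _).trans (hcounter _)
          have e3 : (c.run (st (N - (d + 1)))).nreg 3 = 1 :=
            (run_nreg h3.2 _).trans ((hkeep 3 h3.1 h3.2 _).trans hs3)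
          rw [e1]
          simp only [Instr.apply, e2, e3]
          rfl
        have hlt : (st (N - (d + 1))).nreg i < (st (N - (d + 1))).nreg b := by
          rw [hcounter, hkeep b hb.1.1 hb.1.2]; omega
        have hbody : Exec (.seq c.compile (.instr (.nadd i i 3))) (st (N - (d + 1))) (st (N - d))
            (t' + 1) := .seq e' (hnext ▸ .instr _ _)
        refine ⟨t' + 1 + t + 1, ?_, .whileTrue hlt hbody e⟩
        rw [Nat.succ_mul]; omega
    obtain ⟨t, ht, e⟩ := hwhile N le_rfl
    rw [Nat.sub_self] at e
    refine ⟨1 + t, ?_, .seq (.instr _ _) e⟩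
    have := Nat.mul_le_mul_right (timeBound B c + 2) hsb.1
    rw [timeBound]; omega

/-- The compiled program of a safe command computes `run` in at most `timeBound` steps. -/
theorem exec_compile {c : Cmd} (hc : c.safe = true) {B : ℕ} {s : State} (hs3 : s.nreg 3 = 1)
    (hsb : ∀ b ∈ bounds c, s.nreg b ≤ B) :
    ∃ t ≤ timeBound B c, Exec c.compile s (c.run s) t := by
  simp only [safe, Bool.and_eq_true, Bool.not_eq_true', List.all_eq_true] at hc
  exact exec_compile_aux hc.1.1 hc.1.2 hc.2 s hs3 hsb

/-- The running time is polynomial in the bound `B` on the lengths of the loops. -/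
theorem exists_timeBound_le (c : Cmd) : ∃ K : ℕ, ∀ B : ℕ, 1 ≤ B → timeBound B c ≤ K * B ^ K := by
  have hadd : ∀ c d : Cmd, (∃ K : ℕ, ∀ B : ℕ, 1 ≤ B → timeBound B c ≤ K * B ^ K) →
      (∃ K : ℕ, ∀ B : ℕ, 1 ≤ B → timeBound B d ≤ K * B ^ K) →
      ∃ K : ℕ, ∀ B : ℕ, 1 ≤ B → timeBound B c + timeBound B d + 1 ≤ K * B ^ K := by
    rintro c d ⟨K, hK⟩ ⟨L, hL⟩
    refine ⟨K + L + 1, fun B hB => ?_⟩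
    have h1 : B ^ K ≤ B ^ (K + L + 1) := Nat.pow_le_pow_right hB (by omega)
    have h2 : B ^ L ≤ B ^ (K + L + 1) := Nat.pow_le_pow_right hB (by omega)
    have h3 : 1 ≤ B ^ (K + L + 1) := Nat.one_le_pow _ _ hB
    calc timeBound B c + timeBound B d + 1 ≤ K * B ^ K + L * B ^ L + 1 :=
          Nat.add_le_add_right (Nat.add_le_add (hK B hB) (hL B hB)) 1
      _ ≤ K * B ^ (K + L + 1) + L * B ^ (K + L + 1) + B ^ (K + L + 1) := by gcongr
      _ = (K + L + 1) * B ^ (K + L + 1) := by ring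
  induction c with
  | skip => exact ⟨0, fun B _ => by simp [timeBound]⟩
  | op i => exact ⟨1, fun B hB => by simpa [timeBound] using hB⟩
  | seq c d hc hd =>
    obtain ⟨K, hK⟩ := hadd c d hc hd
    exact ⟨K, fun B hB => (Nat.le_succ _).trans (hK B hB)⟩
  | ifNat a b c d hc hd => exact hadd c d hc hd
  | ifReal a b c d hc hd => exact hadd c d hc hd
  | loop i b c hc =>
    obtain ⟨K, hK⟩ := hc
    refine ⟨K + 4, fun B hB => ?_⟩
    have h1 : 1 ≤ B ^ K := Nat.one_le_pow _ _ hB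
    have h2 : B ^ (K + 1) ≤ B ^ (K + 4) := Nat.pow_le_pow_right hB (by omega)
    have h3 : 1 ≤ B ^ (K + 1) := Nat.one_le_pow _ _ hB
    calc timeBound B (loop i b c) = 2 + B * (timeBound B c + 2) := rfl
      _ ≤ 2 * B ^ (K + 1) + B * (K * B ^ K + 2 * B ^ K) := by
          have := hK B hB
          gcongr <;> omega
      _ = (K + 4) * B ^ (K + 1) := by ring
      _ ≤ (K + 4) * B ^ (K + 4) := by gcongr

end Cmd

/-! ### The table of exponents -/

/- Register conventions of the program. Natural registers: `0, 1, 2` hold `n, D, m`; `3` holds the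
constant `1` and `7` the constant `0`; `4, 5` hold the number of words of length less than `D` and
at most `D`; `21` holds the address in the real memory where the coefficients are accumulated. Real
registers: `0` holds `R`, `2` holds `m`, `3, 5` hold the constants `1, 0`, and `4` counts the steps
of the method. The other registers are scratch. -/

open Cmd Instr

/-- `r := a * n`. -/
def mulCmd (r a : ℕ) : Cmd := block [op (nconst r 0), loop 33 0 (op (nadd r r a))]

/-- Compute the numbers of words of length less than `D` and at most `D`, in the registers `4` and
`5`. -/
def sizeCmd : Cmd := block [op (nconst 5 1),
  loop 6 1 (block [op (nadd 4 5 7), op (nconst 5 1), loop 8 0 (op (nadd 5 5 4))])]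

/-- Write the exponents of the child number `nreg 11` of the word `nreg 10`. -/
def childCmd : Cmd := block [mulCmd 12 10, op (nadd 13 12 11), op (nadd 13 13 3), mulCmd 15 13,
  loop 16 0 (block [op (nadd 17 12 16), op (nload 18 17), op (nadd 19 15 16), op (nstore 19 18)]),
  op (nadd 19 15 11), op (nload 18 19), op (nadd 18 18 3), op (nstore 19 18)]

/-- Write the table of all exponents: the words of length at most `D` are the empty word, whose row
is zero from the start, and the children of the words of length less than `D`. -/
def tableCmd : Cmd := loop 10 4 (loop 11 0 childCmd)

theorem mul_nreg {r a : ℕ} (h0 : r ≠ 0) (h33 : r ≠ 33) (hra : r ≠ a) (ha : a ≠ 33) (s : State) :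
    ((mulCmd r a).run s).nreg r = s.nreg a * s.nreg 0 := by
  have h := run_loop (i := 33) (b := 0) (c := op (nadd r r a)) (s := (nconst r 0).apply s)
    (fun k st => st.nreg r = k * s.nreg a ∧ st.nreg a = s.nreg a)
    (by simp [Instr.apply, State.setN, h33, ha, hra.symm])
    (fun k _ st _ _ hP => by
      simp [Cmd.run, Instr.apply, State.setN, h33, ha, hra.symm, hP]
      ring)
  have e : ((nconst r 0).apply s).nreg 0 = s.nreg 0 := Function.update_of_ne h0.symm _ _
  rw [e] at h
  rw [mul_comm]
  exact h.1

theorem mul_nreg_of_ne {r a x : ℕ} (h1 : x ≠ r) (h2 : x ≠ 33) (s : State) :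
    ((mulCmd r a).run s).nreg x = s.nreg x :=
  run_nreg (by simp [mulCmd, block, writes, instrWrites, h1.symm, h2.symm]) s

theorem mul_nmem (r a : ℕ) (s : State) : ((mulCmd r a).run s).nmem = s.nmem := run_nmem rfl s

theorem mul_rmem (r a : ℕ) (s : State) : ((mulCmd r a).run s).rmem = s.rmem := run_rmem rfl s

theorem mul_rreg (r a x : ℕ) (s : State) : ((mulCmd r a).run s).rreg x = s.rreg x :=
  run_rreg rfl s

theorem run_block_cons (c : Cmd) (l : List Cmd) (s : State) :
    (block (c :: l)).run s = (block l).run (c.run s) := rfl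

theorem run_block_nil (s : State) : (block []).run s = s := rfl

theorem run_op (i : Instr) (s : State) : (op i).run s = i.apply s := rfl

theorem sizeCmd_spec {s : State} {n D : ℕ} (h0 : s.nreg 0 = n) (h1 : s.nreg 1 = D)
    (h4 : s.nreg 4 = 0) (h7 : s.nreg 7 = 0) :
    (sizeCmd.run s).nreg 5 = heapSize n D ∧
      (sizeCmd.run s).nreg 5 = (sizeCmd.run s).nreg 4 * n + 1 := by
  simp only [sizeCmd, run_block_cons, run_block_nil, run_op]
  set s1 := (nconst 5 1).apply s with hs1
  have e0 : s1.nreg 0 = n := by simp [hs1, Instr.apply, h0]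
  have e1 : s1.nreg 1 = D := by simp [hs1, Instr.apply, h1]
  have h := run_loop (s := s1) (i := 6) (b := 1)
    (c := block [op (nadd 4 5 7), op (nconst 5 1), loop 8 0 (op (nadd 5 5 4))])
    (fun d st => st.nreg 5 = heapSize n d ∧ st.nreg 5 = st.nreg 4 * n + 1)
    (by simp [hs1, Instr.apply, State.setN, heapSize, h4])
    (fun d _ st hfr _ hP => by
      have f0 : st.nreg 0 = s1.nreg 0 := hfr (.nreg 0) rfl
      have f7 : st.nreg 7 = s1.nreg 7 := hfr (.nreg 7) rfl
      have g7 : s1.nreg 7 = 0 := by simp [hs1, Instr.apply, h7]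
      simp only [run_block_cons, run_block_nil, run_op]
      set s2 := (nconst 5 1).apply ((nadd 4 5 7).apply st) with hs2
      have q0 : s2.nreg 0 = n := by simp [hs2, Instr.apply, f0, e0]
      have q4 : s2.nreg 4 = heapSize n d := by simp [hs2, Instr.apply, f7, g7, hP.1]
      have q5 : s2.nreg 5 = 1 := by simp [hs2, Instr.apply]
      have hl := run_loop (s := s2) (i := 8) (b := 0) (c := op (nadd 5 5 4))
        (fun i st => st.nreg 5 = heapSize n d * i + 1 ∧ st.nreg 4 = heapSize n d)
        (by simp [State.setN, q5, q4])
        (fun i _ st _ _ hP => by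
          simp [Cmd.run, Instr.apply, State.setN, hP]; ring)
      rw [q0] at hl
      simp [State.setN, hl, heapSize])
  rw [e1] at h
  exact h

/-- The exponents of a child are those of its parent with one of them increased. The rows before
that of the child are not touched. -/
theorem childCmd_spec {s : State} {n q j : ℕ} (hj : j < n) (h0 : s.nreg 0 = n) (h3 : s.nreg 3 = 1)
    (h10 : s.nreg 10 = q) (h11 : s.nreg 11 = j)
    (hrow : ∀ i < n, s.nmem (q * n + i) = heapExp n q i) :
    (∀ i < n, (childCmd.run s).nmem ((q * n + j + 1) * n + i) = heapExp n (q * n + j + 1) i) ∧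
      ∀ a < (q * n + j + 1) * n, (childCmd.run s).nmem a = s.nmem a := by
  simp only [childCmd, run_block_cons, run_block_nil, run_op]
  set s1 := (mulCmd 15 13).run ((nadd 13 13 3).apply ((nadd 13 12 11).apply
    ((mulCmd 12 10).run s))) with hs1
  have e0 : s1.nreg 0 = n := by simp [hs1, Instr.apply, mul_nreg_of_ne, h0]
  have e3 : s1.nreg 3 = 1 := by simp [hs1, Instr.apply, mul_nreg_of_ne, h3]
  have e11 : s1.nreg 11 = j := by simp [hs1, Instr.apply, mul_nreg_of_ne, h11]
  have e12 : s1.nreg 12 = q * n := by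
    simp [hs1, Instr.apply, mul_nreg_of_ne, mul_nreg, h0, h10]
  have e15 : s1.nreg 15 = (q * n + j + 1) * n := by
    simp [hs1, Instr.apply, mul_nreg_of_ne, mul_nreg, h0, h10, h11, h3]
  have em : s1.nmem = s.nmem := by simp [hs1, Instr.apply, mul_nmem]
  have hqn : q * n + n ≤ (q * n + j + 1) * n := by nlinarith
  set c := block [op (nadd 17 12 16), op (nload 18 17), op (nadd 19 15 16), op (nstore 19 18)]
    with hc
  have hl := run_loop (s := s1) (i := 16) (b := 0) (c := c)
    (fun i st => (∀ i' < i, st.nmem ((q * n + j + 1) * n + i') = heapExp n q i') ∧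
      ∀ a < (q * n + j + 1) * n, st.nmem a = s.nmem a)
    ⟨by simp, by simp [State.setN, em]⟩
    (fun i hi st hfr hcnt hP => by
      rw [e0] at hi
      have f12 : st.nreg 12 = q * n := Eq.trans (hfr (.nreg 12) rfl) e12
      have f15 : st.nreg 15 = (q * n + j + 1) * n := Eq.trans (hfr (.nreg 15) rfl) e15
      have hmem : ((c.run st).setN 16 (i + 1)).nmem =
          Function.update st.nmem ((q * n + j + 1) * n + i) (st.nmem (q * n + i)) := by
        simp [hc, Cmd.run, block, Instr.apply, State.setN, f12, f15, hcnt]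
      rw [hmem]
      refine ⟨fun i' hi' => ?_, fun a ha => ?_⟩
      · rcases Nat.lt_succ_iff_lt_or_eq.1 hi' with h | rfl
        · rw [Function.update_of_ne (by omega), hP.1 i' h]
        · rw [Function.update_self, hP.2 _ (by omega), hrow _ hi]
      · rw [Function.update_of_ne (by omega), hP.2 a ha])
  set s2 := (loop 16 0 c).run s1 with hs2
  rw [e0] at hl
  have g3 : s2.nreg 3 = 1 := (run_nreg rfl s1).trans e3
  have g11 : s2.nreg 11 = j := (run_nreg rfl s1).trans e11
  have g15 : s2.nreg 15 = (q * n + j + 1) * n := (run_nreg rfl s1).trans e15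
  have hmem : ((nstore 19 18).apply ((nadd 18 18 3).apply ((nload 18 19).apply
      ((nadd 19 15 11).apply s2)))).nmem = Function.update s2.nmem ((q * n + j + 1) * n + j)
        (s2.nmem ((q * n + j + 1) * n + j) + 1) := by
    simp [Instr.apply, g3, g11, g15]
  rw [hmem]
  refine ⟨fun i hi => ?_, fun a ha => ?_⟩
  · rw [heapExp_child hj]
    by_cases hij : j = i
    · subst hij
      rw [Function.update_self, hl.1 _ hi, if_pos rfl]
    · rw [Function.update_of_ne (by omega), hl.1 _ hi, if_neg hij, add_zero]
  · rw [Function.update_of_ne (by omega), hl.2 a ha]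

theorem tableCmd_spec {s : State} {n M' : ℕ} (h0 : s.nreg 0 = n) (h3 : s.nreg 3 = 1)
    (h4 : s.nreg 4 = M') (hm : ∀ a, s.nmem a = 0) :
    ∀ k < M' * n + 1, ∀ i < n, (tableCmd.run s).nmem (k * n + i) = heapExp n k i := by
  have h := run_loop (s := s) (i := 10) (b := 4) (c := loop 11 0 childCmd)
    (fun q st => ∀ k < q * n + 1, ∀ i < n, st.nmem (k * n + i) = heapExp n k i)
    (fun k hk i _ => by
      have : k = 0 := by omega
      subst this
      simp [State.setN, hm, heapExp_zero])
    (fun q _ st hfr hcnt hP => by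
      have f0 : st.nreg 0 = n := Eq.trans (hfr (.nreg 0) rfl) h0
      have f3 : st.nreg 3 = 1 := Eq.trans (hfr (.nreg 3) rfl) h3
      have hl := run_loop (s := st) (i := 11) (b := 0) (c := childCmd)
        (fun j st => ∀ k < q * n + j + 1, ∀ i < n, st.nmem (k * n + i) = heapExp n k i)
        (by simpa [State.setN] using hP)
        (fun j hj st' hfr' hcnt' hP' => by
          rw [f0] at hj
          have g0 : st'.nreg 0 = n := Eq.trans (hfr' (.nreg 0) rfl) f0
          have g3 : st'.nreg 3 = 1 := Eq.trans (hfr' (.nreg 3) rfl) f3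
          have g10 : st'.nreg 10 = q := Eq.trans (hfr' (.nreg 10) rfl) hcnt
          have hq : q < q * n + j + 1 := by nlinarith
          have hc := childCmd_spec hj g0 g3 g10 hcnt' (hP' q hq)
          intro k hk i hi
          change (childCmd.run st').nmem (k * n + i) = heapExp n k i
          rcases Nat.lt_succ_iff_lt_or_eq.1 hk with h | rfl
          · rw [hc.2 _ ?_, hP' k (by omega) i hi]
            have : (k + 1) * n ≤ (q * n + j + 1) * n := Nat.mul_le_mul_right n (by omega)
            rw [add_mul, one_mul] at this
            omega
          · exact hc.1 i hi)
      rw [f0] at hl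
      intro k hk i hi
      refine hl k ?_ i hi
      rw [Nat.succ_mul] at hk
      exact hk)
  rw [h4] at h
  exact h

/-! ### The conditional gradient program -/

/-- Real register `10` becomes the feature of the word `nreg 42` at the sample `nreg 27`. The bound
of a loop has to be a fixed register, so a power is computed in `D` rounds, of which only as many
multiply as the exponent says. -/
def featureCmd : Cmd := block [op (radd 10 3 5), mulCmd 32 42, mulCmd 34 27, op (nadd 34 34 27),
  loop 35 0 (block [op (nadd 36 32 35), op (nload 37 36), op (nadd 38 34 35), op (rload 17 38),
    loop 39 1 (ifNat 39 37 (op (rmul 10 10 17)) skip)])]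

/-- Real register `9` becomes the prediction of the accumulated coefficients at the sample
`nreg 27`. -/
def predictCmd : Cmd := block [op (radd 9 5 5),
  loop 28 5 (block [op (nadd 42 28 7), featureCmd, op (nadd 29 21 28), op (rload 11 29),
    op (rmul 11 11 10), op (radd 9 9 11)])]

/-- Real register `14` becomes the approximate derivative of the loss at the sample `nreg 27`. The
real register `4` counts the steps made so far; the prediction before the first step is `0`. -/
def residualCmd : Cmd := block [predictCmd, ifReal 5 4 (op (rdiv 9 9 4)) (op (radd 9 5 5)),
  op (rdiv 9 9 2), op (radd 12 3 9), op (rsub 13 3 9), op (rdiv 12 12 13), op (radd 13 3 5),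
  loop 30 2 (op (rmul 13 13 12)), op (rsub 14 13 3), op (radd 15 13 3), op (rdiv 14 14 15),
  mulCmd 31 27, op (nadd 31 31 27), op (nadd 31 31 0), op (rload 15 31), op (rsub 14 14 15)]

/-- Real register `8` becomes the approximate gradient in the direction of the word `nreg 26`. -/
def gradCmd : Cmd := block [op (radd 8 5 5),
  loop 27 2 (block [residualCmd, op (nadd 42 26 7), featureCmd, op (rmul 14 14 10),
    op (radd 8 8 14)])]

/-- Find the vertex `rreg 7 • e_(nreg 25)` of the `ℓ₁` ball that minimizes the approximate
gradient. -/
def bestCmd : Cmd := block [op (radd 6 5 5), op (radd 7 5 5), op (nconst 25 0),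
  loop 26 5 (block [gradCmd,
    ifReal 6 8 (block [op (radd 6 8 5), op (nadd 25 26 7), op (rsub 7 5 0)]) skip,
    op (rsub 16 5 8),
    ifReal 6 16 (block [op (radd 6 16 5), op (nadd 25 26 7), op (radd 7 0 5)]) skip])]

/-- Add the vertex to the accumulated coefficients. -/
def updateCmd : Cmd := block [op (nadd 29 21 25), op (rload 11 29), op (radd 11 11 7),
  op (rstore 29 11), op (radd 4 4 3)]

/-- The conditional gradient method. -/
def methodCmd : Cmd := loop 24 2 (block [bestCmd, updateCmd])

/-- Set up the address of the coefficients and the real number `m`. -/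
def setupCmd : Cmd := block [mulCmd 21 2, op (nadd 21 21 2), op (nadd 21 21 5), op (rconst 3 1),
  loop 23 2 (op (radd 2 2 3))]

/-- Write the coefficients, divided by `m`, to the output cells. -/
def copyCmd : Cmd := loop 40 5 (block [op (nadd 41 21 40), op (rload 18 41), op (rdiv 18 18 2),
  op (rstore 40 18)])

/-- The value of the word `k` at the sample `i`, whose coordinates are `X i`. -/
def wordValue (n : ℕ) (X : ℕ → ℕ → ℝ) (k i : ℕ) : ℝ :=
  ∏ j ∈ Finset.range n, X i j ^ heapExp n k j

/-- The state of the machine while the conditional gradient method runs: the constants, the table of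
exponents and the sample are in place. -/
structure Ready (n D m base : ℕ) (R : ℝ) (X : ℕ → ℕ → ℝ) (Y : ℕ → ℝ) (s : State) : Prop where
  n0 : s.nreg 0 = n
  n1 : s.nreg 1 = D
  n2 : s.nreg 2 = m
  n3 : s.nreg 3 = 1
  n5 : s.nreg 5 = heapSize n D
  n7 : s.nreg 7 = 0
  n21 : s.nreg 21 = base
  r0 : s.rreg 0 = R
  r2 : s.rreg 2 = m
  r3 : s.rreg 3 = 1
  r5 : s.rreg 5 = 0
  table : ∀ k < heapSize n D, ∀ j < n, s.nmem (k * n + j) = heapExp n k j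
  inputs : ∀ i < m, ∀ j < n, s.rmem (i * (n + 1) + j) = X i j
  labels : ∀ i < m, s.rmem (i * (n + 1) + n) = Y i

/-- The components that `Ready` mentions are not among those in `w`. -/
def keepsReady (w : Loc → Bool) : Bool :=
  !w (.nreg 0) && !w (.nreg 1) && !w (.nreg 2) && !w (.nreg 3) && !w (.nreg 5) && !w (.nreg 7) &&
    !w (.nreg 21) && !w (.rreg 0) && !w (.rreg 2) && !w (.rreg 3) && !w (.rreg 5) && !w .nmem &&
    !w .rmem

section method

variable {n D m base : ℕ} {R : ℝ} {X : ℕ → ℕ → ℝ} {Y : ℕ → ℝ} {s : State}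

theorem Ready.of_frame (h : Ready n D m base R X Y s) {w : Loc → Bool} (hw : keepsReady w = true)
    {st : State} (hfr : ∀ l, w l = false → st.same s l) : Ready n D m base R X Y st := by
  simp only [keepsReady, Bool.and_eq_true, Bool.not_eq_true'] at hw
  obtain ⟨⟨⟨⟨⟨⟨⟨⟨⟨⟨⟨⟨h0, h1⟩, h2⟩, h3⟩, h5⟩, h7⟩, h21⟩, k0⟩, k2⟩, k3⟩, k5⟩, km⟩, kr⟩ := hw
  have em : st.nmem = s.nmem := hfr _ km
  have er : st.rmem = s.rmem := hfr _ kr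
  exact ⟨Eq.trans (hfr _ h0) h.n0, Eq.trans (hfr _ h1) h.n1, Eq.trans (hfr _ h2) h.n2,
    Eq.trans (hfr _ h3) h.n3, Eq.trans (hfr _ h5) h.n5, Eq.trans (hfr _ h7) h.n7,
    Eq.trans (hfr _ h21) h.n21, Eq.trans (hfr _ k0) h.r0, Eq.trans (hfr _ k2) h.r2,
    Eq.trans (hfr _ k3) h.r3, Eq.trans (hfr _ k5) h.r5, em ▸ h.table, er ▸ h.inputs,
    er ▸ h.labels⟩

theorem Ready.run (h : Ready n D m base R X Y s) {c : Cmd} (hw : keepsReady c.writes = true) :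
    Ready n D m base R X Y (c.run s) := h.of_frame hw fun _ hl => run_same hl s

theorem heapExp_le {k j : ℕ} (hk : k < heapSize n D) (hj : j < n) : heapExp n k j ≤ D :=
  (Finset.single_le_sum (f := fun i : Fin n => heapExp n k i) (fun _ _ => Nat.zero_le _)
    (Finset.mem_univ ⟨j, hj⟩)).trans (sum_heapExp_le D hk)

theorem featureCmd_spec (h : Ready n D m base R X Y s) {k i : ℕ} (hk : k < heapSize n D)
    (hi : i < m) (h42 : s.nreg 42 = k) (h27 : s.nreg 27 = i) :
    (featureCmd.run s).rreg 10 = wordValue n X k i := by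
  simp only [featureCmd, run_block_cons, run_block_nil, run_op]
  set s1 := (nadd 34 34 27).apply ((mulCmd 34 27).run ((mulCmd 32 42).run
    ((radd 10 3 5).apply s))) with hs1
  have hfr1 : Ready n D m base R X Y s1 :=
    h.run (c := block [op (radd 10 3 5), mulCmd 32 42, mulCmd 34 27, op (nadd 34 34 27)]) rfl
  have e32 : s1.nreg 32 = k * n := by
    simp [hs1, Instr.apply, mul_nreg_of_ne, mul_nreg, h42, h.n0]
  have e34 : s1.nreg 34 = i * (n + 1) := by
    simp [hs1, Instr.apply, mul_nreg_of_ne, mul_nreg, h27, h.n0]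
    ring
  have e10 : s1.rreg 10 = 1 := by
    simp [hs1, Instr.apply, mul_rreg, h.r3, h.r5]
  set p := loop 39 1 (ifNat 39 37 (op (rmul 10 10 17)) skip) with hp
  have hl := run_loop (s := s1) (i := 35) (b := 0)
    (c := block [op (nadd 36 32 35), op (nload 37 36), op (nadd 38 34 35), op (rload 17 38), p])
    (fun j st => st.rreg 10 = ∏ j' ∈ Finset.range j, X i j' ^ heapExp n k j')
    (by simpa [State.setN] using e10)
    (fun j hj st hfr hcnt hP => by
      rw [hfr1.n0] at hj
      have hst := hfr1.of_frame rfl hfr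
      have f32 : st.nreg 32 = k * n := Eq.trans (hfr (.nreg 32) rfl) e32
      have f34 : st.nreg 34 = i * (n + 1) := Eq.trans (hfr (.nreg 34) rfl) e34
      simp only [run_block_cons, run_block_nil, run_op]
      set s2 := (rload 17 38).apply ((nadd 38 34 35).apply ((nload 37 36).apply
        ((nadd 36 32 35).apply st))) with hs2
      have g37 : s2.nreg 37 = heapExp n k j := by
        simp [hs2, Instr.apply, f32, hcnt, hst.table k hk j hj]
      have g17 : s2.rreg 17 = X i j := by
        simp [hs2, Instr.apply, f34, hcnt, hst.inputs i hi j hj]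
      have g1 : s2.nreg 1 = D := by simp [hs2, Instr.apply, hst.n1]
      have g10 : s2.rreg 10 = ∏ j' ∈ Finset.range j, X i j' ^ heapExp n k j' := by
        simp [hs2, Instr.apply, hP]
      have hl := run_loop (s := s2) (i := 39) (b := 1)
        (c := ifNat 39 37 (op (rmul 10 10 17)) skip)
        (fun l st => st.rreg 10 = (∏ j' ∈ Finset.range j, X i j' ^ heapExp n k j') *
          X i j ^ min l (heapExp n k j))
        (by simpa [State.setN] using g10)
        (fun l _ st' hfr' hcnt' hP' => by
          have q37 : st'.nreg 37 = heapExp n k j := Eq.trans (hfr' (.nreg 37) rfl) g37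
          have q17 : st'.rreg 17 = X i j := Eq.trans (hfr' (.rreg 17) rfl) g17
          simp only [Cmd.run, q37, hcnt']
          split_ifs with hlt
          · rw [min_eq_left (by omega)] at hP' ⊢
            simp [Instr.apply, State.setN, hP', q17, pow_succ, mul_assoc]
          · rw [min_eq_right (by omega)] at hP' ⊢
            simpa [State.setN] using hP')
      rw [g1, min_eq_right (heapExp_le hk hj)] at hl
      rw [Finset.prod_range_succ]
      simpa [State.setN] using hl)
  rw [hfr1.n0] at hl
  exact hl

theorem predictCmd_spec (h : Ready n D m base R X Y s) {i : ℕ} (hi : i < m)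
    (h27 : s.nreg 27 = i) : (predictCmd.run s).rreg 9 =
      ∑ k ∈ Finset.range (heapSize n D), s.rmem (base + k) * wordValue n X k i := by
  simp only [predictCmd, run_block_cons, run_block_nil, run_op]
  set s1 := (radd 9 5 5).apply s with hs1
  have hr1 : Ready n D m base R X Y s1 := h.run (c := op (radd 9 5 5)) rfl
  have hl := run_loop (s := s1) (i := 28) (b := 5)
    (c := block [op (nadd 42 28 7), featureCmd, op (nadd 29 21 28), op (rload 11 29),
      op (rmul 11 11 10), op (radd 9 9 11)])
    (fun k st => st.rreg 9 = ∑ k' ∈ Finset.range k, s.rmem (base + k') * wordValue n X k' i)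
    (by simp [hs1, Instr.apply, State.setN, h.r5])
    (fun k hk st hfr hcnt hP => by
      rw [hr1.n5] at hk
      have hst := hr1.of_frame rfl hfr
      have f27 : st.nreg 27 = i := Eq.trans (hfr (.nreg 27) rfl) h27
      have frm : st.rmem = s.rmem := hfr .rmem rfl
      simp only [run_block_cons, run_block_nil, run_op]
      set s2 := (nadd 42 28 7).apply st with hs2
      have hr2 : Ready n D m base R X Y s2 := hst.run (c := op (nadd 42 28 7)) rfl
      have g42 : s2.nreg 42 = k := by simp [hs2, Instr.apply, hcnt, hst.n7]
      have g27 : s2.nreg 27 = i := by simp [hs2, Instr.apply, f27]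
      have g10 := featureCmd_spec hr2 hk hi g42 g27
      set s3 := featureCmd.run s2 with hs3
      have q9 : s3.rreg 9 = st.rreg 9 := run_rreg rfl s2
      have q28 : s3.nreg 28 = k := (run_nreg rfl s2).trans hcnt
      have q21 : s3.nreg 21 = base := (run_nreg rfl s2).trans hst.n21
      have qrm : s3.rmem = s.rmem := (run_rmem rfl s2).trans frm
      simp [Instr.apply, State.setN, q9, q28, q21, qrm, g10, hP, Finset.sum_range_succ])
  rw [hr1.n5] at hl
  exact hl

theorem residualCmd_spec (h : Ready n D m base R X Y s) {i : ℕ} (hi : i < m)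
    (h27 : s.nreg 27 = i) (h4 : 0 ≤ s.rreg 4) : (residualCmd.run s).rreg 14 = rationalTanh m
      ((∑ k ∈ Finset.range (heapSize n D), s.rmem (base + k) * wordValue n X k i) / s.rreg 4) m -
      Y i := by
  simp only [residualCmd, run_block_cons, run_block_nil, run_op]
  set v := ∑ k ∈ Finset.range (heapSize n D), s.rmem (base + k) * wordValue n X k i with hv
  have e9 : (predictCmd.run s).rreg 9 = v := predictCmd_spec h hi h27
  have e4 : (predictCmd.run s).rreg 4 = s.rreg 4 := run_rreg rfl s
  have hr0 : Ready n D m base R X Y (predictCmd.run s) := h.run rfl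
  have e27 : (predictCmd.run s).nreg 27 = i := (run_nreg rfl s).trans h27
  set s0 := predictCmd.run s
  set d := ifReal 5 4 (op (rdiv 9 9 4)) (op (radd 9 5 5))
  have e9' : (d.run s0).rreg 9 = v / s.rreg 4 := by
    rcases h4.lt_or_eq with h4 | h4
    · simp [d, Cmd.run, Instr.apply, hr0.r5, e4, e9, h4]
    · simp [d, Cmd.run, Instr.apply, hr0.r5, e4, ← h4]
  have hr0' : Ready n D m base R X Y (d.run s0) := hr0.run rfl
  have e27' : (d.run s0).nreg 27 = i := (run_nreg rfl s0).trans e27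
  set s1 := (radd 13 3 5).apply ((rdiv 12 12 13).apply ((rsub 13 3 9).apply ((radd 12 3 9).apply
    ((rdiv 9 9 2).apply (d.run s0))))) with hs1
  have hr1 : Ready n D m base R X Y s1 := hr0'.run (c := block [op (rdiv 9 9 2),
    op (radd 12 3 9), op (rsub 13 3 9), op (rdiv 12 12 13), op (radd 13 3 5)]) rfl
  have g12 : s1.rreg 12 = (1 + v / s.rreg 4 / m) / (1 - v / s.rreg 4 / m) := by
    simp [hs1, Instr.apply, e9', hr0'.r2, hr0'.r3]
  have g13 : s1.rreg 13 = 1 := by simp [hs1, Instr.apply, hr0'.r3, hr0'.r5]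
  have g27 : s1.nreg 27 = i := by simp [hs1, Instr.apply, e27']
  have hl := run_loop (s := s1) (i := 30) (b := 2) (c := op (rmul 13 13 12))
    (fun k st => st.rreg 13 = ((1 + v / s.rreg 4 / m) / (1 - v / s.rreg 4 / m)) ^ k)
    (by simpa [State.setN] using g13)
    (fun k _ st hfr _ hP => by
      have f12 : st.rreg 12 = _ := Eq.trans (hfr (.rreg 12) rfl) g12
      simp [Cmd.run, Instr.apply, State.setN, hP, f12, pow_succ])
  rw [hr1.n2] at hl
  have hr2 : Ready n D m base R X Y ((loop 30 2 (op (rmul 13 13 12))).run s1) := hr1.run rfl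
  have q27 : ((loop 30 2 (op (rmul 13 13 12))).run s1).nreg 27 = i := (run_nreg rfl s1).trans g27
  set s2 := (loop 30 2 (op (rmul 13 13 12))).run s1
  have hY : s2.rmem (i * n + i + n) = Y i := by
    rw [← hr2.labels i hi]; ring_nf
  simp [Instr.apply, mul_nreg, mul_nreg_of_ne, mul_rreg, mul_rmem, hl, hr2.r3, hr2.n0, q27, hY,
    rationalTanh]

/-- The features of the sample, in the form used by the conditional gradient method. -/
def sampleFeature (n m : ℕ) (X : ℕ → ℕ → ℝ) (k : ℕ) (i : Fin m) : ℝ := wordValue n X k i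

theorem gradCmd_spec (h : Ready n D m base R X Y s) {k t : ℕ} (hk : k < heapSize n D)
    (h26 : s.nreg 26 = k) (h4 : s.rreg 4 = t) : (gradCmd.run s).rreg 8 =
      approxGradient (heapSize n D) (sampleFeature n m X) (fun i => Y i)
        (fun k => s.rmem (base + k)) t k := by
  simp only [gradCmd, run_block_cons, run_block_nil, run_op]
  set s1 := (radd 8 5 5).apply s with hs1
  have hr1 : Ready n D m base R X Y s1 := h.run (c := op (radd 8 5 5)) rfl
  set g : ℕ → ℝ := fun i => (rationalTanh m ((∑ k ∈ Finset.range (heapSize n D),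
    s.rmem (base + k) * wordValue n X k i) / t) m - Y i) * wordValue n X k i with hg
  have hl := run_loop (s := s1) (i := 27) (b := 2)
    (c := block [residualCmd, op (nadd 42 26 7), featureCmd, op (rmul 14 14 10),
      op (radd 8 8 14)])
    (fun i st => st.rreg 8 = ∑ i' ∈ Finset.range i, g i')
    (by simp [hs1, Instr.apply, State.setN, h.r5])
    (fun i hi st hfr hcnt hP => by
      rw [hr1.n2] at hi
      have hst := hr1.of_frame rfl hfr
      have f26 : st.nreg 26 = k := Eq.trans (hfr (.nreg 26) rfl) h26
      have f4 : st.rreg 4 = t := Eq.trans (hfr (.rreg 4) rfl) h4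
      have frm : st.rmem = s.rmem := hfr .rmem rfl
      simp only [run_block_cons, run_block_nil, run_op]
      have g14 := residualCmd_spec hst hi hcnt (f4 ▸ Nat.cast_nonneg t)
      rw [frm, f4] at g14
      have hr2 : Ready n D m base R X Y (residualCmd.run st) := hst.run rfl
      have e26 : (residualCmd.run st).nreg 26 = k := (run_nreg rfl st).trans f26
      have e27 : (residualCmd.run st).nreg 27 = i := (run_nreg rfl st).trans hcnt
      have e8 : (residualCmd.run st).rreg 8 = st.rreg 8 := run_rreg rfl st
      set s2 := residualCmd.run st
      set s3 := (nadd 42 26 7).apply s2 with hs3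
      have hr3 : Ready n D m base R X Y s3 := hr2.run (c := op (nadd 42 26 7)) rfl
      have q42 : s3.nreg 42 = k := by simp [hs3, Instr.apply, e26, hr2.n7]
      have q27 : s3.nreg 27 = i := by simp [hs3, Instr.apply, e27]
      have g10 := featureCmd_spec hr3 hk hi q42 q27
      have p14 : (featureCmd.run s3).rreg 14 = s2.rreg 14 := run_rreg rfl s3
      have p8 : (featureCmd.run s3).rreg 8 = st.rreg 8 := (run_rreg rfl s3).trans e8
      simp [Instr.apply, State.setN, p14, p8, g10, g14, hP, Finset.sum_range_succ, hg])
  rw [hr1.n2] at hl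
  rw [hl, Finset.sum_range]
  rfl

theorem bestCmd_spec (h : Ready n D m base R X Y s) (hR : 0 ≤ R) {t : ℕ} (h4 : s.rreg 4 = t) :
    (bestCmd.run s).nreg 25 < heapSize n D ∧ |(bestCmd.run s).rreg 7| ≤ R ∧
      ∀ k < heapSize n D, (bestCmd.run s).rreg 7 *
        approxGradient (heapSize n D) (sampleFeature n m X) (fun i => Y i)
          (fun k => s.rmem (base + k)) t ((bestCmd.run s).nreg 25) ≤
        -(R * |approxGradient (heapSize n D) (sampleFeature n m X) (fun i => Y i)
          (fun k => s.rmem (base + k)) t k|) := by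
  simp only [bestCmd, run_block_cons, run_block_nil, run_op]
  set G := approxGradient (heapSize n D) (sampleFeature n m X) (fun i => Y i)
    (fun k => s.rmem (base + k)) t with hG
  set s1 := (nconst 25 0).apply ((radd 7 5 5).apply ((radd 6 5 5).apply s)) with hs1
  have hr1 : Ready n D m base R X Y s1 :=
    h.run (c := block [op (radd 6 5 5), op (radd 7 5 5), op (nconst 25 0)]) rfl
  -- Real register `6` holds the largest absolute value of a gradient coordinate so far. It starts
  -- at zero, together with the zero step, which is optimal if the gradient vanishes.
  have hl := run_loop (s := s1) (i := 26) (b := 5) (c := block [gradCmd,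
      ifReal 6 8 (block [op (radd 6 8 5), op (nadd 25 26 7), op (rsub 7 5 0)]) skip,
      op (rsub 16 5 8),
      ifReal 6 16 (block [op (radd 6 16 5), op (nadd 25 26 7), op (radd 7 0 5)]) skip])
    (fun K st => (∀ k < K, |G k| ≤ st.rreg 6) ∧ st.rreg 7 * G (st.nreg 25) = -(R * st.rreg 6) ∧
      |st.rreg 7| ≤ R ∧ st.nreg 25 < heapSize n D ∧ 0 ≤ st.rreg 6)
    (by simp [hs1, Instr.apply, State.setN, h.r5, hR, heapSize_pos])
    (fun k hk st hfr hcnt hP => by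
      rw [hr1.n5] at hk
      have hst := hr1.of_frame rfl hfr
      have f4 : st.rreg 4 = t := Eq.trans (hfr (.rreg 4) rfl) h4
      have frm : st.rmem = s.rmem := hfr .rmem rfl
      simp only [run_block_cons, run_block_nil, run_op]
      have g8 : (gradCmd.run st).rreg 8 = G k := by
        rw [gradCmd_spec hst hk hcnt f4, frm]
      have hr2 : Ready n D m base R X Y (gradCmd.run st) := hst.run rfl
      have e25 : (gradCmd.run st).nreg 25 = st.nreg 25 := run_nreg rfl st
      have e26 : (gradCmd.run st).nreg 26 = k := (run_nreg rfl st).trans hcnt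
      have e6 : (gradCmd.run st).rreg 6 = st.rreg 6 := run_rreg rfl st
      have e7 : (gradCmd.run st).rreg 7 = st.rreg 7 := run_rreg rfl st
      set s2 := gradCmd.run st
      obtain ⟨hP1, hP2, hP3, hP4, hP5⟩ := hP
      have hkk : ∀ B, st.rreg 6 ≤ B → |G k| ≤ B → ∀ k' ≤ k, |G k'| ≤ B := by
        intro B hB hB' k' hk'
        rcases hk'.lt_or_eq with h | rfl
        · exact (hP1 k' h).trans hB
        · exact hB'
      have habs : |R| ≤ R := (abs_of_nonneg hR).le
      by_cases h1 : st.rreg 6 < G k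
      · have hpos : 0 < G k := lt_of_le_of_lt hP5 h1
        have h2 : ¬ (G k < -G k) := by linarith
        simp [Cmd.run, block, Instr.apply, State.setN, e6, g8, h1, hr2.r5, hr2.n7, hr2.r0, e26, h2,
          habs, hk, hpos.le]
        exact hkk _ h1.le (abs_of_pos hpos).le
      · by_cases h2 : st.rreg 6 < -G k
        · have hneg : G k < 0 := by linarith
          simp [Cmd.run, block, Instr.apply, State.setN, e6, g8, h1, hr2.r5, hr2.n7, hr2.r0, e26,
            h2, habs, hk, hneg.le]
          exact hkk _ h2.le (abs_of_neg hneg).le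
        · simp [Cmd.run, Instr.apply, State.setN, e6, e7, e25, g8, h1, hr2.r5, h2, hP2, hP3,
            hP4, hP5]
          exact hkk _ le_rfl (abs_le.2 ⟨by linarith, by linarith⟩))
  rw [hr1.n5] at hl
  obtain ⟨hP1, hP2, hP3, hP4, -⟩ := hl
  refine ⟨hP4, hP3, fun k hk => ?_⟩
  rw [hP2]
  exact neg_le_neg (mul_le_mul_of_nonneg_left (hP1 k hk) hR)

/-- After the loop, the coefficients in memory are the result of `m` steps of the conditional
gradient method. -/
theorem methodCmd_spec (h : Ready n D m base R X Y s) (hbase : m * (n + 1) ≤ base) (hR : 0 ≤ R)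
    (h4 : s.rreg 4 = 0) (h0 : ∀ k, s.rmem (base + k) = 0) :
    Ready n D m base R X Y (methodCmd.run s) ∧ ∃ c : ℕ → ℕ → ℝ, c 0 = 0 ∧
      (∀ t < m, GradientStep (heapSize n D) (sampleFeature n m X) (fun i => Y i) R t
        (c t) (c (t + 1))) ∧ ∀ k, (methodCmd.run s).rmem (base + k) = c m k := by
  have hl := run_loop (s := s) (i := 24) (b := 2) (c := block [bestCmd, updateCmd])
    (fun t st => Ready n D m base R X Y st ∧ st.rreg 4 = t ∧ ∃ c : ℕ → ℕ → ℝ, c 0 = 0 ∧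
      (∀ t' < t, GradientStep (heapSize n D) (sampleFeature n m X) (fun i => Y i) R t'
        (c t') (c (t' + 1))) ∧ ∀ k, st.rmem (base + k) = c t k)
    ⟨h.of_frame (w := fun l => instrWrites (nconst 24 0) l) rfl
        fun _ hl => instrWrites_spec hl s, by simp [State.setN, h4], fun _ => 0, rfl, by simp,
        by simpa [State.setN] using h0⟩
    (fun t _ st _ _ hP => by
      obtain ⟨hst, f4, c, hc0, hc1, hc2⟩ := hP
      obtain ⟨b1, b2, b3⟩ := bestCmd_spec hst hR f4
      have hr2 : Ready n D m base R X Y (bestCmd.run st) := hst.run rfl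
      have erm : (bestCmd.run st).rmem = st.rmem := run_rmem rfl st
      have e4 : (bestCmd.run st).rreg 4 = t := (run_rreg rfl st).trans f4
      simp only [run_block_cons, run_block_nil]
      set s2 := bestCmd.run st
      set j := s2.nreg 25 with hj
      have hrm : ((updateCmd.run s2).setN 24 (t + 1)).rmem =
          Function.update st.rmem (base + j) (st.rmem (base + j) + s2.rreg 7) := by
        simp [updateCmd, block, Cmd.run, Instr.apply, State.setN, hr2.n21, ← hj, erm]
      have hlow : ∀ a < base, ((updateCmd.run s2).setN 24 (t + 1)).rmem a = s2.rmem a := by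
        intro a ha
        rw [hrm, erm, Function.update_of_ne (by omega)]
      -- `Ready.of_frame` does not apply: the real memory is changed, though only beyond the sample.
      refine ⟨?_, ?_, fun t' => if t' ≤ t then c t' else
        Function.update (c t) j (c t j + s2.rreg 7), by simp [hc0], fun t' ht' => ?_, fun k => ?_⟩
      · have hS : ∀ i < m, ∀ j ≤ n, i * (n + 1) + j < base := by
          intro i hi j hj
          have : (i + 1) * (n + 1) ≤ m * (n + 1) := Nat.mul_le_mul_right _ hi
          rw [add_mul, one_mul] at this
          omega
        have hfr : ∀ l, (seq updateCmd (op (nconst 24 0))).writes l = false →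
            ((updateCmd.run s2).setN 24 (t + 1)).same s2 l := fun l hl => by
          simp only [writes, Bool.or_eq_false_iff] at hl
          refine State.same.trans ?_ (run_same hl.1 s2)
          cases l with
          | nreg x =>
            have := hl.2
            simp only [instrWrites, beq_eq_false_iff_ne] at this
            exact Function.update_of_ne this.symm _ _
          | _ => rfl
        exact ⟨Eq.trans (hfr (.nreg 0) rfl) hr2.n0, Eq.trans (hfr (.nreg 1) rfl) hr2.n1,
          Eq.trans (hfr (.nreg 2) rfl) hr2.n2, Eq.trans (hfr (.nreg 3) rfl) hr2.n3,
          Eq.trans (hfr (.nreg 5) rfl) hr2.n5, Eq.trans (hfr (.nreg 7) rfl) hr2.n7,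
          Eq.trans (hfr (.nreg 21) rfl) hr2.n21, Eq.trans (hfr (.rreg 0) rfl) hr2.r0,
          Eq.trans (hfr (.rreg 2) rfl) hr2.r2, Eq.trans (hfr (.rreg 3) rfl) hr2.r3,
          Eq.trans (hfr (.rreg 5) rfl) hr2.r5, hr2.table,
          fun i hi j hj => (hlow _ (hS i hi j hj.le)).trans (hr2.inputs i hi j hj),
          fun i hi => (hlow _ (hS i hi n le_rfl)).trans (hr2.labels i hi)⟩
      · simp [updateCmd, block, Cmd.run, Instr.apply, State.setN, e4, hr2.r3]
      · rcases Nat.lt_succ_iff_lt_or_eq.1 ht' with hlt | rfl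
        · beta_reduce
          rw [if_pos hlt.le, if_pos (by omega)]
          exact hc1 t' hlt
        · have hc : c t' = fun k => st.rmem (base + k) := funext fun k => (hc2 k).symm
          beta_reduce
          rw [if_pos le_rfl, if_neg (by omega)]
          refine ⟨j, b1, s2.rreg 7, b2, rfl, ?_⟩
          rw [hc]
          exact b3
      · beta_reduce
        rw [hrm, if_neg (by omega)]
        by_cases hkj : k = j
        · subst hkj; rw [Function.update_self, Function.update_self, hc2]
        · rw [Function.update_of_ne (by omega), Function.update_of_ne hkj, hc2])
  rw [h.n2] at hl
  exact ⟨hl.1, hl.2.2⟩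

theorem setupCmd_spec (h2 : s.nreg 2 = m) (h0 : s.nreg 0 = n) (hr2 : s.rreg 2 = 0) :
    (setupCmd.run s).nreg 21 = m * n + m + s.nreg 5 ∧ (setupCmd.run s).rreg 2 = m ∧
      (setupCmd.run s).rreg 3 = 1 := by
  simp only [setupCmd, run_block_cons, run_block_nil, run_op]
  set s1 := (rconst 3 1).apply ((nadd 21 21 5).apply ((nadd 21 21 2).apply
    ((mulCmd 21 2).run s))) with hs1
  have e21 : s1.nreg 21 = m * n + m + s.nreg 5 := by
    simp [hs1, Instr.apply, mul_nreg, mul_nreg_of_ne, h2, h0]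
  have e2 : s1.nreg 2 = m := by simp [hs1, Instr.apply, mul_nreg_of_ne, h2]
  have er3 : s1.rreg 3 = 1 := by simp [hs1, Instr.apply]
  have er2 : s1.rreg 2 = 0 := by simp [hs1, Instr.apply, mul_rreg, hr2]
  have hl := run_loop (s := s1) (i := 23) (b := 2) (c := op (radd 2 2 3))
    (fun k st => st.rreg 2 = k) (by simpa [State.setN] using er2)
    (fun k _ st hfr _ hP => by
      have f3 : st.rreg 3 = 1 := Eq.trans (hfr (.rreg 3) rfl) er3
      simp [Cmd.run, Instr.apply, State.setN, hP, f3])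
  rw [e2] at hl
  exact ⟨(run_nreg rfl s1).trans e21, hl, (run_rreg rfl s1).trans er3⟩

theorem copyCmd_spec (h : Ready n D m base R X Y s) (hbase : heapSize n D ≤ base) :
    ∀ k < heapSize n D, (copyCmd.run s).rmem k = s.rmem (base + k) / m := by
  have hl := run_loop (s := s) (i := 40) (b := 5) (c := block [op (nadd 41 21 40),
      op (rload 18 41), op (rdiv 18 18 2), op (rstore 40 18)])
    (fun K st => (∀ k < K, st.rmem k = s.rmem (base + k) / m) ∧
      ∀ a, base ≤ a → st.rmem a = s.rmem a)
    ⟨by simp, by simp [State.setN]⟩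
    (fun k hk st hfr hcnt hP => by
      rw [h.n5] at hk
      have f21 : st.nreg 21 = base := Eq.trans (hfr (.nreg 21) rfl) h.n21
      have f2 : st.rreg 2 = m := Eq.trans (hfr (.rreg 2) rfl) h.r2
      have hrm : (((block [op (nadd 41 21 40), op (rload 18 41), op (rdiv 18 18 2),
          op (rstore 40 18)]).run st).setN 40 (k + 1)).rmem =
          Function.update st.rmem k (s.rmem (base + k) / m) := by
        simp [block, Cmd.run, Instr.apply, State.setN, f21, f2, hcnt, hP.2]
      rw [hrm]
      refine ⟨fun k' hk' => ?_, fun a ha => ?_⟩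
      · rcases Nat.lt_succ_iff_lt_or_eq.1 hk' with hlt | rfl
        · rw [Function.update_of_ne (by omega), hP.1 k' hlt]
        · rw [Function.update_self]
      · rw [Function.update_of_ne (by omega), hP.2 a ha])
  rw [h.n5] at hl
  exact hl.1

end method

/-! ### Correctness of the solver -/

/-- The commands that follow the computation of the number of words. -/
def solveCmd : Cmd := block [tableCmd, setupCmd, methodCmd, copyCmd]

/-- The machine program for `ℓ₁`-constrained logistic regression. The loops of `solveCmd` are
bounded by the registers `4, 5`, so they run once `sizeCmd` has set these. -/
def solver : Program := .seq (.instr (nconst 3 1)) (.seq sizeCmd.compile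
  (.seq solveCmd.compile (.instr (nadd 0 5 7))))

section input

variable {n m D : ℕ} {R τ : ℝ} {S : Fin m → (Fin n → ℝ) × ℝ}

theorem inputState_input (i : Fin m) (j : Fin n) :
    (inputState D R τ S).rmem (i * (n + 1) + j) = (S i).1 j := by
  have hj : (j : ℕ) < n + 1 := by omega
  have h1 : ((i : ℕ) * (n + 1) + j) / (n + 1) = i := by
    rw [mul_comm, Nat.mul_add_div (Nat.succ_pos n), Nat.div_eq_of_lt hj, add_zero]
  have h2 : ((i : ℕ) * (n + 1) + j) % (n + 1) = j := by
    rw [mul_comm, Nat.mul_add_mod, Nat.mod_eq_of_lt hj]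
  simp [inputState, h1, h2]

theorem inputState_label (i : Fin m) :
    (inputState D R τ S).rmem (i * (n + 1) + n) = (S i).2 := by
  have h1 : ((i : ℕ) * (n + 1) + n) / (n + 1) = i := by
    rw [mul_comm, Nat.mul_add_div (Nat.succ_pos n), Nat.div_eq_of_lt (Nat.lt_succ_self n), add_zero]
  have h2 : ((i : ℕ) * (n + 1) + n) % (n + 1) = n := by
    rw [mul_comm, Nat.mul_add_mod, Nat.mod_eq_of_lt (Nat.lt_succ_self n)]
  simp [inputState, h1, h2]

theorem inputState_rmem_eq_zero {a : ℕ} (ha : m * (n + 1) ≤ a) :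
    (inputState D R τ S).rmem a = 0 := by
  have h : ¬ a / (n + 1) < m := not_lt.2 ((Nat.le_div_iff_mul_le (Nat.succ_pos n)).2 ha)
  simp only [inputState, dif_neg h]

/-- The solver halts in polynomial time; the output is the average of the vertices chosen in `m`
steps of the conditional gradient method. -/
theorem exec_solver (S : Fin m → (Fin n → ℝ) × ℝ) (τ : ℝ) {B : ℕ} (hR : 0 ≤ R) (hnB : n ≤ B)
    (hDB : D ≤ B) (hmB : m ≤ B) (hMB : heapSize n D ≤ B) (hn : 1 ≤ n) :
    ∃ (s : State) (t : ℕ), Exec solver (inputState D R τ S) s t ∧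
      t ≤ timeBound B (seq sizeCmd solveCmd) + 2 ∧ s.nreg 0 = heapSize n D ∧
      (∀ k < heapSize n D, ∀ j < n, s.nmem (k * n + j) = heapExp n k j) ∧
      ∃ c : ℕ → ℕ → ℝ, c 0 = 0 ∧ (∀ t < m, GradientStep (heapSize n D)
        (fun k i => heapFeature k (S i).1) (fun i => (S i).2) R t (c t) (c (t + 1))) ∧
        ∀ k < heapSize n D, s.rmem k = c m k / m := by
  set s0 := inputState D R τ S with hs0
  set s1 := (nconst 3 1).apply s0 with hs1
  have e10 : s1.nreg 0 = n := rfl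
  have e11 : s1.nreg 1 = D := rfl
  have e12 : s1.nreg 2 = m := rfl
  have e13 : s1.nreg 3 = 1 := rfl
  have e17 : s1.nreg 7 = 0 := rfl
  obtain ⟨t1, ht1, x1⟩ := exec_compile (c := sizeCmd) (B := B) (s := s1) rfl e13 (by
    simp [sizeCmd, block, bounds, e10, e11, hnB, hDB])
  obtain ⟨hsz1, hsz2⟩ := sizeCmd_spec e10 e11 rfl e17
  have f (l : Loc) (hl : sizeCmd.writes l = false) := run_same hl s1
  have e20 : (sizeCmd.run s1).nreg 0 = n := f (.nreg 0) rfl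
  have e21 : (sizeCmd.run s1).nreg 1 = D := f (.nreg 1) rfl
  have e22 : (sizeCmd.run s1).nreg 2 = m := f (.nreg 2) rfl
  have e23 : (sizeCmd.run s1).nreg 3 = 1 := f (.nreg 3) rfl
  have e27 : (sizeCmd.run s1).nreg 7 = 0 := f (.nreg 7) rfl
  have er20 : (sizeCmd.run s1).rreg 0 = R := f (.rreg 0) rfl
  have er22 : (sizeCmd.run s1).rreg 2 = 0 := f (.rreg 2) rfl
  have er24 : (sizeCmd.run s1).rreg 4 = 0 := f (.rreg 4) rfl
  have er25 : (sizeCmd.run s1).rreg 5 = 0 := f (.rreg 5) rfl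
  have em2 : ∀ a, (sizeCmd.run s1).nmem a = 0 := congrFun (f .nmem rfl)
  have erm2 : (sizeCmd.run s1).rmem = s0.rmem := f .rmem rfl
  set s2 := sizeCmd.run s1
  have h4B : s2.nreg 4 ≤ B := by
    have : s2.nreg 4 * 1 ≤ s2.nreg 4 * n := Nat.mul_le_mul_left _ hn
    omega
  obtain ⟨t2, ht2, x2⟩ := exec_compile (c := solveCmd) (B := B) (s := s2) rfl e23 (by
    intro b hb
    have hb' : b = 0 ∨ b = 1 ∨ b = 2 ∨ b = 4 ∨ b = 5 := by
      revert b; decide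
    rcases hb' with rfl | rfl | rfl | rfl | rfl <;> omega)
  have htab : ∀ k < heapSize n D, ∀ j < n, (tableCmd.run s2).nmem (k * n + j) = heapExp n k j := by
    rw [← hsz1, hsz2]
    exact tableCmd_spec e20 e23 rfl em2
  have g (l : Loc) (hl : tableCmd.writes l = false) := run_same hl s2
  have e35 : (tableCmd.run s2).nreg 5 = heapSize n D := Eq.trans (g (.nreg 5) rfl) hsz1
  obtain ⟨u1, u2, u3⟩ := setupCmd_spec (s := tableCmd.run s2) (Eq.trans (g (.nreg 2) rfl) e22)
    (Eq.trans (g (.nreg 0) rfl) e20) (Eq.trans (g (.rreg 2) rfl) er22)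
  rw [e35] at u1
  have hfr : ∀ l, setupCmd.writes l = false → tableCmd.writes l = false →
      (setupCmd.run (tableCmd.run s2)).same s2 l := fun l h1 h2 =>
    (run_same h1 _).trans (g l h2)
  have em4 : (setupCmd.run (tableCmd.run s2)).nmem = (tableCmd.run s2).nmem := run_nmem rfl _
  have erm4 : (setupCmd.run (tableCmd.run s2)).rmem = s0.rmem := Eq.trans (hfr .rmem rfl rfl) erm2
  have e44 : (setupCmd.run (tableCmd.run s2)).rreg 4 = 0 := Eq.trans (hfr (.rreg 4) rfl rfl) er24
  have hready : Ready n D m (m * n + m + heapSize n D) R (fun i j => s0.rmem (i * (n + 1) + j))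
      (fun i => s0.rmem (i * (n + 1) + n)) (setupCmd.run (tableCmd.run s2)) :=
    ⟨Eq.trans (hfr (.nreg 0) rfl rfl) e20, Eq.trans (hfr (.nreg 1) rfl rfl) e21,
      Eq.trans (hfr (.nreg 2) rfl rfl) e22, Eq.trans (hfr (.nreg 3) rfl rfl) e23,
      Eq.trans (hfr (.nreg 5) rfl rfl) hsz1, Eq.trans (hfr (.nreg 7) rfl rfl) e27, u1,
      Eq.trans (hfr (.rreg 0) rfl rfl) er20, u2, u3, Eq.trans (hfr (.rreg 5) rfl rfl) er25,
      em4 ▸ htab, fun i _ j _ => by rw [erm4], fun i _ => by rw [erm4]⟩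
  set s4 := setupCmd.run (tableCmd.run s2)
  have hbase : m * (n + 1) ≤ m * n + m + heapSize n D := by rw [mul_add, mul_one]; omega
  obtain ⟨hready', c, hc0, hc1, hc2⟩ := methodCmd_spec hready hbase hR e44 (fun k => by
    rw [erm4]; exact inputState_rmem_eq_zero (hbase.trans (Nat.le_add_right _ _)))
  have hcopy := copyCmd_spec hready' (Nat.le_add_left _ _)
  have hrun : solveCmd.run s2 = copyCmd.run (methodCmd.run s4) := rfl
  refine ⟨_, _, .seq (.instr _ _) (.seq x1 (.seq x2 (.instr _ _))), ?_, ?_, ?_, c, hc0,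
    fun t ht => ?_, fun k hk => ?_⟩
  · rw [timeBound]; omega
  · have v5 : (solveCmd.run s2).nreg 5 = heapSize n D := (run_nreg rfl _).trans hsz1
    have v7 : (solveCmd.run s2).nreg 7 = 0 := (run_nreg rfl _).trans e27
    simp [Instr.apply, v5, v7]
  · intro k hk j hj
    have v : (copyCmd.run (methodCmd.run s4)).nmem = (methodCmd.run s4).nmem := run_nmem rfl _
    change (solveCmd.run s2).nmem _ = _
    rw [hrun, v]
    exact hready'.table k hk j hj
  · have h := hc1 t ht
    have e1 : sampleFeature n m (fun i j => s0.rmem (i * (n + 1) + j)) =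
        fun k i => heapFeature k (S i).1 := by
      funext k i
      rw [sampleFeature, wordValue, heapFeature, Finset.prod_range]
      exact Finset.prod_congr rfl fun j _ => by rw [hs0, inputState_input]
    have e2 : (fun i : Fin m => s0.rmem (i * (n + 1) + n)) = fun i => (S i).2 :=
      funext fun i => inputState_label i
    rw [e1, e2] at h
    exact h
  · change (solveCmd.run s2).rmem k = _
    rw [hrun, hcopy k hk, hc2]

/-- The average of the vertices chosen by the conditional gradient method solves the regression
problem. -/
theorem isL1Regression_outputPolynomial {s : State} {c : ℕ → ℕ → ℝ} (hm : 0 < m) (hR : 0 < R)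
    (hmR : 2 * R ≤ m) (herr : 4 * R ^ 3 / m + 4 * R ^ 2 / √m ≤ τ)
    (hS : ∀ i, (∀ k, |(S i).1 k| ≤ 1) ∧ ((S i).2 = 1 ∨ (S i).2 = -1))
    (h0 : s.nreg 0 = heapSize n D)
    (htab : ∀ k < heapSize n D, ∀ j < n, s.nmem (k * n + j) = heapExp n k j) (hc0 : c 0 = 0)
    (hc1 : ∀ t < m, GradientStep (heapSize n D) (fun k i => heapFeature k (S i).1)
      (fun i => (S i).2) R t (c t) (c (t + 1)))
    (hc2 : ∀ k < heapSize n D, s.rmem k = c m k / m) :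
    IsL1Regression D R τ S (outputPolynomial n s) := by
  have hm' : (0 : ℝ) < m := Nat.cast_pos.2 hm
  obtain ⟨h1, h2⟩ := sampleLoss_gradient_method_le hm hR hmR (heapSize_pos n D)
    (fun k i => abs_heapFeature_le_one k (hS i).1) hc0 hm hc1
  have hout : outputPolynomial n s = ∑ k ∈ Finset.range (heapSize n D), MvPolynomial.monomial
      (Finsupp.equivFunOnFinite.symm fun i : Fin n => heapExp n k i) (c m k / m) := by
    rw [outputPolynomial, h0]
    refine Finset.sum_congr rfl fun k hk => ?_
    rw [hc2 k (Finset.mem_range.1 hk)]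
    congr 2
    exact congrArg _ (funext fun i => htab k (Finset.mem_range.1 hk) i i.2)
  have heval : ∀ x : Fin n → ℝ, MvPolynomial.eval x (outputPolynomial n s) =
      (∑ k ∈ Finset.range (heapSize n D), c m k * heapFeature k x) / m := by
    intro x
    rw [hout, map_sum, Finset.sum_div]
    refine Finset.sum_congr rfl fun k _ => ?_
    rw [MvPolynomial.eval_monomial, Finsupp.prod_fintype _ _ (fun _ => pow_zero _), heapFeature]
    simp only [Finsupp.equivFunOnFinite_symm_apply_apply]
    ring
  have hemp : ∀ v : (Fin n → ℝ) → ℝ,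
      empiricalRisk S v = sampleLoss (fun i => (S i).2) (fun i => v (S i).1) := by
    intro v
    rw [empiricalRisk, sampleLoss]
    congr 1
    exact Finset.sum_congr rfl fun i _ => logisticLoss_eq _ (hS i).2
  refine ⟨⟨?_, ?_⟩, fun q hq => ?_⟩
  · rw [hout]
    refine MvPolynomial.totalDegree_finsetSum_le fun k hk => ?_
    refine (MvPolynomial.totalDegree_monomial_le _ _).trans ?_
    rw [Finsupp.sum_fintype _ _ (fun _ => rfl)]
    exact sum_heapExp_le D (Finset.mem_range.1 hk)
  · rw [hout]
    refine (coeffNorm_sum_le _ _).trans ?_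
    simp only [coeffNorm_monomial, abs_div, ← Finset.sum_div, Nat.abs_cast]
    rw [div_le_iff₀ hm', mul_comm]
    exact h1
  · obtain ⟨b, hb1, hb2⟩ := hq.exists_heap_coeffs
    rw [hemp, hemp]
    simp only [heval, hb2]
    exact (h2 b hb1).trans (add_le_add_right herr _)

end input

/-- The lower bound on the degree forces `ε` to be at least inverse polynomial in `lam ^ D`. -/
theorem two_div_pow_le {T lam ε : ℝ} {D : ℕ} (hT : 1 ≤ T) (hlam : 2 ≤ lam) (hε : 0 < ε)
    (hD1 : 1 ≤ D) (hD : 100 * lam * Real.log (T * lam / ε) ≤ D) : 2 / lam ^ D ≤ ε := by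
  have hX : (2 : ℝ) ^ D ≤ lam ^ D := pow_le_pow_left₀ (by norm_num) hlam D
  have h2 : (2 : ℝ) ≤ 2 ^ D := by
    calc (2 : ℝ) = 2 ^ 1 := by norm_num
      _ ≤ 2 ^ D := pow_le_pow_right₀ (by norm_num) hD1
  rw [div_le_iff₀ (by linarith)]
  rcases le_total 1 ε with h | h
  · nlinarith
  · have hTl : 2 ≤ T * lam := by nlinarith
    have hA : 4 / 3 ≤ T * lam / ε := by rw [le_div_iff₀ hε]; linarith
    have h1 := (degree_bounds hlam hA hD).1.trans hX
    rw [div_le_iff₀ hε] at h1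
    linarith

end RBMRegression

end

theorem mainTheorem3 :
    ∃ (a c C : ℝ) (K : ℕ) (A : Program), 0 < a ∧ 0 < c ∧ 0 < C ∧
      ∀ (n N : ℕ) (net : Network n N) (P : Measure ((Fin n → ℝ) × ℝ)) (lam ε δ : ℝ) (D m : ℕ),
        1 ≤ n → IsProbabilityMeasure P → IsNetworkLaw net P →
        (∀ j, net.β j ∈ Set.Icc (0 : ℝ) 1) →
        2 ≤ lam → (∀ j, ∑ k, |net.W j k| ≤ lam) →
        0 < ε → 0 < δ → δ < 1 →
        1 ≤ D → c * lam * Real.log (max 1 net.topNorm * lam / ε) ≤ (D : ℝ) →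
        C * (|net.bias| ^ 2 + lam ^ (C * (D : ℝ))) * Real.log (2 * (n : ℝ) / δ) ≤ (m : ℝ) →
        -- with probability at least `1 - δ`, every solution has excess loss at most `ε`
        (Measure.pi fun _ : Fin m => P)
            {S | ¬ ∀ p : MvPolynomial (Fin n) ℝ,
              IsL1Regression D (lam ^ (a * (D : ℝ))) (ε / 4) S p →
                risk P (fun x => MvPolynomial.eval x p) - risk P net.preactivation ≤ ε}
            ≤ ENNReal.ofReal δ ∧
        -- the machine finds a solution in time polynomial in `m` and `n ^ D`
        ∀ S : Fin m → (Fin n → ℝ) × ℝ,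
          (∀ i, (∀ k, |(S i).1 k| ≤ 1) ∧ ((S i).2 = 1 ∨ (S i).2 = -1)) →
          ∃ (s : State) (t : ℕ),
            Exec A (inputState D (lam ^ (a * (D : ℝ))) (ε / 4) S) s t ∧
            t ≤ K * (m * n ^ D) ^ K ∧
            IsL1Regression D (lam ^ (a * (D : ℝ))) (ε / 4) S (outputPolynomial n s) := by
  obtain ⟨K, hK⟩ := Cmd.exists_timeBound_le (.seq sizeCmd solveCmd)
  refine ⟨10, 100, 100, K + 2, solver, by norm_num, by norm_num, by norm_num, ?_⟩
  intro n N net P lam ε δ D m hn hprob hP hβ hlam hW hε hδ hδ1 hD1 hD hm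
  have hlam0 : 0 < lam := by linarith
  set X := lam ^ D with hXdef
  have hDX : (2 : ℝ) ^ D ≤ X := pow_le_pow_left₀ (by norm_num) hlam D
  have hX : (2 : ℝ) ≤ X := le_trans (by
    calc (2 : ℝ) = 2 ^ 1 := by norm_num
      _ ≤ 2 ^ D := pow_le_pow_right₀ (by norm_num) hD1) hDX
  have hX0 : 0 < X := by linarith
  have hX1 : 1 ≤ X := by linarith
  have hrpow : ∀ k : ℕ, lam ^ ((k : ℝ) * (D : ℝ)) = X ^ k := fun k => by
    rw [mul_comm, Real.rpow_mul hlam0.le, Real.rpow_natCast, Real.rpow_natCast]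
  have hR : lam ^ ((10 : ℝ) * (D : ℝ)) = X ^ 10 := mod_cast hrpow 10
  have hC : lam ^ ((100 : ℝ) * (D : ℝ)) = X ^ 100 := mod_cast hrpow 100
  have hn' : (1 : ℝ) ≤ n := Nat.one_le_cast.2 hn
  have hL : 1 / 2 ≤ Real.log (2 * n / δ) := by
    have : Real.log 2 ≤ Real.log (2 * n / δ) :=
      Real.log_le_log (by norm_num) (by rw [le_div_iff₀ hδ]; nlinarith)
    linarith [Real.log_two_gt_d9]
  -- Everything is measured in powers of `X = lam ^ D`: the constraint is `X ^ 10`, the sample size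
  -- is at least `X ^ 100`, and `ε` is at least `2 / X`.
  rw [hC] at hm
  rw [hR]
  have hεX : 2 / X ≤ ε := two_div_pow_le (le_max_left _ _) hlam hε hD1 hD
  have hm1 : X ^ 100 * Real.log (2 * n / δ) * 100 ≤ m := by
    refine le_trans ?_ hm
    have : 0 ≤ |net.bias| ^ 2 * Real.log (2 * n / δ) := by positivity
    linarith
  have hX100 : (0 : ℝ) < X ^ 100 := by positivity
  have hm2 : X ^ 100 ≤ m := by nlinarith
  refine ⟨measure_excess_risk_le hn hP hβ hlam hW hε hδ hδ1 hD1 hD hεX ?_, fun S hS => ?_⟩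
  · have : X ^ 80 * Real.log (2 * n / δ) ≤ X ^ 100 * Real.log (2 * n / δ) := by
      gcongr; norm_num
    have : 0 ≤ X ^ 100 * Real.log (2 * n / δ) := by positivity
    linarith
  · -- All quantities that bound a loop of the solver are at most `m * n ^ D`.
    have hm0' : (0 : ℝ) < m := by linarith
    have hm0 : 0 < m := by exact_mod_cast hm0'
    have hDm : D + 1 ≤ m := by
      have h1 : (D : ℝ) + 1 ≤ 2 ^ D := by exact_mod_cast Nat.lt_two_pow_self (n := D)
      have h2 : X ≤ X ^ 100 := le_self_pow₀ hX1 (by norm_num)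
      have : (D : ℝ) + 1 ≤ m := by linarith
      exact_mod_cast this
    have hnD : n ≤ n ^ D := Nat.le_self_pow (by omega) n
    have hnD1 : 1 ≤ n ^ D := hn.trans hnD
    have hmB : m ≤ m * n ^ D := Nat.le_mul_of_pos_right m hnD1
    obtain ⟨s, t, hexec, ht, h0, htab, c, hc0, hc1, hc2⟩ := exec_solver (D := D) (R := X ^ 10)
      (B := m * n ^ D) S (ε / 4) (by positivity)
      (hnD.trans (Nat.le_mul_of_pos_left _ hm0)) (by omega) hmB
      ((heapSize_le hn D).trans (Nat.mul_le_mul_right _ hDm)) hn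
    have hB1 : 1 ≤ m * n ^ D := Nat.mul_pos hm0 hnD1
    refine ⟨s, t, hexec, ht.trans ?_, ?_⟩
    · have h1 := hK _ hB1
      have h2 : (m * n ^ D) ^ K ≤ (m * n ^ D) ^ (K + 2) := Nat.pow_le_pow_right hB1 (by omega)
      have h3 : 1 ≤ (m * n ^ D) ^ (K + 2) := Nat.one_le_pow _ _ hB1
      calc _ ≤ K * (m * n ^ D) ^ K + 2 := by omega
        _ ≤ K * (m * n ^ D) ^ (K + 2) + 2 * (m * n ^ D) ^ (K + 2) := by gcongr; omega
        _ = _ := by ring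
    · have hX28 : (16 : ℝ) ≤ X ^ 28 := by
        calc (16 : ℝ) ≤ 2 ^ 28 := by norm_num
          _ ≤ X ^ 28 := pow_le_pow_left₀ (by norm_num) hX 28
      refine isL1Regression_outputPolynomial hm0 (by positivity) ?_ ?_ hS h0 htab hc0 hc1 hc2
      · calc 2 * X ^ 10 ≤ X * X ^ 10 := by gcongr
          _ = X ^ 11 := by ring
          _ ≤ X ^ 100 := pow_le_pow_right₀ hX1 (by norm_num)
          _ ≤ m := hm2
      · have hsqrt : X ^ 50 ≤ √m := Real.le_sqrt_of_sq_le (by rw [← pow_mul]; exact hm2)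
        have h1 : 4 * (X ^ 10) ^ 3 / m ≤ 4 * (X ^ 10) ^ 3 / X ^ 100 := by gcongr
        have h2 : 4 * (X ^ 10) ^ 2 / √m ≤ 4 * (X ^ 10) ^ 2 / X ^ 50 := by gcongr
        have h3 : 4 * (X ^ 10) ^ 3 / X ^ 100 = 4 / X ^ 70 := by field_simp
        have h4 : 4 * (X ^ 10) ^ 2 / X ^ 50 = 4 / X ^ 30 := by field_simp
        have h5 : 4 / X ^ 70 ≤ 4 / X ^ 30 := by gcongr; norm_num
        have h6 : 4 / X ^ 30 * 2 ≤ 2 / X / 4 := by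
          rw [div_div, div_mul_eq_mul_div, div_le_div_iff₀ (by positivity) (by positivity)]
          calc 4 * 2 * (X * 4) = 2 * (16 * X) := by ring
            _ ≤ 2 * (X ^ 28 * X) := by gcongr
            _ = 2 * X ^ 29 := by ring
            _ ≤ 2 * X ^ 30 := by gcongr; norm_num
        linarith
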